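/- **Setting.** Let $d\ge 2$ and let $E_d$ be the set of nearest-neighbour bonds of $\mathbb Z^d$. Let $\Omega=[0,\infty)^{E_d}$ carry the product Borel $\sigma$-algebra, with shifts $(\tau_z\omega)(\{x,y\})=\omega(\{x+z,y+z\})$. A bond $e$ is *open* if $\omega(e)>0$; write $x\sim y$ if $\{x,y\}$ is open. Let $\mathcal C_\infty(\omega)$ be the set of vertices in infinite open clusters, $d^\omega$ the graph distance of the open graph, $B^\omega(x,r)=\{y\in\mathcal C_\infty(\omega): d^\omega(x,y)\le\lfloor r\rfloor\}$ and $B^\omega(r)=B^\omega(0,r)$. Let $\mathbb P$ be a probability measure on $\Omega$ that is stationary and ergodic under the shifts, with $\mathbb E[\omega(e)]<\infty$ for every $e$, with $\mathbb P$-a.s. exactly one infinite open cluster, and with $\mathbb P[0\in\mathcal C_\infty]>0$. Put $\mathbb P_0=\mathbb P[\,\cdot\mid 0\in\mathcal C_\infty]$. Fix constants $C_V\in(0,1]$, $C_{\rm riso}\in(0,\infty)$, $C_W\in[1,\infty)$. A ball $B^\omega(x,r)$ is *regular* if $C_V r^d\le|B^\omega(x,r)|$ and there is a connected set $S\subset\mathcal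 C_\infty(\omega)$ with $B^\omega(x,r)\subset S\subset B^\omega(x,C_W r)$ such that, for every $A\subset S$ with $|A|\le\frac12|S|$, the number of open bonds between $A$ and $S\setminus A$ is at least $C_{\rm riso}\,r^{-1}|A|$. *Corrector.* $L^2_{\rm cov}$ is the space of measurable $\Psi:\Omega\times\mathbb Z^d\to\mathbb R$ with $\mathbb E_0\big[\sum_{x\sim0}\omega(\{0,x\})\Psi(\omega,x)^2\big]<\infty$ and, for $\mathbb P_0$-a.e. $\omega$, $\Psi(\tau_x\omega,y-x)=\Psi(\omega,y)-\Psi(\omega,x)$ for all $x,y\in\mathcal C_\infty(\omega)$. It carries the corresponding inner product. $L^2_{\rm pot}$ is the closure in $L^2_{\rm cov}$ of the gradients $(\omega,x)\mapsto\varphi(\tau_x\omega)-\varphi(\omega)$, where $\varphi$ is bounded, measurable and depends on finitely many conductances; $L^2_{\rm sol}$ is its orthogonal complement in $L^2_{\rm cov}$. The corrector component $\chi_j$ ($j=1,\dots,d$) is the $L^2_{\rm pot}$-part of the field $(\omega,x)\mapsto x_j$ in $L^2_{\rm cov}=L^2_{\rm pot}\oplus L^2_{\rm sol}$. *Weights and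 norms.* $\mu^\omega(x)=\sum_{y\sim x}\omega(\{x,y\})$ and $\nu^\omega(x)=\sum_{y\sim x}\omega(\{x,y\})^{-1}$. For a finite non-empty set $A$, $\|f\|_{p,A}=\big(|A|^{-1}\sum_{x\in A}|f(x)|^p\big)^{1/p}$ for $0<p<\infty$, and $\|f\|_{\infty,A}=\max_A|f|$. **Proposition (maximal inequality).** Let $\theta\in(0,1)$ and $p,q\in[1,\infty]$ satisfy $$\frac1p+\frac1q<\frac{2(1-\theta)}{d-\theta}.$$ Then for every $\alpha>0$ there exist $\gamma'>0$, $\kappa'>0$ and $c<\infty$, depending only on $\alpha,p,q,\theta,d$ and $C_V,C_{\rm riso},C_W$, such that the following holds for every law $\mathbb P$ as above that satisfies the two conditions 1. for $\mathbb P_0$-a.e. $\omega$ there is $N_0(\omega)<\infty$ such that for all $n\ge N_0(\omega)$ the ball $B^\omega(x,r)$ is regular for every $x\in B^\omega(n)$ and every real $r\ge n^{\theta/d}$; 2. $\mathbb E[\omega(e)^p]<\infty$ and $\mathbb E[\omega(e)^{-q}\mathbf 1_{\omega(e)>0}]<\infty$ for every $e\in E_d$ (essential boundedness of $\omega(e)$,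 respectively of $\omega(e)^{-1}\mathbf 1_{\omega(e)>0}$, if the exponent is $\infty$). For $\mathbb P_0$-a.e. $\omega$ there is $N(\omega)<\infty$ such that, for all $n\ge N(\omega)$ and all $j=1,\dots,d$, $$\max_{x\in B^\omega(n)}\Big|\tfrac1n\chi_j(\omega,x)\Big|\;\le\; c\,\Big(1\vee\|\mu^\omega\|_{p,B^\omega(n)}\,\|\nu^\omega\|_{q,B^\omega(n)}\Big)^{\kappa'}\,\Big\|\tfrac1n\chi_j(\omega,\cdot)\Big\|_{\alpha,B^\omega(2n)}^{\gamma'} .$$ -/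

import Mathlib

open MeasureTheory ProbabilityTheory
open scoped NNReal ENNReal

namespace RCM

noncomputable section

/-- Vertices of the Euclidean lattice. -/
abbrev Site (d : ℕ) : Type := Fin d → ℤ

/-- The lattice graph: `x` and `y` are adjacent iff their `ℓ¹`-distance is one. -/
def lattice (d : ℕ) : SimpleGraph (Site d) where
  Adj x y := ∑ i, |x i - y i| = 1
  symm := ⟨fun x y h => by simpa only [abs_sub_comm] using h⟩
  loopless := ⟨fun x h => by simp at h⟩

/-- Non-oriented nearest neighbour bonds. -/
abbrev Bond (d : ℕ) : Type := (lattice d).edgeSet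

/-- The environment space `[0, ∞)^E`, with the product Borel `σ`-algebra. -/
abbrev Env (d : ℕ) : Type := Bond d → ℝ≥0

variable {d : ℕ}

/-- The lattice neighbours of `x`, as a finite set. -/
def nbrs (x : Site d) : Finset (Site d) :=
  open scoped Classical in
  (Finset.Icc (x - 1) (x + 1)).filter fun y => (lattice d).Adj x y

theorem mem_nbrs {x y : Site d} : y ∈ nbrs x ↔ (lattice d).Adj x y := by
  classical
  simp only [nbrs, Finset.mem_filter, Finset.mem_Icc, and_iff_right_iff_imp]
  intro h
  have h1 : ∀ i, |x i - y i| ≤ 1 := fun i => by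
    have h2 : ∑ i, |x i - y i| = 1 := h
    rw [← h2]
    exact Finset.single_le_sum (f := fun i => |x i - y i|)
      (fun _ _ => abs_nonneg _) (Finset.mem_univ i)
  constructor <;> intro i <;> have := abs_le.1 (h1 i) <;>
    simp only [Pi.sub_apply, Pi.add_apply, Pi.one_apply] <;> omega

/-- Translation `x ↦ x + z` as an automorphism of the lattice graph. -/
def transl (z : Site d) : lattice d ≃g lattice d where
  toEquiv := Equiv.addRight z
  map_rel_iff' := by intro x y; simp [lattice]

/-- The shift of environments, `(τ_z ω)({x, y}) = ω({x + z, y + z})`. -/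
def shift (z : Site d) (ω : Env d) : Env d := fun e => ω ((transl z).mapEdgeSet e)

/-- The conductance between `x` and `y`; it is zero if `{x, y}` is not a bond. -/
def conductance (ω : Env d) (x y : Site d) : ℝ≥0 :=
  open scoped Classical in
  if h : (lattice d).Adj x y then ω ⟨s(x, y), (lattice d).mem_edgeSet.2 h⟩ else 0

/-- The graph of open bonds, i.e. bonds with positive conductance. -/
def openGraph (ω : Env d) : SimpleGraph (Site d) where
  Adj x y := ∃ h : (lattice d).Adj x y, 0 < ω ⟨s(x, y), (lattice d).mem_edgeSet.2 h⟩
  symm := ⟨by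
    rintro x y ⟨h, hω⟩
    refine ⟨h.symm, ?_⟩
    have : (⟨s(y, x), (lattice d).mem_edgeSet.2 h.symm⟩ : Bond d) = ⟨s(x, y), (lattice d).mem_edgeSet.2 h⟩ := Subtype.ext Sym2.eq_swap
    rwa [this]⟩
  loopless := ⟨fun x h => (lattice d).loopless.irrefl x h.1⟩

/-- `C_∞(ω)`: vertices lying in infinite connected components of the open graph. -/
def cluster (ω : Env d) : Set (Site d) :=
  {x | ((openGraph ω).connectedComponentMk x).supp.Infinite}

/-- The closed ball in `C_∞(ω)` with respect to the graph distance of the open graph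
(`edist` is the graph distance, with value `⊤` between different components). -/
def ball (ω : Env d) (x : Site d) (r : ℝ) : Set (Site d) :=
  {y | y ∈ cluster ω ∧ (openGraph ω).edist x y ≤ (⌊r⌋₊ : ℕ∞)}

/-- The relative boundary of `A` in `B`: open bonds joining `A` to `B \ A`. -/
def relBoundary (ω : Env d) (B A : Set (Site d)) : Set (Sym2 (Site d)) :=
  {e | ∃ x ∈ A, ∃ y ∈ B \ A, (openGraph ω).Adj x y ∧ e = s(x, y)}

/-- Regularity of the ball with centre `x` and radius `r`: volume regularity of order `d` and
the weak relative isoperimetric inequality. -/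
def IsRegularBall (CV Criso CW : ℝ) (ω : Env d) (x : Site d) (r : ℝ) : Prop :=
  CV * r ^ d ≤ ((ball ω x r).ncard : ℝ) ∧
  ∃ S : Set (Site d), S ⊆ cluster ω ∧ ((openGraph ω).induce S).Connected ∧
    ball ω x r ⊆ S ∧ S ⊆ ball ω x (CW * r) ∧
    ∀ A ⊆ S, (A.ncard : ℝ) ≤ 1 / 2 * (S.ncard : ℝ) →
      Criso * r⁻¹ * (A.ncard : ℝ) ≤ ((relBoundary ω S A).ncard : ℝ)

/-- The ball with centre `0` and radius `n` is `θ`-very regular. -/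
def IsVeryRegular (CV Criso CW θ : ℝ) (ω : Env d) (n : ℕ) : Prop :=
  ∀ x ∈ ball ω 0 n, ∀ r : ℝ, (n : ℝ) ^ (θ / d) ≤ r → IsRegularBall CV Criso CW ω x r

/-- Environments for which the origin lies in an infinite cluster. -/
def Env0 (d : ℕ) : Set (Env d) := {ω | (0 : Site d) ∈ cluster ω}

/-- The conditional law given that the origin lies in an infinite cluster. -/
def condLaw (P : Measure (Env d)) : Measure (Env d) := ProbabilityTheory.cond P (Env0 d)

/-- Stationarity, ergodicity, integrability of the conductances, and existence and uniqueness
of the infinite open cluster. -/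
structure LawAssumption (P : Measure (Env d)) : Prop where
  stationary : ∀ z : Site d, MeasurePreserving (shift z) P P
  ergodic : ∀ A : Set (Env d), MeasurableSet A → (∀ z : Site d, shift z ⁻¹' A = A) →
    P A = 0 ∨ P A = 1
  integrable : ∀ e : Bond d, Integrable (fun ω : Env d => (ω e : ℝ)) P
  unique_cluster : ∀ᵐ ω ∂P, ∃! C : (openGraph ω).ConnectedComponent, C.supp.Infinite
  origin_pos : 0 < P (Env0 d)

/-- Almost surely, all large balls around the origin are `θ`-very regular. -/
def ClusterAssumption (CV Criso CW θ : ℝ) (P : Measure (Env d)) : Prop :=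
  ∀ᵐ ω ∂(condLaw P), ∃ N₀ : ℕ, ∀ n : ℕ, N₀ ≤ n → IsVeryRegular CV Criso CW θ ω n

/-- `E[ω(e)^p] < ∞` and `E[ω(e)^(-q) 1_{ω(e) > 0}] < ∞` for all bonds, read as essential
boundedness when the exponent is infinite. -/
structure MomentAssumption (p q : ℝ≥0∞) (P : Measure (Env d)) : Prop where
  upper : ∀ e : Bond d, MemLp (fun ω : Env d => (ω e : ℝ)) p P
  lower : ∀ e : Bond d, MemLp (fun ω : Env d => if 0 < ω e then ((ω e : ℝ))⁻¹ else 0) q P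

/-- The measure `μ^ω(x) = ∑_{y ∼ x} ω({x, y})`. -/
def mu (ω : Env d) (x : Site d) : ℝ := ∑ y ∈ nbrs x, (conductance ω x y : ℝ)

/-- The measure `ν^ω(x) = ∑_{y ∼ x} 1 / ω({x, y})`, the sum being over open bonds. -/
def nu (ω : Env d) (x : Site d) : ℝ :=
  ∑ y ∈ nbrs x, if 0 < conductance ω x y then 1 / (conductance ω x y : ℝ) else 0

/-- The space-averaged norm of `f` over a finite non-empty set `A`, with exponent `p ∈ (0, ∞]`;
for `p = ∞` it is the maximum of `|f|` over `A`. -/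
def avgNorm (p : ℝ≥0∞) (A : Set (Site d)) (f : Site d → ℝ) : ℝ :=
  open scoped Classical in
  if p = ⊤ then ⨆ x : A, |f x|
  else ((A.ncard : ℝ)⁻¹ * ∑ᶠ x ∈ A, |f x| ^ p.toReal) ^ (1 / p.toReal)

/-- Random fields on the lattice. -/
abbrev RandomField (d : ℕ) : Type := Env d → Site d → ℝ

/-- The cocycle property, almost surely on the infinite cluster. -/
def IsCocycle (P : Measure (Env d)) (Ψ : RandomField d) : Prop :=
  ∀ᵐ ω ∂(condLaw P), ∀ x ∈ cluster ω, ∀ y ∈ cluster ω,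
    Ψ (shift x ω) (y - x) = Ψ ω y - Ψ ω x

/-- The squared norm `E₀[∑_{x ∼ 0} ω({0, x}) |Ψ(ω, x)|²]`. -/
def covNormSq (P : Measure (Env d)) (Ψ : RandomField d) : ℝ≥0∞ :=
  ∫⁻ ω, ∑ x ∈ nbrs (0 : Site d), ENNReal.ofReal ((conductance ω 0 x : ℝ) * Ψ ω x ^ 2) ∂(condLaw P)

/-- The inner product `E₀[∑_{x ∼ 0} ω({0, x}) Ψ(ω, x) Θ(ω, x)]`. -/
def covInner (P : Measure (Env d)) (Ψ Θ : RandomField d) : ℝ :=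
  ∫ ω, ∑ x ∈ nbrs (0 : Site d), (conductance ω 0 x : ℝ) * Ψ ω x * Θ ω x ∂(condLaw P)

/-- The space of square integrable covariant fields. -/
def L2cov (P : Measure (Env d)) : Set (RandomField d) :=
  {Ψ | (∀ x, Measurable fun ω => Ψ ω x) ∧ IsCocycle P Ψ ∧ covNormSq P Ψ < ⊤}

/-- The horizontal gradient `Dφ(ω, x) = φ(τ_x ω) - φ(ω)`. -/
def hgrad (φ : Env d → ℝ) : RandomField d := fun ω x => φ (shift x ω) - φ ω

/-- Bounded measurable functions that depend on finitely many conductances only. -/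
def IsBoundedLocal (φ : Env d → ℝ) : Prop :=
  Measurable φ ∧ (∃ C : ℝ, ∀ ω, |φ ω| ≤ C) ∧ ∃ F : Finset (Bond d), DependsOn φ (F : Set (Bond d))

/-- The potential fields: closure of the gradients of bounded local functions. -/
def L2pot (P : Measure (Env d)) : Set (RandomField d) :=
  {Ψ | Ψ ∈ L2cov P ∧
    ∀ ε : ℝ≥0∞, 0 < ε → ∃ φ, IsBoundedLocal φ ∧ covNormSq P (Ψ - hgrad φ) < ε}

/-- The solenoidal fields: orthogonal complement of the potential fields. -/
def L2sol (P : Measure (Env d)) : Set (RandomField d) :=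
  {Ψ | Ψ ∈ L2cov P ∧ ∀ Θ ∈ L2pot P, covInner P Ψ Θ = 0}

/-- The `j`-th coordinate of the position field. -/
def position (j : Fin d) : RandomField d := fun _ x => (x j : ℝ)

/-- `χ` is (a version of) the `j`-th component of the corrector: the potential part in the
orthogonal decomposition of the `j`-th coordinate of the position field. -/
def IsCorrector (P : Measure (Env d)) (j : Fin d) (χ : RandomField d) : Prop :=
  χ ∈ L2pot P ∧ position j - χ ∈ L2sol P

end

end RCM

open RCM

/-! Divided by `n`, the corrector becomes a function `u` on the infinite cluster with `div (ω ∇u) =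
div (ω ∇f)`, where `f = x_j / n` varies by at most `1 / n` along bonds. The estimate is Moser's
iteration for this degenerate equation: unbounded conductances are paid for by the norms of `μ` and
`ν`, the irregular geometry by `θ`.

Geometry. Only balls of radius at least `n^(θ/d)` are known to be regular. Covering a set by such
balls yields the Euclidean isoperimetric inequality for sets of more than about `n^θ` points; for
smaller sets all that is used is that their boundary is non-empty. Both facts fit into one
isoperimetric inequality of dimension `D = (d - θ) / (1 - θ)` (`exists_isoperimetric`), and the
condition on the exponents reads `1/p + 1/q < 2/D`.

Analysis. Isoperimetry gives a weighted Sobolev inequality (`sobolev_two`), and testing the equation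
with powers of `v = u⁺ + k` gives a Caccioppoli inequality (`energy_le`); the shift `k` absorbs the
right-hand side. Together they raise integrability by the factor `σ / p' > 1` (`moser_step`). The
iteration halves integer radii, so it stops after logarithmically many steps, and passing from the
last exponent to the maximum costs only a power of the ratio of scales. Choosing `k` as a power of
the `α`-average of `u` turns the bound into one that vanishes with that average
(`maximal_inequality`), provided the average is at most one.

Sublinearity. This proviso forces a qualitative result first: `χ_j` is sublinear (`ae_sublinear`). A
potential field is, up to a small `L²`-error, the gradient of a bounded function; an `L¹` Poincaré
inequality makes the mean oscillation of `χ_j / n` tend to zero, and the maximal inequality with `α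
= 1` upgrades this to uniform convergence.

Ergodic theory. The analysis sees weights on `B(2n)`, the theorem averages them over `B(n)`, and the
constant must not depend on the law. Sums over both balls are therefore compared with `n^d` times
the same mean: from above by a weak-type maximal inequality on boxes, from below by a Vitali
covering inside the ball (`eventually_sum_ballF_two_mul_le`). -/

namespace RCM

/-! ### Layer-cake principle and the `ℓ¹` Sobolev inequality on finite networks. -/

section Network
open scoped Classical

/-- Discrete layer-cake principle: a sublinear functional dominated by a total variation on
indicators of a hereditary family of sets is dominated on all functions supported there. -/
theorem layer_cake {V : Type} [Fintype V] (b : V → V → ℝ) (F : (V → ℝ) → ℝ)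
    (hadd : ∀ g h : V → ℝ, (∀ x, 0 ≤ g x) → (∀ x, 0 ≤ h x) → F (g + h) ≤ F g + F h)
    (hsmul : ∀ (t : ℝ) (g : V → ℝ), 0 ≤ t → (∀ x, 0 ≤ g x) → F (t • g) ≤ t * F g)
    (hzero : F 0 ≤ 0) (𝒜 : Finset V → Prop) (hmono : ∀ A B, A ⊆ B → 𝒜 B → 𝒜 A)
    (hind : ∀ A : Finset V, A.Nonempty → 𝒜 A → F (fun x => if x ∈ A then 1 else 0) ≤
      ∑ x, ∑ y, b x y * |(if x ∈ A then (1 : ℝ) else 0) - (if y ∈ A then 1 else 0)|)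
    (g : V → ℝ) (hg : ∀ x, 0 ≤ g x) (hs : 𝒜 (Finset.univ.filter fun x => 0 < g x)) :
    F g ≤ ∑ x, ∑ y, b x y * |g x - g y| := by
  induction hc : (Finset.univ.filter fun x => 0 < g x).card using Nat.strong_induction_on
    generalizing g with
  | _ c ih =>
    set A := Finset.univ.filter fun x => 0 < g x with hA
    rcases A.eq_empty_or_nonempty with h0 | hne
    · have : g = 0 := by
        funext x
        have : x ∉ A := by simp [h0]
        simp only [hA, Finset.mem_filter, Finset.mem_univ, true_and, not_lt] at this
        exact le_antisymm this (hg x)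
      subst this
      simpa using hzero
    -- The lowest positive level `t` is peeled off: `g = t 1_A + g'`, where `g'` has smaller support
    -- since the minimiser drops out. Total variation is exactly additive along this splitting,
    -- because both pieces change in the same direction across each edge; for `F` subadditivity is
    -- enough.
    · obtain ⟨z, hz, hmin⟩ := A.exists_min_image g hne
      have hzpos : 0 < g z := by simpa [hA] using hz
      set t := g z
      set g' : V → ℝ := fun x => if x ∈ A then g x - t else 0 with hg'
      have hout : ∀ x, x ∉ A → g x = 0 := fun x hx => by
        simp only [hA, Finset.mem_filter, Finset.mem_univ, true_and, not_lt] at hx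
        exact le_antisymm hx (hg x)
      have hg'0 : ∀ x, 0 ≤ g' x := fun x => by
        by_cases hx : x ∈ A
        · simpa [hg', hx] using hmin x hx
        · simp [hg', hx]
      have hsplit : g = t • (fun x => if x ∈ A then (1 : ℝ) else 0) + g' := by
        funext x
        by_cases hx : x ∈ A
        · simp [hg', hx]
        · simp [hg', hx, hout x hx]
      have hsub : (Finset.univ.filter fun x => 0 < g' x) ⊆ A := fun x hx => by
        by_contra h
        simp [hg', h] at hx
      have hlt : (Finset.univ.filter fun x => 0 < g' x).card < c := by
        rw [← hc]
        refine Finset.card_lt_card (Finset.ssubset_iff_subset_ne.2 ⟨hsub, fun h => ?_⟩)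
        rw [← h] at hz
        simp [hg', t] at hz
      have hrec := ih _ hlt g' hg'0 (hmono _ _ hsub hs) rfl
      have h1 := hadd (t • (fun x => if x ∈ A then (1 : ℝ) else 0)) g'
        (fun x => by by_cases hx : x ∈ A <;> simp [hx, hzpos.le]) hg'0
      rw [← hsplit] at h1
      have h2 := hsmul t (fun x => if x ∈ A then (1 : ℝ) else 0) hzpos.le
        (fun x => by by_cases hx : x ∈ A <;> simp [hx])
      have h3 := mul_le_mul_of_nonneg_left (hind A hne hs) hzpos.le
      have h4 : ∑ x, ∑ y, b x y * |g x - g y| =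
          t * (∑ x, ∑ y, b x y * |(if x ∈ A then (1 : ℝ) else 0) - (if y ∈ A then 1 else 0)|) +
          ∑ x, ∑ y, b x y * |g' x - g' y| := by
        simp only [Finset.mul_sum, ← Finset.sum_add_distrib]
        refine Finset.sum_congr rfl fun x _ => Finset.sum_congr rfl fun y _ => ?_
        by_cases hx : x ∈ A <;> by_cases hy : y ∈ A
        · simp [hg', hx, hy]
        · have := hmin x hx
          simp only [hg', hx, hy, hout y hy, if_true, if_false, sub_zero, abs_one]
          rw [abs_of_nonneg (hg x), abs_of_nonneg (by linarith)]; ring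
        · have := hmin y hy
          simp only [hg', hx, hy, hout x hx, if_true, if_false, zero_sub, abs_neg, abs_one]
          rw [abs_of_nonneg (hg y), abs_of_nonneg (by linarith)]; ring
        · simp [hg', hx, hy, hout x hx, hout y hy]
      rw [h4]
      linarith

/-- A finite weighted graph together with a height function that varies by at most one along
the edges. -/
structure Network (V : Type) [Fintype V] where
  w : V → V → ℝ
  ρ : V → ℕ
  symm : ∀ x y, w x y = w y x
  nonneg : ∀ x y, 0 ≤ w x y
  lip : ∀ x y, 0 < w x y → ρ y ≤ ρ x + 1

namespace Network
variable {V : Type} [Fintype V] (G : Network V)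

/-- The number of pairs in the edge boundary of `A`. -/
noncomputable def bdry (A : Finset V) : ℝ :=
  ∑ x ∈ A, ∑ y ∈ Aᶜ, if 0 < G.w x y then 1 else 0

/-- Isoperimetric inequality of dimension `D` for sets of height less than `R`. -/
def Iso (D CI L N : ℝ) (R : ℕ) : Prop :=
  ∀ A : Finset V, A.Nonempty → (∀ x ∈ A, G.ρ x < R) →
    ((A.card : ℝ) / N) ^ (1 - 1 / D) ≤ CI * (L / N) * G.bdry A

theorem sum_abs_indicator (A : Finset V) :
    ∑ x, ∑ y, (if 0 < G.w x y then (1 : ℝ) else 0) *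
      |(if x ∈ A then (1 : ℝ) else 0) - (if y ∈ A then 1 else 0)| = 2 * G.bdry A := by
  have h : ∀ x y, (if 0 < G.w x y then (1 : ℝ) else 0) *
      |(if x ∈ A then (1 : ℝ) else 0) - (if y ∈ A then 1 else 0)| =
      (if x ∈ A then (if y ∈ Aᶜ then (if 0 < G.w x y then (1 : ℝ) else 0) else 0) else 0) +
      (if y ∈ A then (if x ∈ Aᶜ then (if 0 < G.w y x then (1 : ℝ) else 0) else 0) else 0) := by
    intro x y
    rw [G.symm y x]
    by_cases hx : x ∈ A <;> by_cases hy : y ∈ A <;> simp [hx, hy]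
  simp only [h, Finset.sum_add_distrib]
  rw [Finset.sum_comm (f := fun x y => if y ∈ A then _ else _), two_mul]
  have h2 : ∑ x, ∑ y, (if x ∈ A then (if y ∈ Aᶜ then (if 0 < G.w x y then (1 : ℝ) else 0) else 0)
      else 0) = G.bdry A := by
    unfold bdry
    rw [← Finset.sum_filter_add_sum_filter_not Finset.univ (· ∈ A)]
    simp only [Finset.filter_mem_eq_inter, Finset.univ_inter]
    rw [Finset.sum_eq_zero (s := Finset.univ.filter (· ∉ A)), add_zero]
    · refine Finset.sum_congr rfl fun x hx => ?_
      simp only [hx, if_true]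
      rw [← Finset.sum_filter]
      congr 1
      ext; simp
    · intro x hx
      simp at hx
      simp [hx]
  rw [h2]

/-- The Federer–Fleming argument: the norm with exponent `D / (D - 1)` is subadditive by Minkowski
and equals `(|A| / N)^(1 - 1/D)` on indicators, so `layer_cake` reduces the claim to `Iso`. The sum
over ordered pairs counts boundary edges twice, and this factor is given away. -/
theorem sobolev_one {D CI L N : ℝ} {R : ℕ} (hD : 1 < D) (hN : 0 < N) (hCI : 0 ≤ CI) (hL : 0 ≤ L)
    (hiso : G.Iso D CI L N R) (g : V → ℝ) (hg : ∀ x, 0 ≤ g x)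
    (hs : ∀ x, R ≤ G.ρ x → g x = 0) :
    (N⁻¹ * ∑ x, g x ^ (D / (D - 1))) ^ (1 - 1 / D) ≤
      CI * (L / N) * ∑ x, ∑ y, if 0 < G.w x y then |g x - g y| else 0 := by
  have hD1 : 0 < D - 1 := by linarith
  set a := D / (D - 1) with ha
  have ha1 : 1 ≤ a := by rw [ha, le_div_iff₀ hD1]; linarith
  have ha0 : 0 < a := by linarith
  have hinv : 1 - 1 / D = 1 / a := by rw [ha]; field_simp
  have hN' : 0 ≤ N⁻¹ := (inv_pos.2 hN).le
  rw [hinv]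
  have key := layer_cake (fun x y => CI * (L / N) * (if 0 < G.w x y then (1 : ℝ) else 0))
    (fun g : V → ℝ => (N⁻¹ * ∑ x, |g x| ^ a) ^ (1 / a)) ?_ ?_ ?_
    (fun A => ∀ x ∈ A, G.ρ x < R) (fun A B h hB x hx => hB x (h hx)) ?_ g hg ?_
  · simp only [mul_assoc, ite_mul, one_mul, zero_mul, ← Finset.mul_sum] at key ⊢
    simpa only [abs_of_nonneg (hg _)] using key
  · intro g h hg hh
    have := Real.Lp_add_le (Finset.univ : Finset V) g h ha1
    simp only [Pi.add_apply]
    rw [Real.mul_rpow hN' (by positivity), Real.mul_rpow hN' (by positivity),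
      Real.mul_rpow hN' (by positivity), ← mul_add]
    gcongr
  · intro t g ht hg
    simp only [Pi.smul_apply, smul_eq_mul, abs_mul, abs_of_nonneg ht]
    rw [Finset.sum_congr rfl fun x _ => Real.mul_rpow ht (abs_nonneg (g x)), ← Finset.mul_sum,
      mul_left_comm, Real.mul_rpow (by positivity) (by positivity), ← Real.rpow_mul ht,
      mul_one_div_cancel ha0.ne', Real.rpow_one]
  · simp [Real.zero_rpow ha0.ne', Real.zero_rpow (inv_pos.2 ha0).ne']
  · intro A hA hAR
    have h1 := hiso A hA hAR
    rw [hinv] at h1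
    have h2 : ∑ x, |if x ∈ A then (1 : ℝ) else 0| ^ a = A.card := by
      rw [Finset.sum_congr rfl (g := fun x => if x ∈ A then (1 : ℝ) else 0) fun x _ => by
        by_cases hx : x ∈ A <;> simp [hx, Real.zero_rpow ha0.ne']]
      simp
    simp only [h2]
    have h3 : ∑ x, ∑ y, CI * (L / N) * (if 0 < G.w x y then (1 : ℝ) else 0) *
        |(if x ∈ A then (1 : ℝ) else 0) - (if y ∈ A then 1 else 0)| =
        CI * (L / N) * (2 * G.bdry A) := by
      rw [← G.sum_abs_indicator A]
      simp only [Finset.mul_sum, mul_assoc]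
    rw [h3, inv_mul_eq_div]
    have h4 : 0 ≤ G.bdry A := Finset.sum_nonneg fun x _ => Finset.sum_nonneg fun y _ => by
      split_ifs <;> simp
    have : 0 ≤ CI * (L / N) * G.bdry A := by positivity
    linarith
  · intro x hx
    by_contra h
    simp [hs x (not_lt.1 h)] at hx

/-- The measure of a vertex. -/
def mu (x : V) : ℝ := ∑ y, G.w x y

/-- The sum of the resistances at a vertex. -/
noncomputable def nu (x : V) : ℝ := ∑ y, (G.w x y)⁻¹

/-- The (doubled) Dirichlet energy. -/
def energy (h : V → ℝ) : ℝ := ∑ x, ∑ y, G.w x y * (h x - h y) ^ 2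

theorem mu_nonneg (x : V) : 0 ≤ G.mu x := Finset.sum_nonneg fun y _ => G.nonneg x y

theorem nu_nonneg (x : V) : 0 ≤ G.nu x :=
  Finset.sum_nonneg fun y _ => inv_nonneg.2 (G.nonneg x y)

theorem energy_nonneg (h : V → ℝ) : 0 ≤ G.energy h :=
  Finset.sum_nonneg fun x _ => Finset.sum_nonneg fun y _ =>
    mul_nonneg (G.nonneg x y) (sq_nonneg _)

end Network

/-- Bernoulli's inequality at the ratio of the smaller to the larger number takes the place of the
mean value theorem. -/
theorem abs_rpow_sub_rpow_le {a b t : ℝ} (ha : 0 ≤ a) (hb : 0 ≤ b) (ht : 1 ≤ t) :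
    |a ^ t - b ^ t| ≤ t * max a b ^ (t - 1) * |a - b| := by
  wlog hab : b ≤ a generalizing a b
  · rw [abs_sub_comm, abs_sub_comm a b, max_comm]
    exact this hb ha (not_le.1 hab).le
  rw [max_eq_left hab, abs_of_nonneg (sub_nonneg.2 (Real.rpow_le_rpow hb hab (by linarith))),
    abs_of_nonneg (sub_nonneg.2 hab)]
  rcases ha.eq_or_lt with h0 | h0
  · subst h0
    have : b = 0 := le_antisymm hab hb
    subst this; simp
  have h1 := one_add_mul_self_le_rpow_one_add (s := b / a - 1) (by
    have : 0 ≤ b / a := by positivity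
    linarith) ht
  have h2 : b ^ t = a ^ t * (1 + (b / a - 1)) ^ t := by
    rw [← Real.mul_rpow ha (by have : 0 ≤ b / a := by positivity
                               linarith)]
    congr 1; field_simp; ring
  have h3 : a ^ t = a ^ (t - 1) * a := by
    rw [← Real.rpow_add_one h0.ne']; congr 1; ring
  have h4 : 0 ≤ a ^ t := by positivity
  have h5 : a ^ t * (1 + t * (b / a - 1)) = a ^ t + t * a ^ (t - 1) * (b - a) := by
    rw [h3]; field_simp
  nlinarith [mul_le_mul_of_nonneg_left h1 h4]

/-- For `b ≤ a` one has `b ^ m ≤ a ^ (m - 1) * b`. This supplies the coercive term of the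
Caccioppoli estimate. -/
theorem sq_mul_rpow_le {a b m : ℝ} (ha : 0 ≤ a) (hb : 0 ≤ b) (hm : 1 ≤ m) :
    max a b ^ (m - 1) * (a - b) ^ 2 ≤ (a - b) * (a ^ m - b ^ m) := by
  wlog hab : b ≤ a generalizing a b
  · have := this hb ha (not_le.1 hab).le
    rw [max_comm] at this
    nlinarith
  rw [max_eq_left hab]
  rcases ha.eq_or_lt with h0 | h0
  · subst h0
    have : b = 0 := le_antisymm hab hb
    subst this; simp
  have h3 : a ^ m = a ^ (m - 1) * a := by
    rw [← Real.rpow_add_one h0.ne']; congr 1; ring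
  have h4 : b ^ m ≤ a ^ (m - 1) * b := by
    rcases hb.eq_or_lt with h | h
    · subst h; simp [Real.zero_rpow (by linarith : m ≠ 0)]
    · have : b ^ m = b ^ (m - 1) * b := by
        rw [← Real.rpow_add_one h.ne']; congr 1; ring
      rw [this]
      gcongr
  have h5 : 0 ≤ (a - b) * (a ^ (m - 1) * b - b ^ m) :=
    mul_nonneg (by linarith) (by linarith)
  rw [h3]
  nlinarith

end Network

/-! ### The Caccioppoli inequality. -/

section Network
open scoped Classical

-- The weighted difference `e² Fa - g² Fb` splits into the symmetric part `Q (Fa - Fb)` and the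
-- cutoff part `(e² - g²)/2 (Fa + Fb)`. Paired with `a - b`, the first yields the main term `P Q
-- D²`. The other three products are errors: by Young's inequality `t1` and `t2` each use a quarter
-- of the main term, `t3` none. The lower bound `k ≤ T` converts `δ` into `δ / k` times `T`.
set_option maxHeartbeats 400000 in
theorem caccioppoli_product {a b k e g τ δ d m P T Q D Fa Fb : ℝ} (hk : 0 < k) (hTk : k ≤ T)
    (hP0 : 0 < P) (he : 0 ≤ e) (he' : e ≤ 1) (hg : 0 ≤ g) (hg' : g ≤ 1) (hm1 : 1 ≤ m)
    (hτ : |e - g| ≤ τ) (hd : |d| ≤ δ) (hQ : Q = (e ^ 2 + g ^ 2) / 2) (hD : D = |a - b|)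
    (hFa0 : 0 ≤ Fa) (hFb0 : 0 ≤ Fb) (hFaT : Fa ≤ P * T) (hFbT : Fb ≤ P * T)
    (hX : P * D ^ 2 ≤ (a - b) * (Fa - Fb)) (hFD : |Fa - Fb| ≤ m * P * D) :
    P * Q * D ^ 2 / 2 - P * T ^ 2 * (5 * τ ^ 2 + (m ^ 2 + 1) * (δ ^ 2 / k ^ 2)) ≤
      (a - b - d) * (e ^ 2 * Fa - g ^ 2 * Fb) := by
  have hT0 : 0 < T := hk.trans_le hTk
  have hQ0 : 0 ≤ Q := by rw [hQ]; positivity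
  have hQ1 : Q ≤ 1 := by rw [hQ]; nlinarith
  have hegQ : (e + g) ^ 2 ≤ 4 * Q := by rw [hQ]; nlinarith [sq_nonneg (e - g)]
  have hτ0 : 0 ≤ τ := (abs_nonneg _).trans hτ
  have hδ0 : 0 ≤ δ := (abs_nonneg _).trans hd
  have hD0 : 0 ≤ D := hD ▸ abs_nonneg _
  have habs : |(e ^ 2 - g ^ 2) / 2 * (Fa + Fb)| ≤ τ * (e + g) * (P * T) := by
    rw [abs_mul, abs_of_nonneg (add_nonneg hFa0 hFb0)]
    have h1 : |(e ^ 2 - g ^ 2) / 2| ≤ τ * (e + g) / 2 := by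
      rw [show (e ^ 2 - g ^ 2) / 2 = (e - g) * ((e + g) / 2) by ring, abs_mul,
        abs_of_nonneg (by linarith : 0 ≤ (e + g) / 2)]
      nlinarith
    calc _ ≤ τ * (e + g) / 2 * (P * T + P * T) := by gcongr
      _ = _ := by ring
  have t1 : -(P * (Q * D ^ 2 / 4 + 4 * τ ^ 2 * T ^ 2)) ≤
      (a - b) * ((e ^ 2 - g ^ 2) / 2 * (Fa + Fb)) := by
    refine (abs_le.1 ?_).1
    rw [abs_mul, ← hD]
    calc _ ≤ D * (τ * (e + g) * (P * T)) := by gcongr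
      _ = P * (τ * (e + g) * D * T) := by ring
      _ ≤ _ := by
        gcongr
        have h1 := sq_nonneg ((e + g) * D / 4 - 2 * τ * T)
        have h2 := mul_le_mul_of_nonneg_right hegQ (sq_nonneg D)
        nlinarith
  have t2 : -(P * (Q * D ^ 2 / 4 + m ^ 2 * (δ ^ 2 / k ^ 2) * T ^ 2)) ≤ -d * (Q * (Fa - Fb)) := by
    refine (abs_le.1 ?_).1
    rw [abs_mul, abs_neg, abs_mul, abs_of_nonneg hQ0]
    have h3 : δ ^ 2 ≤ δ ^ 2 / k ^ 2 * T ^ 2 := by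
      rw [div_mul_eq_mul_div, le_div_iff₀ (by positivity)]
      gcongr
    calc _ ≤ δ * (Q * (m * P * D)) := by gcongr
      _ = P * (Q * (m * δ * D)) := by ring
      _ ≤ P * (Q * (D ^ 2 / 4 + m ^ 2 * δ ^ 2)) := by
        gcongr
        nlinarith [sq_nonneg (D / 2 - m * δ)]
      _ = P * (Q * D ^ 2 / 4 + m ^ 2 * (Q * δ ^ 2)) := by ring
      _ ≤ P * (Q * D ^ 2 / 4 + m ^ 2 * (1 * (δ ^ 2 / k ^ 2 * T ^ 2))) := by gcongr
      _ = _ := by ring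
  have t3 : -(P * (τ ^ 2 + δ ^ 2 / k ^ 2) * T ^ 2) ≤ -d * ((e ^ 2 - g ^ 2) / 2 * (Fa + Fb)) := by
    refine (abs_le.1 ?_).1
    rw [abs_mul, abs_neg]
    have h4 : T ≤ T ^ 2 / k := by rw [le_div_iff₀ hk]; nlinarith
    calc _ ≤ δ * (τ * (e + g) * (P * T)) := by gcongr
      _ ≤ δ * (τ * 2 * (P * (T ^ 2 / k))) := by gcongr; linarith
      _ = P * (2 * τ * (δ / k)) * T ^ 2 := by ring
      _ ≤ P * (τ ^ 2 + δ ^ 2 / k ^ 2) * T ^ 2 := by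
        have h5 : 2 * τ * (δ / k) ≤ τ ^ 2 + δ ^ 2 / k ^ 2 := by
          rw [← div_pow]
          nlinarith [sq_nonneg (τ - δ / k)]
        exact mul_le_mul_of_nonneg_right (mul_le_mul_of_nonneg_left h5 hP0.le) (sq_nonneg T)
  have h1 : (a - b - d) * (e ^ 2 * Fa - g ^ 2 * Fb) = Q * ((a - b) * (Fa - Fb)) +
      (a - b) * ((e ^ 2 - g ^ 2) / 2 * (Fa + Fb)) + -d * (Q * (Fa - Fb)) +
      -d * ((e ^ 2 - g ^ 2) / 2 * (Fa + Fb)) := by rw [hQ]; ring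
  rw [h1]
  have h2 := mul_le_mul_of_nonneg_left hX hQ0
  linarith

theorem caccioppoli_constant {β τ m z : ℝ} (hm : m = 2 * β - 1) (hβ : 1 ≤ β) (h4 : 0 ≤ z) :
    2 * τ ^ 2 + 4 * β ^ 2 * (5 * τ ^ 2 + (m ^ 2 + 1) * z) ≤ 32 * β ^ 4 * (τ ^ 2 + z) := by
  have h1 : 1 ≤ β ^ 2 := by nlinarith
  have h2 : β ^ 2 ≤ β ^ 4 := by nlinarith
  have h3 : m ^ 2 + 1 ≤ 8 * β ^ 2 := by rw [hm]; nlinarith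
  have h5 : 0 ≤ τ ^ 2 := by positivity
  have h7 : β ^ 2 * τ ^ 2 ≤ β ^ 4 * τ ^ 2 := by gcongr
  have h8 : τ ^ 2 ≤ β ^ 4 * τ ^ 2 := by nlinarith
  have h9 : β ^ 2 * ((m ^ 2 + 1) * z) ≤ β ^ 2 * (8 * β ^ 2 * z) := by gcongr
  nlinarith

-- Here `a, b` are the values of `u⁺ + k` at the ends of an edge, `e, g` those of the cutoff, and
-- `d` is the increment of the right-hand side. The increment of `η v^β` splits into a gradient
-- part, controlled by `caccioppoli_product`, and a cutoff part bounded by `τ T^β`.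
set_option maxHeartbeats 400000 in
theorem caccioppoli_edge {a b k e g τ δ d β : ℝ} (hk : 0 < k) (ha : k ≤ a) (hb : k ≤ b)
    (he : 0 ≤ e) (he' : e ≤ 1) (hg : 0 ≤ g) (hg' : g ≤ 1) (hτ : |e - g| ≤ τ) (hd : |d| ≤ δ)
    (hβ : 1 ≤ β) :
    (e * a ^ β - g * b ^ β) ^ 2 ≤
      4 * β ^ 2 * ((a - b - d) * (e ^ 2 * (a ^ (2 * β - 1) - k ^ (2 * β - 1)) -
        g ^ 2 * (b ^ (2 * β - 1) - k ^ (2 * β - 1)))) +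
      32 * β ^ 4 * (τ ^ 2 + δ ^ 2 / k ^ 2) * (a ^ (2 * β) + b ^ (2 * β)) := by
  set m := 2 * β - 1 with hm
  have hm1 : 1 ≤ m := by linarith
  have ha0 : 0 < a := hk.trans_le ha
  have hb0 : 0 < b := hk.trans_le hb
  set T := max a b with hT
  have hTk : k ≤ T := ha.trans (le_max_left _ _)
  have hT0 : 0 < T := hk.trans_le hTk
  set P := T ^ (m - 1) with hP
  have hP0 : 0 < P := Real.rpow_pos_of_pos hT0 _
  set Q := (e ^ 2 + g ^ 2) / 2 with hQ
  have hQ0 : 0 ≤ Q := by positivity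
  have hQ1 : Q ≤ 1 := by rw [hQ]; nlinarith
  have hegQ : (e + g) ^ 2 ≤ 4 * Q := by rw [hQ]; nlinarith [sq_nonneg (e - g)]
  have hTm : T ^ m = P * T := by
    rw [hP, ← Real.rpow_add_one hT0.ne']; congr 1; ring
  have hTb : T ^ (2 * β) = P * T ^ 2 := by
    rw [hP, ← Real.rpow_natCast, ← Real.rpow_add hT0]; congr 1; rw [hm]; push_cast; ring
  have hTb1 : (T ^ (β - 1)) ^ 2 = P := by
    rw [hP, ← Real.rpow_natCast, ← Real.rpow_mul hT0.le]; congr 1; rw [hm]; push_cast; ring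
  have hTb2 : (T ^ β) ^ 2 = P * T ^ 2 := by
    rw [← hTb, ← Real.rpow_natCast, ← Real.rpow_mul hT0.le]; congr 1; push_cast; ring
  have hτ0 : 0 ≤ τ := (abs_nonneg _).trans hτ
  have hδ0 : 0 ≤ δ := (abs_nonneg _).trans hd
  set Fa := a ^ m - k ^ m with hFa
  set Fb := b ^ m - k ^ m with hFb
  have hkm : 0 ≤ k ^ m := by positivity
  have hFa0 : 0 ≤ Fa := sub_nonneg.2 (Real.rpow_le_rpow hk.le ha (by linarith))
  have hFb0 : 0 ≤ Fb := sub_nonneg.2 (Real.rpow_le_rpow hk.le hb (by linarith))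
  have hFaT : Fa ≤ P * T := by
    rw [← hTm]
    have := Real.rpow_le_rpow ha0.le (le_max_left a b) (by linarith : 0 ≤ m)
    rw [← hT] at this; linarith
  have hFbT : Fb ≤ P * T := by
    rw [← hTm]
    have := Real.rpow_le_rpow hb0.le (le_max_right a b) (by linarith : 0 ≤ m)
    rw [← hT] at this; linarith
  set D := |a - b| with hD
  have hD0 : 0 ≤ D := abs_nonneg _
  have hDD : D ^ 2 = (a - b) ^ 2 := sq_abs _
  have hX : P * D ^ 2 ≤ (a - b) * (Fa - Fb) := by
    have := sq_mul_rpow_le ha0.le hb0.le hm1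
    rw [hDD]
    have h2 : Fa - Fb = a ^ m - b ^ m := by rw [hFa, hFb]; ring
    rw [h2]; exact this
  have hFD : |Fa - Fb| ≤ m * P * D := by
    have := abs_rpow_sub_rpow_le ha0.le hb0.le hm1
    have h2 : Fa - Fb = a ^ m - b ^ m := by rw [hFa, hFb]; ring
    rw [h2]; exact this
  have hbD : |a ^ β - b ^ β| ≤ β * T ^ (β - 1) * D := abs_rpow_sub_rpow_le ha0.le hb0.le hβ
  have hprod := caccioppoli_product hk hTk hP0 he he' hg hg' hm1 hτ hd hQ hD hFa0 hFb0 hFaT hFbT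
    hX hFD
  have hlhs : (e * a ^ β - g * b ^ β) ^ 2 ≤ 2 * β ^ 2 * (P * Q * D ^ 2) + 2 * τ ^ 2 * (P * T ^ 2) := by
    have h1 : e * a ^ β - g * b ^ β =
        (e + g) / 2 * (a ^ β - b ^ β) + (e - g) / 2 * (a ^ β + b ^ β) := by ring
    have h2 : ((e + g) / 2 * (a ^ β - b ^ β)) ^ 2 ≤ β ^ 2 * (P * Q * D ^ 2) := by
      rw [mul_pow, ← sq_abs (a ^ β - b ^ β)]
      calc _ ≤ Q * (β * T ^ (β - 1) * D) ^ 2 := by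
            gcongr
            linarith
        _ = _ := by rw [mul_pow, mul_pow, hTb1]; ring
    have h3 : ((e - g) / 2 * (a ^ β + b ^ β)) ^ 2 ≤ τ ^ 2 * (P * T ^ 2) := by
      rw [← hTb2, ← mul_pow, sq_le_sq, abs_mul, abs_of_nonneg (by positivity : 0 ≤ a ^ β + b ^ β),
        abs_of_nonneg (by positivity : 0 ≤ τ * T ^ β), abs_div, abs_two]
      have h4 : a ^ β ≤ T ^ β := Real.rpow_le_rpow ha0.le (le_max_left a b) (by linarith)
      have h5 : b ^ β ≤ T ^ β := Real.rpow_le_rpow hb0.le (le_max_right a b) (by linarith)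
      calc _ ≤ τ / 2 * (T ^ β + T ^ β) := by gcongr
        _ = _ := by ring
    rw [h1]
    refine add_sq_le.trans ?_
    linarith
  have hY : P * T ^ 2 ≤ a ^ (2 * β) + b ^ (2 * β) := by
    rw [← hTb]
    have h1 : 0 ≤ a ^ (2 * β) := by positivity
    have h2 : 0 ≤ b ^ (2 * β) := by positivity
    rcases max_cases a b with h | h <;> rw [hT, h.1] <;> linarith
  have hc := caccioppoli_constant (τ := τ) hm hβ (by positivity : 0 ≤ δ ^ 2 / k ^ 2)
  have hPT : 0 ≤ P * T ^ 2 := by positivity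
  have hk2 : 0 ≤ 32 * β ^ 4 * (τ ^ 2 + δ ^ 2 / k ^ 2) := by positivity
  have h1 := mul_le_mul_of_nonneg_left hY hk2
  have h2 := mul_le_mul_of_nonneg_right hc hPT
  have h3 := mul_le_mul_of_nonneg_left hprod (by positivity : 0 ≤ 4 * β ^ 2)
  linarith

namespace Network
variable {V : Type} [Fintype V] (G : Network V)

/-- Summation by parts. -/
theorem sum_grad_mul_grad (h φ : V → ℝ) :
    ∑ x, ∑ y, G.w x y * ((h x - h y) * (φ x - φ y)) =
      2 * ∑ x, φ x * ∑ y, G.w x y * (h x - h y) := by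
  have h1 : ∑ x, ∑ y, G.w x y * ((h x - h y) * φ y) =
      -∑ x, ∑ y, G.w x y * ((h x - h y) * φ x) := by
    rw [Finset.sum_comm, ← Finset.sum_neg_distrib]
    refine Finset.sum_congr rfl fun x _ => ?_
    rw [← Finset.sum_neg_distrib]
    refine Finset.sum_congr rfl fun y _ => ?_
    rw [G.symm y x]; ring
  have h2 : ∑ x, ∑ y, G.w x y * ((h x - h y) * φ x) =
      ∑ x, φ x * ∑ y, G.w x y * (h x - h y) := by
    refine Finset.sum_congr rfl fun x _ => ?_
    rw [Finset.mul_sum]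
    refine Finset.sum_congr rfl fun y _ => ?_
    ring
  simp only [mul_sub, Finset.sum_sub_distrib] at h1 h2 ⊢
  linarith

/-- `u` solves `div (w ∇u) = div (w ∇f)` at all vertices of height less than `R`. -/
def Solves (R : ℕ) (u f : V → ℝ) : Prop :=
  ∀ x, G.ρ x < R → ∑ y, G.w x y * (u x - u y) = ∑ y, G.w x y * (f x - f y)

/-- The equation is tested with `η² (v^(2β-1) - k^(2β-1))`. Subtracting the constant makes the test
function vanish where `u ≤ 0`, so that the truncation `v` behaves like a solution;
`caccioppoli_edge` is then summed over all edges. -/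
theorem energy_le {R r : ℕ} {u f η : V → ℝ} {τ δ k β : ℝ} (hu : G.Solves R u f)
    (hf : ∀ x y, 0 < G.w x y → |f x - f y| ≤ δ) (hrR : r ≤ R) (hk : 0 < k) (hβ : 1 ≤ β)
    (hη : ∀ x, 0 ≤ η x) (hη' : ∀ x, η x ≤ 1) (hητ : ∀ x y, 0 < G.w x y → |η x - η y| ≤ τ)
    (hηr : ∀ x, r ≤ G.ρ x → η x = 0) :
    G.energy (fun x => η x * (max (u x) 0 + k) ^ β) ≤
      64 * β ^ 4 * (τ ^ 2 + δ ^ 2 / k ^ 2) *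
        ∑ x with G.ρ x ≤ r, G.mu x * (max (u x) 0 + k) ^ (2 * β) := by
  set v : V → ℝ := fun x => max (u x) 0 + k with hv
  have hvk : ∀ x, k ≤ v x := fun x => by simp [hv]
  set F : V → ℝ := fun x => v x ^ (2 * β - 1) - k ^ (2 * β - 1) with hF
  have hF0 : ∀ x, 0 ≤ F x := fun x =>
    sub_nonneg.2 (Real.rpow_le_rpow hk.le (hvk x) (by linarith))
  have hFneg : ∀ x, u x ≤ 0 → F x = 0 := fun x hx => by simp [hF, hv, max_eq_right hx]
  set φ : V → ℝ := fun x => η x ^ 2 * F x with hφ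
  set C := 32 * β ^ 4 * (τ ^ 2 + δ ^ 2 / k ^ 2) with hC
  have hC0 : 0 ≤ C := by positivity
  have hzero : ∑ x, ∑ y, G.w x y * (((u x - f x) - (u y - f y)) * (φ x - φ y)) = 0 := by
    rw [G.sum_grad_mul_grad (fun x => u x - f x) φ, Finset.sum_eq_zero, mul_zero]
    intro x _
    rcases lt_or_ge (G.ρ x) r with h | h
    · have := hu x (h.trans_le hrR)
      rw [show ∑ y, G.w x y * (u x - f x - (u y - f y)) =
        ∑ y, G.w x y * (u x - u y) - ∑ y, G.w x y * (f x - f y) by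
          rw [← Finset.sum_sub_distrib]
          exact Finset.sum_congr rfl fun y _ => by ring, this, sub_self, mul_zero]
    · simp [hφ, hηr x h]
  -- At an endpoint with `u ≤ 0` the test function is zero, so truncating there can only lower the
  -- product.
  have hpos : ∀ x y, (v x - v y) * (φ x - φ y) ≤ (u x - u y) * (φ x - φ y) := by
    intro x y
    have hx0 : 0 ≤ φ x := mul_nonneg (sq_nonneg _) (hF0 x)
    have hy0 : 0 ≤ φ y := mul_nonneg (sq_nonneg _) (hF0 y)
    rcases le_total (u x) 0 with hx | hx <;> rcases le_total (u y) 0 with hy | hy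
    · have h1 : φ x = 0 := by simp [hφ, hFneg x hx]
      have h2 : φ y = 0 := by simp [hφ, hFneg y hy]
      simp [h1, h2]
    · have h1 : φ x = 0 := by simp [hφ, hFneg x hx]
      simp only [hv, max_eq_right hx, max_eq_left hy, h1]; nlinarith
    · have h2 : φ y = 0 := by simp [hφ, hFneg y hy]
      simp only [hv, max_eq_left hx, max_eq_right hy, h2]; nlinarith
    · simp only [hv, max_eq_left hx, max_eq_left hy]
      apply le_of_eq; ring
  set I : V → ℝ := fun x => if G.ρ x ≤ r then v x ^ (2 * β) else 0 with hI
  have hedge : ∀ x y, G.w x y * (η x * v x ^ β - η y * v y ^ β) ^ 2 ≤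
      4 * β ^ 2 * (G.w x y * (((u x - f x) - (u y - f y)) * (φ x - φ y))) +
        C * (G.w x y * I x + G.w x y * I y) := by
    intro x y
    rcases (G.nonneg x y).eq_or_lt with h0 | h0
    · simp [← h0]
    -- An edge with both ends at height at least `r` does not meet the support of `η`. Any other
    -- edge has both ends at height at most `r`, since heights change by at most one; hence the
    -- non-strict bound in the sum.
    by_cases hz : r ≤ G.ρ x ∧ r ≤ G.ρ y
    · have hI0 : ∀ x, 0 ≤ I x := fun x => by
        simp only [hI]; split_ifs
        · exact Real.rpow_nonneg (hk.le.trans (hvk x)) _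
        · exact le_rfl
      simp only [hφ, hηr x hz.1, hηr y hz.2]
      have := hI0 x
      have := hI0 y
      have : 0 ≤ C * (G.w x y * I x + G.w x y * I y) := by positivity
      simpa using this
    · have hxy : G.ρ x ≤ r ∧ G.ρ y ≤ r := by
        have h1 := G.lip x y h0
        have h2 := G.lip y x (by rwa [G.symm])
        omega
      have h1 := caccioppoli_edge (d := f x - f y) hk (hvk x) (hvk y) (hη x) (hη' x) (hη y)
        (hη' y) (hητ x y h0) (hf x y h0) hβ
      have h2 : (v x - v y - (f x - f y)) * (φ x - φ y) ≤
          ((u x - f x) - (u y - f y)) * (φ x - φ y) := by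
        have := hpos x y
        nlinarith
      have h3 : (η x * v x ^ β - η y * v y ^ β) ^ 2 ≤
          4 * β ^ 2 * (((u x - f x) - (u y - f y)) * (φ x - φ y)) + C * (I x + I y) := by
        simp only [hI, hxy.1, hxy.2, if_true]
        refine h1.trans ?_
        gcongr
      calc _ ≤ G.w x y * (4 * β ^ 2 * (((u x - f x) - (u y - f y)) * (φ x - φ y)) +
              C * (I x + I y)) := by gcongr
        _ = _ := by ring
  have hsum := Finset.sum_le_sum fun x (_ : x ∈ Finset.univ) =>
    Finset.sum_le_sum fun y (_ : y ∈ Finset.univ) => hedge x y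
  simp only [Finset.sum_add_distrib, ← Finset.mul_sum] at hsum
  rw [hzero, mul_zero, zero_add] at hsum
  have h1 : ∑ x, ∑ y, G.w x y * I x = ∑ x with G.ρ x ≤ r, G.mu x * v x ^ (2 * β) := by
    rw [Finset.sum_filter]
    refine Finset.sum_congr rfl fun x _ => ?_
    simp only [hI, mu, ← Finset.sum_mul]
    split_ifs <;> simp
  have h2' : ∑ x, ∑ y, G.w x y * I y = ∑ x, ∑ y, G.w x y * I x := by
    rw [Finset.sum_comm]
    exact Finset.sum_congr rfl fun x _ => Finset.sum_congr rfl fun y _ => by rw [G.symm]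
  rw [h2', h1] at hsum
  refine hsum.trans (le_of_eq ?_)
  rw [hC]; ring

end Network
end Network

/-! ### Weighted Sobolev inequality and one step of Moser's iteration. -/

section Network
open scoped Classical

/-- The normalisation `N` need not be the cardinality of `S`: conjugate exponents split `N⁻¹` for
every positive `N`. -/
theorem normalized_holder {V : Type} (S : Finset V) {N p p' : ℝ} (hN : 0 < N)
    (hp : p.HolderConjugate p') (f g : V → ℝ) (hf : ∀ x, 0 ≤ f x) (hg : ∀ x, 0 ≤ g x) :
    N⁻¹ * ∑ x ∈ S, f x * g x ≤
      (N⁻¹ * ∑ x ∈ S, f x ^ p) ^ (1 / p) * (N⁻¹ * ∑ x ∈ S, g x ^ p') ^ (1 / p') := by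
  have hN' : 0 ≤ N⁻¹ := (inv_pos.2 hN).le
  have hF : 0 ≤ ∑ x ∈ S, f x ^ p := Finset.sum_nonneg fun x _ => Real.rpow_nonneg (hf x) _
  have hG : 0 ≤ ∑ x ∈ S, g x ^ p' := Finset.sum_nonneg fun x _ => Real.rpow_nonneg (hg x) _
  have h := Real.inner_le_Lp_mul_Lq_of_nonneg S hp (fun x _ => hf x) (fun x _ => hg x)
  rw [Real.mul_rpow hN' hF, Real.mul_rpow hN' hG]
  have h1 : N⁻¹ = N⁻¹ ^ (1 / p) * N⁻¹ ^ (1 / p') := by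
    rw [← Real.rpow_add (inv_pos.2 hN), one_div, one_div, hp.inv_add_inv_eq_one, Real.rpow_one]
  calc _ ≤ N⁻¹ * ((∑ x ∈ S, f x ^ p) ^ (1 / p) * (∑ x ∈ S, g x ^ p') ^ (1 / p')) := by gcongr
    _ = (N⁻¹ ^ (1 / p) * N⁻¹ ^ (1 / p')) *
        ((∑ x ∈ S, f x ^ p) ^ (1 / p) * (∑ x ∈ S, g x ^ p') ^ (1 / p')) := by rw [← h1]
    _ = _ := by ring

namespace Network
variable {V : Type} [Fintype V] (G : Network V)

/-- Cauchy–Schwarz with the edge factors `√w` and `1 / √w`. This is where the resistances `ν` enter.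
-/
theorem sum_grad_sq_le (h c : V → ℝ) :
    (∑ x, ∑ y, if 0 < G.w x y then c x * |h x - h y| else 0) ^ 2 ≤
      G.energy h * ∑ x, G.nu x * c x ^ 2 := by
  have key := Finset.sum_mul_sq_le_sq_mul_sq (Finset.univ : Finset (V × V))
    (fun z => √(G.w z.1 z.2) * |h z.1 - h z.2|) (fun z => √(G.w z.1 z.2)⁻¹ * c z.1)
  simp only [Fintype.sum_prod_type] at key
  refine le_trans (le_of_eq ?_) (key.trans (le_of_eq ?_))
  · congr 1
    refine Finset.sum_congr rfl fun x _ => Finset.sum_congr rfl fun y _ => ?_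
    split_ifs with h0
    · have : √(G.w x y) * √(G.w x y)⁻¹ = 1 := by
        rw [← Real.sqrt_mul h0.le, mul_inv_cancel₀ h0.ne', Real.sqrt_one]
      calc _ = (√(G.w x y) * √(G.w x y)⁻¹) * (c x * |h x - h y|) := by rw [this, one_mul]
        _ = _ := by ring
    · have : G.w x y = 0 := le_antisymm (not_lt.1 h0) (G.nonneg x y)
      simp [this]
  · congr 1
    · refine Finset.sum_congr rfl fun x _ => Finset.sum_congr rfl fun y _ => ?_
      rw [mul_pow, Real.sq_sqrt (G.nonneg x y), sq_abs]
    · refine Finset.sum_congr rfl fun x _ => ?_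
      rw [nu, Finset.sum_mul]
      refine Finset.sum_congr rfl fun y _ => ?_
      rw [mul_pow, Real.sq_sqrt (inv_nonneg.2 (G.nonneg x y))]

/-- Weighted Sobolev inequality. -/
theorem sobolev_two {D CI L N q σ t : ℝ} {R : ℕ} (hD : 2 < D) (hN : 0 < N) (hCI : 0 ≤ CI)
    (hL : 0 ≤ L) (hq : 1 < q) (hσ0 : 0 < σ) (hσ : 1 / σ = 1 - 2 / D + 1 / q)
    (ht : t = 2 * σ * (1 - 1 / D)) (hiso : G.Iso D CI L N R) (h : V → ℝ) (hh : ∀ x, 0 ≤ h x)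
    (hs : ∀ x, R ≤ G.ρ x → h x = 0) :
    (N⁻¹ * ∑ x, h x ^ (2 * σ)) ^ (1 / σ) ≤
      (2 * t * CI * L) ^ 2 * (N⁻¹ * G.energy h) * (N⁻¹ * ∑ x, G.nu x ^ q) ^ (1 / q) := by
  have hD0 : 0 < D := by linarith
  have hqc := Real.HolderConjugate.conjExponent hq
  set q' := Real.conjExponent q
  have hq' : 1 / q' = 1 - 1 / q := by
    have := hqc.inv_add_inv_eq_one
    rw [one_div, one_div]; linarith
  -- This identity gives `2 (t - 1) q' = 2 σ`. After Hölder's inequality the same integral `I` then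
  -- stands on both sides, and the factor `I ^ (1 - 1/q)` cancels.
  have ht1 : t - 1 = σ / q' := by
    have h1 : σ * (1 / σ) = 1 := by field_simp
    rw [hσ] at h1
    rw [ht, div_eq_mul_one_div σ, hq']
    linear_combination h1
  have ht1' : 0 < t - 1 := ht1 ▸ div_pos hσ0 hqc.symm.pos
  have hI0 : 0 ≤ N⁻¹ * ∑ x, h x ^ (2 * σ) :=
    mul_nonneg (inv_pos.2 hN).le (Finset.sum_nonneg fun x _ => Real.rpow_nonneg (hh x) _)
  set I := N⁻¹ * ∑ x, h x ^ (2 * σ) with hI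
  have hν0 : 0 ≤ (N⁻¹ * ∑ x, G.nu x ^ q) ^ (1 / q) :=
    Real.rpow_nonneg (mul_nonneg (inv_pos.2 hN).le
      (Finset.sum_nonneg fun x _ => Real.rpow_nonneg (G.nu_nonneg x) _)) _
  set Nq := (N⁻¹ * ∑ x, G.nu x ^ q) ^ (1 / q)
  have hE := G.energy_nonneg h
  rcases hI0.eq_or_lt with hz | hIpos
  · rw [← hz, Real.zero_rpow (by positivity)]
    have : 0 ≤ N⁻¹ := (inv_pos.2 hN).le
    positivity
  have h1 := G.sobolev_one (by linarith) hN hCI hL hiso (fun x => h x ^ t)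
    (fun x => Real.rpow_nonneg (hh x) _) (fun x hx => by
      simp [hs x hx, Real.zero_rpow (by linarith : t ≠ 0)])
  have h2 : ∀ x, (h x ^ t) ^ (D / (D - 1)) = h x ^ (2 * σ) := fun x => by
    rw [← Real.rpow_mul (hh x)]
    congr 1
    have : D - 1 ≠ 0 := by linarith
    rw [ht]; field_simp
  simp only [h2, ← hI] at h1
  set S := ∑ x, ∑ y, if 0 < G.w x y then h x ^ (t - 1) * |h x - h y| else 0 with hS
  have h3 : (∑ x, ∑ y, if 0 < G.w x y then |h x ^ t - h y ^ t| else 0) ≤ 2 * t * S := by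
    have h4 : ∀ x y, (if 0 < G.w x y then |h x ^ t - h y ^ t| else 0) ≤
        t * ((if 0 < G.w x y then h x ^ (t - 1) * |h x - h y| else 0) +
          (if 0 < G.w y x then h y ^ (t - 1) * |h y - h x| else 0)) := by
      intro x y
      rw [G.symm y x]
      split_ifs
      · rw [abs_sub_comm (h y), ← add_mul, ← mul_assoc]
        refine (abs_rpow_sub_rpow_le (hh x) (hh y) (by linarith)).trans ?_
        have hx := Real.rpow_nonneg (hh x) (t - 1)
        have hy := Real.rpow_nonneg (hh y) (t - 1)
        have : max (h x) (h y) ^ (t - 1) ≤ h x ^ (t - 1) + h y ^ (t - 1) := by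
          rcases max_cases (h x) (h y) with hm | hm <;> rw [hm.1] <;> linarith
        have : 0 ≤ t := by linarith
        gcongr
      · simp
    calc _ ≤ _ := Finset.sum_le_sum fun x _ => Finset.sum_le_sum fun y _ => h4 x y
      _ = 2 * t * S := by
        simp only [← Finset.mul_sum, Finset.sum_add_distrib]
        rw [Finset.sum_comm (f := fun x y => if 0 < G.w y x then _ else _)]
        ring
  have h5 : S ^ 2 ≤ G.energy h * (N * (Nq * I ^ (1 - 1 / q))) := by
    refine (G.sum_grad_sq_le h fun x => h x ^ (t - 1)).trans ?_
    gcongr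
    have h6 := normalized_holder (Finset.univ : Finset V) hN hqc G.nu (fun x => (h x ^ (t - 1)) ^ 2)
      G.nu_nonneg (fun x => sq_nonneg _)
    have h7 : ∀ x, ((h x ^ (t - 1)) ^ 2) ^ q' = h x ^ (2 * σ) := fun x => by
      rw [← Real.rpow_natCast, ← Real.rpow_mul (hh x), ← Real.rpow_mul (hh x)]
      congr 1
      have := hqc.symm.pos.ne'
      rw [ht1]; push_cast; field_simp
    simp only [h7, ← hI, hq'] at h6
    rwa [inv_mul_le_iff₀ hN] at h6
  have hS0 : 0 ≤ S := Finset.sum_nonneg fun x _ => Finset.sum_nonneg fun y _ => by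
    split_ifs
    · exact mul_nonneg (Real.rpow_nonneg (hh x) _) (abs_nonneg _)
    · exact le_rfl
  have h8 : (I ^ (1 - 1 / D)) ^ 2 ≤ (CI * (L / N) * (2 * t * S)) ^ 2 := by
    gcongr
    exact h1.trans (by gcongr)
  have h9 : (I ^ (1 - 1 / D)) ^ 2 = I ^ (1 / σ) * I ^ (1 - 1 / q) := by
    rw [← Real.rpow_natCast, ← Real.rpow_mul hI0, ← Real.rpow_add hIpos, hσ]
    congr 1; push_cast; ring
  have h10 : I ^ (1 / σ) * I ^ (1 - 1 / q) ≤
      (2 * t * CI * L) ^ 2 * (N⁻¹ * G.energy h) * Nq * I ^ (1 - 1 / q) := by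
    rw [← h9]
    refine h8.trans ?_
    calc _ = (2 * t * CI * L) ^ 2 * (N⁻¹ * N⁻¹) * S ^ 2 := by rw [div_eq_mul_inv]; ring
      _ ≤ (2 * t * CI * L) ^ 2 * (N⁻¹ * N⁻¹) * (G.energy h * (N * (Nq * I ^ (1 - 1 / q)))) := by
        have : 0 ≤ N⁻¹ * N⁻¹ := mul_self_nonneg _
        gcongr
      _ = _ := by field_simp
  exact le_of_mul_le_mul_right h10 (Real.rpow_pos_of_pos hIpos _)

/-- Normalized `ℓ^s`-norm over the set of vertices of height at most `r`. -/
noncomputable def lpn (N s : ℝ) (r : ℕ) (v : V → ℝ) : ℝ :=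
  (N⁻¹ * ∑ x with G.ρ x ≤ r, v x ^ s) ^ (1 / s)

/-- The linear cutoff function between the heights `r'` and `r`. -/
noncomputable def cutoff (r' r : ℕ) (x : V) : ℝ :=
  max (min (((r : ℝ) - G.ρ x) / ((r : ℝ) - r')) 1) 0

theorem cutoff_lipschitz {r' r : ℕ} (hr : r' < r) {x y : V} (h : 0 < G.w x y) :
    |G.cutoff r' r x - G.cutoff r' r y| ≤ 1 / ((r : ℝ) - r') := by
  have hr' : (0 : ℝ) < (r : ℝ) - r' := sub_pos.2 (by exact_mod_cast hr)
  refine (abs_max_sub_max_le_abs _ _ _).trans ((abs_min_sub_min_le_max _ _ _ _).trans ?_)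
  rw [sub_self, abs_zero, max_eq_left (abs_nonneg _), ← sub_div, abs_div, abs_of_pos hr']
  gcongr
  have h1 : (G.ρ y : ℝ) ≤ G.ρ x + 1 := by exact_mod_cast G.lip x y h
  have h2 : (G.ρ x : ℝ) ≤ G.ρ y + 1 := by exact_mod_cast G.lip y x (by rwa [G.symm])
  rw [abs_le]; constructor <;> linarith

/-- One step of the Moser iteration. -/
theorem moser_step {D CI L N p p' q σ t : ℝ} {R r r' : ℕ} (hD : 2 < D) (hN : 0 < N) (hCI : 0 ≤ CI)
    (hp : p.HolderConjugate p') (hq : 1 < q) (hσ0 : 0 < σ) (hσ : 1 / σ = 1 - 2 / D + 1 / q)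
    (ht : t = 2 * σ * (1 - 1 / D)) (hiso : G.Iso D CI L N R) {u f : V → ℝ} {k s K : ℝ}
    (hu : G.Solves R u f) (hf : ∀ x y, 0 < G.w x y → |f x - f y| ≤ 1 / L) (hr : r' < r)
    (hrR : r ≤ R) (hk : 0 < k) (hk1 : k ≤ 1) (hL : (r : ℝ) - r' ≤ L) (hs : 2 * p' ≤ s)
    (hK : (N⁻¹ * ∑ x, G.mu x ^ p) ^ (1 / p) * (N⁻¹ * ∑ x, G.nu x ^ q) ^ (1 / q) ≤ K) :
    G.lpn N (σ / p' * s) r' (fun x => max (u x) 0 + k) ≤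
      (128 * (2 * t * CI) ^ 2 * s ^ 4 * K * (L / (((r : ℝ) - r') * k)) ^ 2) ^ (p' / s) *
        G.lpn N s r (fun x => max (u x) 0 + k) := by
  have hp'1 : 1 < p' := hp.symm.lt
  have hp'0 : 0 < p' := by linarith
  have hgap : (0 : ℝ) < (r : ℝ) - r' := sub_pos.2 (by exact_mod_cast hr)
  have hL0 : 0 < L := hgap.trans_le hL
  set gap := (r : ℝ) - r'
  set v : V → ℝ := fun x => max (u x) 0 + k with hv
  have hv0 : ∀ x, 0 < v x := fun x => add_pos_of_nonneg_of_pos (le_max_right _ _) hk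
  -- With this `β`, Hölder with `p, p'` turns `μ v^(2β)` into `v^s`, while the Sobolev side carries
  -- `v^(2σβ) = v^(σ s / p')`.
  set β := s / (2 * p') with hβ
  have hβ1 : 1 ≤ β := by rw [hβ, one_le_div (by positivity)]; exact hs
  have hs0 : 0 < s := by linarith
  have hβs : β ≤ s := by
    rw [hβ, div_le_iff₀ (by positivity)]; nlinarith
  have hN' : 0 ≤ N⁻¹ := (inv_pos.2 hN).le
  set η := G.cutoff r' r with hη
  have hη0 : ∀ x, 0 ≤ η x := fun x => le_max_right _ _
  have hη1 : ∀ x, η x ≤ 1 := fun x => max_le (min_le_right _ _) zero_le_one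
  have hηr : ∀ x, r ≤ G.ρ x → η x = 0 := fun x hx => by
    refine max_eq_right ((min_le_left _ _).trans (div_nonpos_of_nonpos_of_nonneg ?_ hgap.le))
    have : (r : ℝ) ≤ G.ρ x := by exact_mod_cast hx
    linarith
  have hηr' : ∀ x, G.ρ x ≤ r' → η x = 1 := fun x hx => by
    have : (G.ρ x : ℝ) ≤ r' := by exact_mod_cast hx
    rw [hη, cutoff, min_eq_right, max_eq_left zero_le_one]
    rw [one_le_div hgap]; simp only [gap]; linarith
  have hE := G.energy_le hu hf hrR hk hβ1 hη0 hη1 (fun x y h => G.cutoff_lipschitz hr h) hηr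
  have hsob := G.sobolev_two hD hN hCI hL0.le hq hσ0 hσ ht hiso (fun x => η x * v x ^ β)
    (fun x => mul_nonneg (hη0 x) (Real.rpow_nonneg (hv0 x).le _))
    (fun x hx => by simp [hηr x (hrR.trans hx)])
  have hhol := normalized_holder (Finset.univ.filter fun x => G.ρ x ≤ r) hN hp G.mu
    (fun x => v x ^ (2 * β)) G.mu_nonneg (fun x => Real.rpow_nonneg (hv0 x).le _)
  have hpow : ∀ x, (v x ^ (2 * β)) ^ p' = v x ^ s := fun x => by
    rw [← Real.rpow_mul (hv0 x).le]; congr 1; rw [hβ]; field_simp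
  simp only [hpow] at hhol
  have hμ0 : ∀ x, 0 ≤ G.mu x ^ p := fun x => Real.rpow_nonneg (G.mu_nonneg x) _
  have hν0 : ∀ x, 0 ≤ G.nu x ^ q := fun x => Real.rpow_nonneg (G.nu_nonneg x) _
  have hMp : (N⁻¹ * ∑ x with G.ρ x ≤ r, G.mu x ^ p) ^ (1 / p) ≤
      (N⁻¹ * ∑ x, G.mu x ^ p) ^ (1 / p) := by
    have : 0 ≤ ∑ x with G.ρ x ≤ r, G.mu x ^ p := Finset.sum_nonneg fun x _ => hμ0 x
    have hp0 := hp.pos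
    gcongr
    · exact fun x _ _ => hμ0 x
    · exact Finset.filter_subset _ _
  set Mp := (N⁻¹ * ∑ x, G.mu x ^ p) ^ (1 / p)
  set Nq := (N⁻¹ * ∑ x, G.nu x ^ q) ^ (1 / q) with hNq
  have hNq0 : 0 ≤ Nq := Real.rpow_nonneg (mul_nonneg hN' (Finset.sum_nonneg fun x _ => hν0 x)) _
  set J := N⁻¹ * ∑ x with G.ρ x ≤ r, v x ^ s with hJ
  have hJ0 : 0 ≤ J := mul_nonneg hN' (Finset.sum_nonneg fun x _ => Real.rpow_nonneg (hv0 x).le _)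
  have hlow : N⁻¹ * ∑ x with G.ρ x ≤ r', v x ^ (σ / p' * s) ≤
      N⁻¹ * ∑ x, (η x * v x ^ β) ^ (2 * σ) := by
    gcongr
    rw [Finset.sum_filter]
    refine Finset.sum_le_sum fun x _ => ?_
    split_ifs with hx
    · rw [hηr' x hx, one_mul, ← Real.rpow_mul (hv0 x).le]
      apply le_of_eq; congr 1; rw [hβ]; field_simp
    · exact Real.rpow_nonneg (mul_nonneg (hη0 x) (Real.rpow_nonneg (hv0 x).le _)) _
  -- Since `gap ≤ L` and `k ≤ 1`, the slope `1 / gap` of the cutoff and the relative forcing `1 / (L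
  -- k)` are both at most `1 / (gap k)`.
  have hτ : (1 / gap) ^ 2 + (1 / L) ^ 2 / k ^ 2 ≤ 2 * (1 / (gap * k)) ^ 2 := by
    have h1 : (1 / gap) ^ 2 ≤ (1 / (gap * k)) ^ 2 := by
      gcongr
      nlinarith
    have h2 : (1 / L) ^ 2 / k ^ 2 ≤ (1 / (gap * k)) ^ 2 := by
      rw [← div_pow, div_div]
      gcongr
    linarith
  have hmain : (N⁻¹ * ∑ x, (η x * v x ^ β) ^ (2 * σ)) ^ (1 / σ) ≤
      128 * (2 * t * CI) ^ 2 * s ^ 4 * K * (L / (gap * k)) ^ 2 * J ^ (1 / p') := by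
    refine hsob.trans ?_
    have hJp : 0 ≤ J ^ (1 / p') := Real.rpow_nonneg hJ0 _
    have h1 : N⁻¹ * ∑ x with G.ρ x ≤ r, G.mu x * v x ^ (2 * β) ≤ Mp * J ^ (1 / p') :=
      hhol.trans (by gcongr)
    have h2 : N⁻¹ * G.energy (fun x => η x * v x ^ β) ≤
        64 * s ^ 4 * (2 * (1 / (gap * k)) ^ 2) * (Mp * J ^ (1 / p')) := by
      calc _ ≤ N⁻¹ * (64 * β ^ 4 * ((1 / gap) ^ 2 + (1 / L) ^ 2 / k ^ 2) *
            ∑ x with G.ρ x ≤ r, G.mu x * v x ^ (2 * β)) := by gcongr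
        _ = 64 * β ^ 4 * ((1 / gap) ^ 2 + (1 / L) ^ 2 / k ^ 2) *
            (N⁻¹ * ∑ x with G.ρ x ≤ r, G.mu x * v x ^ (2 * β)) := by ring
        _ ≤ _ := by
          have : 0 ≤ N⁻¹ * ∑ x with G.ρ x ≤ r, G.mu x * v x ^ (2 * β) :=
            mul_nonneg hN' (Finset.sum_nonneg fun x _ =>
              mul_nonneg (G.mu_nonneg x) (Real.rpow_nonneg (hv0 x).le _))
          gcongr
    calc _ ≤ (2 * t * CI * L) ^ 2 * (64 * s ^ 4 * (2 * (1 / (gap * k)) ^ 2) *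
            (Mp * J ^ (1 / p'))) * Nq := by gcongr
      _ = 128 * (2 * t * CI) ^ 2 * s ^ 4 * (Mp * Nq) * (L / (gap * k)) ^ 2 * J ^ (1 / p') := by
        rw [div_eq_mul_one_div L]; ring
      _ ≤ _ := by gcongr
  have hK0 : 0 ≤ K := le_trans (mul_nonneg (Real.rpow_nonneg (mul_nonneg hN'
    (Finset.sum_nonneg fun x _ => hμ0 x)) _) hNq0) hK
  have hlow0 : 0 ≤ N⁻¹ * ∑ x with G.ρ x ≤ r', v x ^ (σ / p' * s) :=
    mul_nonneg hN' (Finset.sum_nonneg fun x _ => Real.rpow_nonneg (hv0 x).le _)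
  unfold lpn
  have e1 : 1 / (σ / p' * s) = 1 / σ * (p' / s) := by field_simp
  have e2 : 1 / s = 1 / p' * (p' / s) := by field_simp
  rw [e1, e2, Real.rpow_mul hlow0, Real.rpow_mul hJ0, ← Real.mul_rpow (by positivity)
    (Real.rpow_nonneg hJ0 _)]
  refine Real.rpow_le_rpow (Real.rpow_nonneg hlow0 _) ?_ (by positivity)
  exact (Real.rpow_le_rpow hlow0 hlow (by positivity)).trans hmain

end Network
end Network

/-! ### The Moser iteration. -/

section Network
open scoped Classical

/-- Price of leaving the iteration at a finite exponent. If `h² ≤ L`, then `L ≤ (L/h)²` and the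
trivial bound suffices. If `h² > L`, then `l^J ≥ h^ε ≥ L^(ε/2)` outgrows `log L`, so the left side
is bounded. -/
theorem rpow_div_pow_le {l d : ℝ} (hl : 1 < l) (hd : 0 ≤ d) :
    ∃ C : ℝ, 1 ≤ C ∧ ∀ (L h : ℝ) (J : ℕ), 1 ≤ h → h ≤ L → h < 2 ^ J →
      L ^ (d / l ^ J) ≤ C * (L / h) ^ (2 * d) := by
  set ε := Real.logb 2 l with hε
  have hε0 : 0 < ε := Real.logb_pos (by norm_num) hl
  have hl2 : (2 : ℝ) ^ ε = l := Real.rpow_logb (by norm_num) (by norm_num) (by linarith)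
  refine ⟨Real.exp (d * (2 / ε)), Real.one_le_exp (by positivity), fun L h J h1 hL hJ => ?_⟩
  have hL1 : 1 ≤ L := h1.trans hL
  have hL0 : 0 < L := by linarith
  have hh0 : 0 < h := by linarith
  have hlJ : h ^ ε ≤ l ^ J := by
    calc h ^ ε ≤ ((2 : ℝ) ^ J) ^ ε := by gcongr
      _ = l ^ J := by
        rw [← hl2, ← Real.rpow_natCast, ← Real.rpow_natCast, ← Real.rpow_mul (by norm_num),
          ← Real.rpow_mul (by norm_num), mul_comm]
  have hexp : (1 : ℝ) ≤ Real.exp (d * (2 / ε)) := Real.one_le_exp (by positivity)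
  have hLh : 1 ≤ L / h := by rwa [one_le_div hh0]
  rcases le_or_gt (h ^ 2) L with hc | hc
  · have h2 : L ≤ (L / h) ^ 2 := by
      rw [div_pow, le_div_iff₀ (by positivity)]; nlinarith
    have h3 : d / l ^ J ≤ d := div_le_self hd (one_le_pow₀ hl.le)
    calc L ^ (d / l ^ J) ≤ L ^ d := Real.rpow_le_rpow_of_exponent_le hL1 h3
      _ ≤ ((L / h) ^ 2) ^ d := by gcongr
      _ = (L / h) ^ (2 * d) := by
        rw [Real.rpow_mul (by positivity)]; norm_cast
      _ ≤ _ := le_mul_of_one_le_left (by positivity) hexp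
  · have h2 : L ^ (ε / 2) ≤ l ^ J := by
      refine le_trans ?_ hlJ
      calc L ^ (ε / 2) ≤ (h ^ 2) ^ (ε / 2) := by gcongr
        _ = h ^ ε := by
          rw [← Real.rpow_natCast, ← Real.rpow_mul hh0.le]; congr 1; push_cast; ring
    have h3 : Real.log L ≤ L ^ (ε / 2) / (ε / 2) := Real.log_le_rpow_div hL0.le (by positivity)
    have h4 : L ^ (d / l ^ J) ≤ Real.exp (d * (2 / ε)) := by
      rw [Real.rpow_def_of_pos hL0, Real.exp_le_exp]
      have hlp : 0 < l ^ J := by positivity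
      rw [mul_div_assoc', div_le_iff₀ hlp]
      calc Real.log L * d ≤ (L ^ (ε / 2) / (ε / 2)) * d := by gcongr
        _ = d * (2 / ε) * L ^ (ε / 2) := by field_simp
        _ ≤ _ := by gcongr
    calc _ ≤ _ := h4
      _ ≤ _ := le_mul_of_one_le_right (by positivity) (Real.one_le_rpow hLh (by positivity))

namespace Network

/-- The standing assumptions of the maximal inequality: an isoperimetric inequality, a bound on
the product of the norms of the weights, and a Poisson equation in divergence form with
a right-hand side that varies by at most `1 / L` along the edges. -/
structure Admissible {V : Type} [Fintype V] (G : Network V) (d : ℕ) (D CI p q L : ℝ) (R : ℕ)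
    (K : ℝ) (u f : V → ℝ) : Prop where
  one_le_L : 1 ≤ L
  iso : G.Iso D CI L (L ^ d) R
  one_le_K : 1 ≤ K
  weights : ((L ^ d)⁻¹ * ∑ x, G.mu x ^ p) ^ (1 / p) * ((L ^ d)⁻¹ * ∑ x, G.nu x ^ q) ^ (1 / q) ≤ K
  solves : G.Solves R u f
  grad : ∀ x y, 0 < G.w x y → |f x - f y| ≤ 1 / L

theorem Admissible.neg {V : Type} [Fintype V] {G : Network V} {d : ℕ} {D CI p q L : ℝ} {R : ℕ}
    {K : ℝ} {u f : V → ℝ} (h : G.Admissible d D CI p q L R K u f) :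
    G.Admissible d D CI p q L R K (-u) (-f) where
  one_le_L := h.one_le_L
  iso := h.iso
  one_le_K := h.one_le_K
  weights := h.weights
  solves x hx := by
    have := h.solves x hx
    simp only [Pi.neg_apply]
    have e : ∀ g : V → ℝ, ∑ y, G.w x y * (-g x - -g y) = -∑ y, G.w x y * (g x - g y) := fun g => by
      rw [← Finset.sum_neg_distrib]; exact Finset.sum_congr rfl fun y _ => by ring
    rw [e, e, this]
  grad x y hxy := by
    have := h.grad x y hxy
    rwa [Pi.neg_apply, Pi.neg_apply, neg_sub_neg, abs_sub_comm]

theorem lpn_nonneg {V : Type} [Fintype V] (G : Network V) {N s : ℝ} {r : ℕ} {v : V → ℝ}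
    (hN : 0 < N) (hv : ∀ x, 0 ≤ v x) : 0 ≤ G.lpn N s r v :=
  Real.rpow_nonneg (mul_nonneg (inv_pos.2 hN).le
    (Finset.sum_nonneg fun x _ => Real.rpow_nonneg (hv x) _)) _

/-- A single term is at most the whole sum; the volume factor `N ^ (1/s)` is harmless once `s` is
large. -/
theorem le_mul_lpn {V : Type} [Fintype V] (G : Network V) {N s : ℝ} {r : ℕ} {v : V → ℝ}
    (hN : 0 < N) (hs : 0 < s) (hv : ∀ x, 0 ≤ v x) {x : V} (hx : G.ρ x ≤ r) :
    v x ≤ N ^ (1 / s) * G.lpn N s r v := by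
  have h0 : 0 ≤ ∑ x with G.ρ x ≤ r, v x ^ s :=
    Finset.sum_nonneg fun x _ => Real.rpow_nonneg (hv x) _
  rw [lpn, ← Real.mul_rpow hN.le (mul_nonneg (inv_pos.2 hN).le h0), mul_inv_cancel_left₀ hN.ne']
  calc v x = (v x ^ s) ^ (1 / s) := by
        rw [← Real.rpow_mul (hv x), mul_one_div_cancel hs.ne', Real.rpow_one]
    _ ≤ _ := by
      gcongr
      · exact Real.rpow_nonneg (hv x) _
      · exact Finset.single_le_sum (f := fun x => v x ^ s)
          (fun x _ => Real.rpow_nonneg (hv x) _) (by simpa using hx)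

/-- The Moser iteration, with the radii `m + ⌊h / 2 ^ j⌋`. -/
theorem moser_iterate {d : ℕ} {D CI p p' q σ t : ℝ} (hD : 2 < D) (hCI : 0 ≤ CI)
    (hp : p.HolderConjugate p') (hq : 1 < q) (hσ0 : 0 < σ) (hσ : 1 / σ = 1 - 2 / D + 1 / q)
    (ht : t = 2 * σ * (1 - 1 / D)) (hl : 1 < σ / p') {s : ℝ} (hs : 2 * p' ≤ s)
    {V : Type} [Fintype V] {G : Network V} {L : ℝ} {R m h : ℕ} {k K : ℝ} {u f : V → ℝ}
    (hG : G.Admissible d D CI p q L R K u f) (hk : 0 < k) (hk1 : k ≤ 1) (hh : 1 ≤ h)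
    (hhL : (h : ℝ) ≤ L) (hR : m + h ≤ R) (j : ℕ) (hj : ∀ i < j, 2 ^ i ≤ h) :
    G.lpn (L ^ d) ((σ / p') ^ j * s) (m + h / 2 ^ j) (fun x => max (u x) 0 + k) ≤
      ((128 * (2 * t * CI) ^ 2 + 1) * s ^ 4 * K * (4 * L / (h * k)) ^ 2) ^
          (p' / s * ∑ i ∈ Finset.range j, (σ / p')⁻¹ ^ i) *
        (4 * (σ / p') ^ 4) ^ (p' / s * ∑ i ∈ Finset.range j, i * (σ / p')⁻¹ ^ i) *
        G.lpn (L ^ d) s (m + h) (fun x => max (u x) 0 + k) := by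
  have hp'1 : 1 < p' := hp.symm.lt
  have hs0 : 0 < s := by linarith
  have hL0 : 0 < L := by linarith [hG.one_le_L]
  have hN : 0 < L ^ d := by positivity
  have hK0 : 0 < K := by linarith [hG.one_le_K]
  have hh0 : (0 : ℝ) < h := by exact_mod_cast hh
  set l := σ / p'
  have hl0 : 0 < l := by linarith
  set v : V → ℝ := fun x => max (u x) 0 + k with hv
  have hv0 : ∀ x, 0 ≤ v x := fun x => add_nonneg (le_max_right _ _) hk.le
  set A := 128 * (2 * t * CI) ^ 2 + 1
  have hA : 0 < A := by positivity
  set B := A * s ^ 4 * K * (4 * L / (h * k)) ^ 2 with hB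
  have hB0 : 0 < B := by positivity
  have hb0 : 0 < 4 * l ^ 4 := by positivity
  induction j with
  | zero => simp
  | succ j ih =>
    have ih := ih fun i hi => hj i (by omega)
    have h2j : 2 ^ j ≤ h := hj j (by omega)
    set a := h / 2 ^ j with ha
    have ha1 : 1 ≤ a := (Nat.one_le_div_iff (by positivity)).2 h2j
    have ha2 : h / 2 ^ (j + 1) = a / 2 := by rw [pow_succ, Nat.div_div_eq_div_mul]
    have hah : a ≤ h := Nat.div_le_self _ _
    -- Rounding costs a bounded factor: `a = ⌊h / 2^j⌋ ≥ 1` gives `h < 2^j (a + 1) ≤ 2^(j+1) a`, and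
    -- `a - ⌊a/2⌋ ≥ a / 2`.
    have hgap : (h : ℝ) / 2 ^ (j + 2) ≤ ((m + a : ℕ) : ℝ) - ((m + a / 2 : ℕ) : ℝ) := by
      have h1 : h < 2 ^ j * (a + 1) := by
        have := Nat.lt_mul_div_succ h (by positivity : 0 < 2 ^ j)
        rwa [← ha] at this
      have h2 : a + 2 * (a / 2) ≤ 2 * a := by omega
      have h1' : (h : ℝ) ≤ 2 ^ j * (a + 1) := by exact_mod_cast h1.le
      have h2' : (a : ℝ) + 2 * ((a / 2 : ℕ) : ℝ) ≤ 2 * a := by exact_mod_cast h2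
      have ha1' : (1 : ℝ) ≤ a := by exact_mod_cast ha1
      rw [div_le_iff₀ (by positivity), pow_add]
      push_cast at *
      have : (0 : ℝ) < 2 ^ j := by positivity
      nlinarith
    have hgap0 : (0 : ℝ) < ((m + a : ℕ) : ℝ) - ((m + a / 2 : ℕ) : ℝ) :=
      lt_of_lt_of_le (by positivity) hgap
    have hgapL : ((m + a : ℕ) : ℝ) - ((m + a / 2 : ℕ) : ℝ) ≤ L := by
      refine le_trans ?_ hhL
      have : (a : ℝ) ≤ h := by exact_mod_cast hah
      push_cast
      have : (0 : ℝ) ≤ ((a / 2 : ℕ) : ℝ) := by positivity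
      linarith
    have hlj : 1 ≤ l ^ j := one_le_pow₀ hl.le
    have hstep := G.moser_step hD hN hCI hp hq hσ0 hσ ht hG.iso hG.solves hG.grad
      (r' := m + a / 2) (r := m + a) (by omega) (by omega) hk hk1 hgapL
      (s := l ^ j * s) (by nlinarith) hG.weights
    rw [ha2]
    have e1 : l ^ (j + 1) * s = l * (l ^ j * s) := by ring
    rw [e1]
    refine hstep.trans ?_
    -- Per step, halving the gap contributes `4` through the square, and the growth of the exponent
    -- contributes `l^4` through `s^4`.
    have hfac : 128 * (2 * t * CI) ^ 2 * (l ^ j * s) ^ 4 * K *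
        (L / ((((m + a : ℕ) : ℝ) - ((m + a / 2 : ℕ) : ℝ)) * k)) ^ 2 ≤ B * (4 * l ^ 4) ^ j := by
      calc _ ≤ A * (l ^ j * s) ^ 4 * K * (L / ((h : ℝ) / 2 ^ (j + 2) * k)) ^ 2 := by
            gcongr
            linarith
        _ = _ := by
          rw [hB, mul_pow 4, ← pow_mul, mul_pow, ← pow_mul, pow_add, mul_comm j 4,
            show (4 : ℝ) = 2 ^ 2 by norm_num, ← pow_mul, mul_comm 2 j, pow_mul 2 j 2]
          field_simp
    have hnn : 0 ≤ 128 * (2 * t * CI) ^ 2 * (l ^ j * s) ^ 4 * K *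
        (L / ((((m + a : ℕ) : ℝ) - ((m + a / 2 : ℕ) : ℝ)) * k)) ^ 2 := by positivity
    have hexp : p' / (l ^ j * s) = p' / s * l⁻¹ ^ j := by
      rw [inv_pow]; field_simp
    have hexp0 : 0 ≤ p' / s * l⁻¹ ^ j := by positivity
    calc _ ≤ (B * (4 * l ^ 4) ^ j) ^ (p' / s * l⁻¹ ^ j) *
          (B ^ (p' / s * ∑ i ∈ Finset.range j, l⁻¹ ^ i) *
            (4 * l ^ 4) ^ (p' / s * ∑ i ∈ Finset.range j, i * l⁻¹ ^ i) *
            G.lpn (L ^ d) s (m + h) v) := by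
          rw [hexp]
          have := G.lpn_nonneg (s := l ^ j * s) (r := m + a) hN hv0
          gcongr
      _ = _ := by
        rw [Finset.sum_range_succ, Finset.sum_range_succ, mul_add, mul_add, Real.rpow_add hB0,
          Real.rpow_add hb0, Real.mul_rpow hB0.le (by positivity), ← Real.rpow_natCast (4 * l ^ 4),
          ← Real.rpow_mul hb0.le]
        have : (j : ℝ) * (p' / s * l⁻¹ ^ j) = p' / s * (j * l⁻¹ ^ j) := by ring
        rw [this]
        ring

set_option maxHeartbeats 400000 in
/-- Moser's maximal inequality for the positive part, with large exponents. -/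
theorem moser_sup (d : ℕ) {D CI p q : ℝ} (hD : 2 < D) (hCI : 0 ≤ CI)
    (hp : 1 < p) (hq : 1 < q) (hpq : 1 / p + 1 / q < 2 / D) :
    ∃ κ : ℝ, 0 < κ ∧ ∃ s₀ : ℝ, 1 ≤ s₀ ∧ ∀ s, s₀ ≤ s → ∃ C : ℝ, 1 ≤ C ∧ ∃ b : ℝ, 0 ≤ b ∧
      ∀ (V : Type) [Fintype V] (G : Network V) (L : ℝ) (R m h : ℕ) (k K : ℝ) (u f : V → ℝ),
        G.Admissible d D CI p q L R K u f → 0 < k → k ≤ 1 → 1 ≤ h → (h : ℝ) ≤ L → m + h ≤ R →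
        ∀ x, G.ρ x ≤ m → max (u x) 0 + k ≤ C * (L / h) ^ b * (K / k ^ 2) ^ (κ / s) *
          G.lpn (L ^ d) s (m + h) (fun x => max (u x) 0 + k) := by
  have hpc := Real.HolderConjugate.conjExponent hp
  set p' := Real.conjExponent p
  have hp'1 : 1 < p' := hpc.symm.lt
  have hp' : 1 / p' = 1 - 1 / p := by
    have := hpc.inv_add_inv_eq_one
    rw [one_div, one_div]; linarith
  have hD0 : 0 < D := by linarith
  have hq0 : 0 < 1 / q := by positivity
  have h2D : 2 / D < 1 := by rw [div_lt_one hD0]; exact hD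
  have hτ0 : 0 < 1 - 2 / D + 1 / q := by linarith
  obtain ⟨σ, hσ⟩ : ∃ σ : ℝ, 1 / σ = 1 - 2 / D + 1 / q := ⟨1 / (1 - 2 / D + 1 / q), by simp⟩
  have hσ0 : 0 < σ := one_div_pos.1 (hσ ▸ hτ0)
  -- The gain of integrability exceeds one exactly because `1/p + 1/q < 2/D`.
  have hl : 1 < σ / p' := by
    rw [one_lt_div (by linarith), ← one_div_lt_one_div hσ0 (by linarith), hσ, hp']
    linarith
  set l := σ / p' with hldef
  have hl0 : 0 < l := by linarith
  have hli : l⁻¹ < 1 := inv_lt_one_of_one_lt₀ hl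
  have hli0 : 0 ≤ l⁻¹ := by positivity
  have hsum1 : Summable fun i : ℕ => l⁻¹ ^ i := summable_geometric_of_lt_one hli0 hli
  have hsum2 : Summable fun i : ℕ => (i : ℝ) * l⁻¹ ^ i := by
    simpa using summable_pow_mul_geometric_of_norm_lt_one 1
      (r := l⁻¹) (by rwa [Real.norm_of_nonneg hli0])
  set S1 := ∑' i : ℕ, l⁻¹ ^ i
  set S2 := ∑' i : ℕ, (i : ℝ) * l⁻¹ ^ i
  have hS1 : 1 ≤ S1 := by
    have := hsum1.sum_le_tsum (Finset.range 1) fun i _ => by positivity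
    rwa [Finset.sum_range_one, pow_zero] at this
  have hS2 : 0 ≤ S2 := tsum_nonneg fun i => by positivity
  obtain ⟨Cr, hCr1, hCr⟩ := rpow_div_pow_le hl (Nat.cast_nonneg d)
  -- The exponent `κ = p' S1` does not depend on `s`, so `κ / s` can later be made small. In the
  -- power of `L / h`, the part `2 d` comes from `rpow_div_pow_le`, the rest from the square in the
  -- step constant.
  refine ⟨p' * S1, by positivity, 2 * p', by linarith, fun s hs => ?_⟩
  have hs1 : 1 ≤ s := by linarith
  have hs0 : 0 < s := by linarith
  set t := 2 * σ * (1 - 1 / D) with ht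
  set A := 128 * (2 * t * CI) ^ 2 + 1 with hA
  have hA1 : 1 ≤ A := by rw [hA]; nlinarith [sq_nonneg (2 * t * CI)]
  have he0 : 0 ≤ p' * S1 / s := by positivity
  have hb1 : 1 ≤ 4 * l ^ 4 := by nlinarith [one_le_pow₀ (n := 4) hl.le]
  have hc1 : 1 ≤ (16 * A * s ^ 4) ^ (p' * S1 / s) := by
    refine Real.one_le_rpow ?_ he0
    nlinarith [one_le_pow₀ (n := 4) hs1]
  have hc2 : 1 ≤ (4 * l ^ 4) ^ (p' / s * S2) := Real.one_le_rpow hb1 (by positivity)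
  refine ⟨Cr * (16 * A * s ^ 4) ^ (p' * S1 / s) * (4 * l ^ 4) ^ (p' / s * S2),
    one_le_mul_of_one_le_of_one_le (one_le_mul_of_one_le_of_one_le hCr1 hc1) hc2,
    2 * d + 2 * (p' * S1 / s), by positivity, ?_⟩
  intro V _ G L R m h k K u f hG hk hk1 hh hhL hR x hx
  have hL0 : 0 < L := by linarith [hG.one_le_L]
  have hN : 0 < L ^ d := by positivity
  have hK0 : 0 < K := by linarith [hG.one_le_K]
  have hh0 : (0 : ℝ) < h := by exact_mod_cast hh
  have hLh : 1 ≤ L / h := by rwa [one_le_div hh0]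
  set v : V → ℝ := fun x => max (u x) 0 + k with hv
  have hv0 : ∀ x, 0 ≤ v x := fun x => add_nonneg (le_max_right _ _) hk.le
  -- The first index with `h / 2^J = 0`: the inner radius is then exactly `m`, and every step `i <
  -- J` still has `2^i ≤ h`.
  set J := Nat.log 2 h + 1 with hJ
  have hJh : h < 2 ^ J := Nat.lt_pow_succ_log_self (by norm_num) h
  have hiter := moser_iterate hD hCI hpc hq hσ0 hσ ht hl hs hG hk hk1 hh hhL hR J fun i hi =>
    (Nat.pow_le_pow_right (by norm_num) (by omega : i ≤ Nat.log 2 h)).trans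
      (Nat.pow_log_le_self 2 (by omega))
  rw [Nat.div_eq_of_lt hJh, add_zero] at hiter
  have hlJ : 1 ≤ l ^ J := one_le_pow₀ hl.le
  have h1 : v x ≤ _ := G.le_mul_lpn (s := l ^ J * s) hN (by positivity) hv0 hx
  have h2 : (L ^ d : ℝ) ^ (1 / (l ^ J * s)) ≤ Cr * (L / h) ^ (2 * (d : ℝ)) := by
    refine le_trans ?_ (hCr L h J (by exact_mod_cast hh) hhL (by exact_mod_cast hJh))
    rw [← Real.rpow_natCast, ← Real.rpow_mul hL0.le]
    refine Real.rpow_le_rpow_of_exponent_le hG.one_le_L ?_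
    rw [mul_one_div]
    gcongr
    nlinarith
  have hB1 : 1 ≤ A * s ^ 4 * K * (4 * L / (h * k)) ^ 2 := by
    have h3 : 1 ≤ 4 * L / (h * k) := by
      have : (h : ℝ) * k ≤ h := mul_le_of_le_one_right hh0.le hk1
      rw [one_le_div (by positivity)]; linarith
    have h4 := one_le_pow₀ (n := 4) hs1
    have h5 := one_le_pow₀ (n := 2) h3
    exact one_le_mul_of_one_le_of_one_le (one_le_mul_of_one_le_of_one_le
      (one_le_mul_of_one_le_of_one_le hA1 h4) hG.one_le_K) h5
  have h3 : (A * s ^ 4 * K * (4 * L / (h * k)) ^ 2) ^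
      (p' / s * ∑ i ∈ Finset.range J, l⁻¹ ^ i) ≤
      (16 * A * s ^ 4) ^ (p' * S1 / s) * (L / h) ^ (2 * (p' * S1 / s)) *
        (K / k ^ 2) ^ (p' * S1 / s) := by
    calc _ ≤ (A * s ^ 4 * K * (4 * L / (h * k)) ^ 2) ^ (p' * S1 / s) := by
          refine Real.rpow_le_rpow_of_exponent_le hB1 ?_
          rw [mul_div_right_comm]
          gcongr
          exact hsum1.sum_le_tsum _ fun i _ => by positivity
      _ = ((16 * A * s ^ 4) * (L / h) ^ 2 * (K / k ^ 2)) ^ (p' * S1 / s) := by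
          congr 1; field_simp; ring
      _ = _ := by
          rw [Real.mul_rpow (by positivity) (by positivity),
            Real.mul_rpow (by positivity) (by positivity), Real.rpow_mul (by positivity) 2]
          norm_cast
  have h4 : (4 * l ^ 4) ^ (p' / s * ∑ i ∈ Finset.range J, i * l⁻¹ ^ i) ≤
      (4 * l ^ 4) ^ (p' / s * S2) := by
    refine Real.rpow_le_rpow_of_exponent_le hb1 ?_
    gcongr
    exact hsum2.sum_le_tsum _ fun i _ => by positivity
  have h0 := G.lpn_nonneg (s := s) (r := m + h) hN hv0
  have h0' := G.lpn_nonneg (s := l ^ J * s) (r := m) hN hv0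
  calc v x ≤ (Cr * (L / h) ^ (2 * (d : ℝ))) * ((16 * A * s ^ 4) ^ (p' * S1 / s) *
        (L / h) ^ (2 * (p' * S1 / s)) * (K / k ^ 2) ^ (p' * S1 / s) *
        (4 * l ^ 4) ^ (p' / s * S2) * G.lpn (L ^ d) s (m + h) v) := by
        refine h1.trans (mul_le_mul h2 (hiter.trans ?_) h0' (by positivity))
        gcongr
    _ = _ := by
        rw [Real.rpow_add (by positivity)]; ring

end Network
end Network

/-! ### Local boundedness and the maximal inequality on finite networks. -/

section Network
open scoped Classical

namespace Network

theorem lpn_mono {V : Type} [Fintype V] (G : Network V) {N s : ℝ} {r : ℕ} {v w : V → ℝ}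
    (hN : 0 < N) (hs : 0 ≤ s) (hv : ∀ x, 0 ≤ v x) (h : ∀ x, v x ≤ w x) :
    G.lpn N s r v ≤ G.lpn N s r w := by
  have h1 : ∀ x, v x ^ s ≤ w x ^ s := fun x => Real.rpow_le_rpow (hv x) (h x) hs
  refine Real.rpow_le_rpow (mul_nonneg (inv_pos.2 hN).le
    (Finset.sum_nonneg fun x _ => Real.rpow_nonneg (hv x) _)) ?_ (by positivity)
  exact mul_le_mul_of_nonneg_left (Finset.sum_le_sum fun x _ => h1 x) (inv_pos.2 hN).le

/-- The class of admissible problems is stable under `(u, f) ↦ (-u, -f)`, which gives the negative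
part. -/
theorem moser_sup_abs (d : ℕ) {D CI p q : ℝ} (hD : 2 < D) (hCI : 0 ≤ CI)
    (hp : 1 < p) (hq : 1 < q) (hpq : 1 / p + 1 / q < 2 / D) :
    ∃ κ : ℝ, 0 < κ ∧ ∃ s₀ : ℝ, 1 ≤ s₀ ∧ ∀ s, s₀ ≤ s → ∃ C : ℝ, 1 ≤ C ∧ ∃ b : ℝ, 0 ≤ b ∧
      ∀ (V : Type) [Fintype V] (G : Network V) (L : ℝ) (R m h : ℕ) (k K : ℝ) (u f : V → ℝ),
        G.Admissible d D CI p q L R K u f → 0 < k → k ≤ 1 → 1 ≤ h → (h : ℝ) ≤ L → m + h ≤ R →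
        ∀ x, G.ρ x ≤ m → |u x| + k ≤ C * (L / h) ^ b * (K / k ^ 2) ^ (κ / s) *
          G.lpn (L ^ d) s (m + h) (fun x => |u x| + k) := by
  obtain ⟨κ, hκ, s₀, hs₀, H⟩ := moser_sup d hD hCI hp hq hpq
  refine ⟨κ, hκ, s₀, hs₀, fun s hs => ?_⟩
  obtain ⟨C, hC, b, hb, H⟩ := H s hs
  refine ⟨C, hC, b, hb, fun V _ G L R m h k K u f hG hk hk1 hh hhL hR x hx => ?_⟩
  have hL0 : 0 < L := by linarith [hG.one_le_L]
  have hK0 : 0 < K := by linarith [hG.one_le_K]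
  have hh0 : (0 : ℝ) < h := by exact_mod_cast hh
  have h1 := H V G L R m h k K u f hG hk hk1 hh hhL hR x hx
  have h2 := H V G L R m h k K (-u) (-f) hG.neg hk hk1 hh hhL hR x hx
  have hN : 0 < L ^ d := by positivity
  have e1 := G.lpn_mono (s := s) (r := m + h) (v := fun x => max (u x) 0 + k)
    (w := fun x => |u x| + k) hN (by linarith) (fun x => add_nonneg (le_max_right _ _) hk.le)
    fun x => by gcongr; exact max_le (le_abs_self _) (abs_nonneg _)
  have e2 := G.lpn_mono (s := s) (r := m + h) (v := fun x => max ((-u) x) 0 + k)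
    (w := fun x => |u x| + k) hN (by linarith) (fun x => add_nonneg (le_max_right _ _) hk.le)
    fun x => by gcongr; exact max_le (neg_le_abs _) (abs_nonneg _)
  rcases abs_cases (u x) with ⟨ha, _⟩ | ⟨ha, _⟩
  · calc |u x| + k ≤ max (u x) 0 + k := by rw [ha]; gcongr; exact le_max_left _ _
      _ ≤ _ := h1
      _ ≤ _ := by gcongr
  · calc |u x| + k ≤ max ((-u) x) 0 + k := by rw [ha]; gcongr; exact le_max_left _ _
      _ ≤ _ := h2
      _ ≤ _ := by gcongr

theorem rpow_add_one_le {x α : ℝ} (hx : 0 ≤ x) (hα : 0 < α) :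
    (x + 1) ^ α ≤ 2 ^ α * (x ^ α + 1) := by
  have h1 : x + 1 ≤ 2 * max x 1 := by
    have := le_max_left x 1
    have := le_max_right x 1
    linarith
  calc (x + 1) ^ α ≤ (2 * max x 1) ^ α := by gcongr
    _ = 2 ^ α * max x 1 ^ α := by rw [Real.mul_rpow (by norm_num) (by positivity)]
    _ ≤ _ := by
      gcongr
      rcases max_cases x 1 with h | h <;> rw [h.1]
      · linarith
      · rw [Real.one_rpow]; have := Real.rpow_nonneg hx α; linarith

set_option maxHeartbeats 1000000 in
/-- Local boundedness, with a bound that does not see the size of small solutions. -/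
theorem exists_abs_le (d : ℕ) {D CI p q : ℝ} (hD : 2 < D) (hCI : 0 ≤ CI)
    (hp : 1 < p) (hq : 1 < q) (hpq : 1 / p + 1 / q < 2 / D) {α Cvol : ℝ} (hα : 0 < α)
    (hCvol : 0 ≤ Cvol) :
    ∃ κ : ℝ, 0 < κ ∧ ∃ C : ℝ, 1 ≤ C ∧
      ∀ (V : Type) [Fintype V] (G : Network V) (n : ℕ) (K : ℝ) (u f : V → ℝ),
        G.Admissible d D CI p q n (2 * n) K u f → (∀ x, G.ρ x ≤ 2 * n) →
        (Fintype.card V : ℝ) ≤ Cvol * (n : ℝ) ^ d →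
        ((n : ℝ) ^ d)⁻¹ * ∑ x, |u x| ^ α ≤ 1 →
        ∀ x, G.ρ x ≤ n + n / 2 → |u x| ≤ C * K ^ κ := by
  obtain ⟨κ, hκ, s₀, hs₀, H⟩ := moser_sup_abs d hD hCI hp hq hpq
  set s := max s₀ α with hs
  have hsα : α ≤ s := le_max_right _ _
  have hs0 : 0 < s := by linarith [le_max_left s₀ α]
  obtain ⟨C, hC, b, hb, H⟩ := H s (le_max_left _ _)
  -- The summand `b s / α` compensates the loss `(n / h)^b` when the weighted maximum is interior;
  -- `d / α` lets the weight `n^(-a)` absorb the crude bound `U ≤ (n^d C0)^(1/α)` when it lies in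
  -- the outermost layer.
  set a := b * s / α + d / α with ha
  have ha0 : 0 ≤ a := by positivity
  set C0 := 2 ^ α * (1 + Cvol) with hC0
  have hC00 : 0 < C0 := by positivity
  set w := a * (α / s) - b with hw
  have hw0 : 0 ≤ w := by
    have : a * (α / s) = b + d / s := by rw [ha]; field_simp
    rw [hw, this]; have : (0 : ℝ) ≤ d / s := by positivity
    linarith
  set C1 := C * 3 ^ b * 2 ^ (a * (1 - α / s)) * C0 ^ (1 / s) * 3 ^ w with hC1
  have hC10 : 0 < C1 := by positivity
  refine ⟨κ / α, by positivity, 2 ^ a * (C1 ^ (s / α) + C0 ^ (1 / α)) + 1, by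
    have : 0 ≤ 2 ^ a * (C1 ^ (s / α) + C0 ^ (1 / α)) := by positivity
    linarith, fun V _ G n K u f hG hρ hV hu x hx => ?_⟩
  have hn1 : (1 : ℝ) ≤ n := hG.one_le_L
  have hn0 : (0 : ℝ) < n := by linarith
  have hK1 := hG.one_le_K
  have hK0 : 0 < K := by linarith
  have hN : (0 : ℝ) < (n : ℝ) ^ d := by positivity
  set U : V → ℝ := fun y => |u y| + 1 with hU
  have hU1 : ∀ y, 1 ≤ U y := fun y => by simp [hU]
  have hU0 : ∀ y, 0 < U y := fun y => by linarith [hU1 y]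
  have hUα : ((n : ℝ) ^ d)⁻¹ * ∑ y, U y ^ α ≤ C0 := by
    calc ((n : ℝ) ^ d)⁻¹ * ∑ y, U y ^ α ≤ ((n : ℝ) ^ d)⁻¹ * ∑ y, 2 ^ α * (|u y| ^ α + 1) := by
          gcongr with y
          exact rpow_add_one_le (abs_nonneg _) hα
      _ = 2 ^ α * (((n : ℝ) ^ d)⁻¹ * ∑ y, |u y| ^ α + ((n : ℝ) ^ d)⁻¹ * Fintype.card V) := by
          rw [← Finset.mul_sum, Finset.sum_add_distrib]; simp; ring
      _ ≤ 2 ^ α * (1 + Cvol) := by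
          gcongr
          rw [inv_mul_le_iff₀ hN]; linarith
  -- To lower the exponent from `s` to `α` without a second iteration, `U` is weighted by a power of
  -- the distance to the outer sphere and the Moser bound is used only at the maximiser. The `+ 1`
  -- keeps the weight positive at height `2n`.
  obtain ⟨x₀, -, hmax⟩ := Finset.exists_max_image (Finset.univ : Finset V)
    (fun y => (((2 * n + 1 - G.ρ y : ℕ) : ℝ) / n) ^ a * U y) ⟨x, Finset.mem_univ _⟩
  set h₀ := 2 * n + 1 - G.ρ x₀ with hh₀
  have hh₀1 : 1 ≤ h₀ := by have := hρ x₀; omega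
  have hh₀0 : (0 : ℝ) < h₀ := by exact_mod_cast hh₀1
  set Q := ((h₀ : ℝ) / n) ^ a * U x₀ with hQ
  have hQ0 : 0 < Q := by have := hU0 x₀; positivity
  have hQK : Q ≤ (C1 ^ (s / α) + C0 ^ (1 / α)) * K ^ (κ / α) := by
    have hKκ : 1 ≤ K ^ (κ / α) := Real.one_le_rpow hK1 (by positivity)
    rcases hh₀1.eq_or_lt with h1 | h2
    · have h3 : U x₀ ^ α ≤ (n : ℝ) ^ d * C0 := by
        rw [inv_mul_le_iff₀ hN] at hUα
        exact (Finset.single_le_sum (f := fun y => U y ^ α)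
          (fun y _ => Real.rpow_nonneg (hU0 y).le _) (Finset.mem_univ x₀)).trans hUα
      have h4 : U x₀ ≤ (n : ℝ) ^ a * C0 ^ (1 / α) := by
        calc U x₀ = (U x₀ ^ α) ^ (1 / α) := by
              rw [← Real.rpow_mul (hU0 x₀).le, mul_one_div_cancel hα.ne', Real.rpow_one]
          _ ≤ ((n : ℝ) ^ d * C0) ^ (1 / α) := by
              have := hU0 x₀
              gcongr
          _ = (n : ℝ) ^ ((d : ℝ) / α) * C0 ^ (1 / α) := by
              rw [Real.mul_rpow hN.le hC00.le, ← Real.rpow_natCast, ← Real.rpow_mul hn0.le,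
                mul_one_div]
          _ ≤ _ := by
              gcongr
              rw [ha]
              have : 0 ≤ b * s / α := by positivity
              linarith
      have h5 : Q ≤ C0 ^ (1 / α) := by
        rw [hQ, ← h1, Nat.cast_one, one_div, Real.inv_rpow hn0.le,
          inv_mul_le_iff₀ (by positivity)]
        exact h4
      have h6 : 0 < C1 ^ (s / α) := by positivity
      have h7 : 0 < C0 ^ (1 / α) := by positivity
      nlinarith
    · set h := h₀ / 2 with hh
      have hh1 : 1 ≤ h := by omega
      have hhn : (h : ℝ) ≤ n := by
        have : h ≤ n := by omega
        exact_mod_cast this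
      have hh0' : (0 : ℝ) < h := by exact_mod_cast hh1
      have hR : G.ρ x₀ + h ≤ 2 * n := by omega
      have key := H V G n (2 * n) (G.ρ x₀) h 1 K u f hG one_pos le_rfl hh1 hhn hR x₀ le_rfl
      rw [one_pow, div_one] at key
      set g := (n : ℝ) / h₀ with hg
      have hg0 : 0 < g := by positivity
      have hg3 : 1 / 3 ≤ g := by
        have : h₀ ≤ 3 * n := by
          have : 1 ≤ n := by exact_mod_cast hn1
          omega
        have : (h₀ : ℝ) ≤ 3 * n := by exact_mod_cast this
        rw [hg, le_div_iff₀ hh₀0]; linarith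
      have hgh : (n : ℝ) / h ≤ 3 * g := by
        have : h₀ ≤ 3 * h := by omega
        have : (h₀ : ℝ) ≤ 3 * h := by exact_mod_cast this
        rw [hg, mul_div_assoc', div_le_div_iff₀ hh0' hh₀0]
        nlinarith
      have hUQ : U x₀ = Q * g ^ a := by
        rw [hQ, hg, mul_right_comm, ← Real.mul_rpow (by positivity) (by positivity)]
        rw [div_mul_div_cancel₀ hn0.ne', div_self hh₀0.ne', Real.one_rpow, one_mul]
      set W := Q * (2 * g) ^ a with hW
      have hW0 : 0 < W := by positivity
      -- Up to height `ρ x₀ + h` the distance to the outer sphere is at least `h₀ / 2`, so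
      -- maximality at `x₀` bounds `U` by `W`.
      have hUW : ∀ y, G.ρ y ≤ G.ρ x₀ + h → U y ≤ W := by
        intro y hy
        have h1 := hmax y (Finset.mem_univ _)
        have h2 : h₀ ≤ 2 * (2 * n + 1 - G.ρ y) := by omega
        have h2' : (h₀ : ℝ) ≤ 2 * ((2 * n + 1 - G.ρ y : ℕ) : ℝ) := by exact_mod_cast h2
        have h3 : (1 / (2 * g)) ^ a * U y ≤ Q := by
          refine le_trans ?_ h1
          have := (hU0 y).le
          have h4 : 1 / (2 * g) ≤ ((2 * n + 1 - G.ρ y : ℕ) : ℝ) / n := by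
            rw [hg, div_le_div_iff₀ (by positivity) hn0]
            field_simp
            linarith
          gcongr
        rw [one_div, Real.inv_rpow (by positivity), inv_mul_le_iff₀ (by positivity)] at h3
        rw [hW]; linarith
      have hlpn : G.lpn ((n : ℝ) ^ d) s (G.ρ x₀ + h) U ≤ W ^ (1 - α / s) * C0 ^ (1 / s) := by
        have h1 : ((n : ℝ) ^ d)⁻¹ * ∑ y with G.ρ y ≤ G.ρ x₀ + h, U y ^ s ≤ W ^ (s - α) * C0 := by
          calc _ ≤ ((n : ℝ) ^ d)⁻¹ * ∑ y with G.ρ y ≤ G.ρ x₀ + h, W ^ (s - α) * U y ^ α := by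
                gcongr with y hy
                rw [show U y ^ s = U y ^ (s - α) * U y ^ α by
                  rw [← Real.rpow_add (hU0 y)]; congr 1; ring]
                have := hU0 y
                have := hUW y (by simpa using hy)
                have : 0 ≤ s - α := by linarith
                gcongr
            _ ≤ ((n : ℝ) ^ d)⁻¹ * ∑ y, W ^ (s - α) * U y ^ α := by
                refine mul_le_mul_of_nonneg_left (Finset.sum_le_sum_of_subset_of_nonneg
                  (Finset.filter_subset _ _) fun y _ _ => ?_) (by positivity)
                have := hU0 y
                positivity
            _ = W ^ (s - α) * (((n : ℝ) ^ d)⁻¹ * ∑ y, U y ^ α) := by rw [← Finset.mul_sum]; ring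
            _ ≤ _ := by gcongr
        rw [lpn]
        calc _ ≤ (W ^ (s - α) * C0) ^ (1 / s) := by
              refine Real.rpow_le_rpow ?_ h1 (by positivity)
              exact mul_nonneg (by positivity) (Finset.sum_nonneg fun y _ =>
                Real.rpow_nonneg (hU0 y).le _)
          _ = _ := by
              rw [Real.mul_rpow (by positivity) hC00.le, ← Real.rpow_mul hW0.le]
              congr 2; field_simp
      -- In terms of `Q` and `g = n / h₀`, dividing by `Q^(1 - α/s) g^a` leaves `g^(-w)` with `w ≥
      -- 0`, which is at most `3^w` because `g ≥ 1/3`.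
      have hQα : Q ^ (α / s) ≤ C1 * K ^ (κ / s) := by
        have hx := key.trans (mul_le_mul_of_nonneg_left hlpn (by positivity))
        have h1 : Q * g ^ a ≤ C * (3 * g) ^ b * K ^ (κ / s) *
            (W ^ (1 - α / s) * C0 ^ (1 / s)) := by
          rw [← hUQ]
          exact hx.trans (by gcongr)
        have h2 : W ^ (1 - α / s) = Q ^ (1 - α / s) * (2 ^ (a * (1 - α / s)) *
            (g ^ a * g ^ (- (a * (α / s))))) := by
          rw [hW, Real.mul_rpow hQ0.le (by positivity), ← Real.rpow_mul (by positivity),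
            Real.mul_rpow (by norm_num) hg0.le, ← Real.rpow_add hg0]
          congr 3; ring
        have h3 : Q = Q ^ (α / s) * Q ^ (1 - α / s) := by
          rw [← Real.rpow_add hQ0]; simp
        have h4 : g ^ b * g ^ (-(a * (α / s))) ≤ 3 ^ w := by
          rw [← Real.rpow_add hg0, show b + -(a * (α / s)) = -w by rw [hw]; ring,
            Real.rpow_neg hg0.le, ← Real.inv_rpow hg0.le]
          gcongr
          rw [inv_le_comm₀ hg0 (by norm_num)]
          linarith
        have hp1 : 0 < Q ^ (1 - α / s) * g ^ a := by positivity
        refine le_of_mul_le_mul_right ?_ hp1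
        calc Q ^ (α / s) * (Q ^ (1 - α / s) * g ^ a) = Q * g ^ a := by
              rw [← mul_assoc, ← h3]
          _ ≤ _ := h1
          _ = C * 3 ^ b * 2 ^ (a * (1 - α / s)) * C0 ^ (1 / s) *
                (g ^ b * g ^ (-(a * (α / s)))) * K ^ (κ / s) * (Q ^ (1 - α / s) * g ^ a) := by
              rw [h2, Real.mul_rpow (by norm_num) hg0.le]; ring
          _ ≤ _ := by rw [hC1]; gcongr
      calc Q = (Q ^ (α / s)) ^ (s / α) := by
            rw [← Real.rpow_mul hQ0.le, div_mul_div_cancel₀ hs0.ne', div_self hα.ne',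
              Real.rpow_one]
        _ ≤ (C1 * K ^ (κ / s)) ^ (s / α) := by gcongr
        _ = C1 ^ (s / α) * K ^ (κ / α) := by
            rw [Real.mul_rpow hC10.le (by positivity), ← Real.rpow_mul hK0.le]
            congr 2; field_simp
        _ ≤ _ := by
            gcongr
            have : 0 < C0 ^ (1 / α) := by positivity
            linarith
  have h1 := hmax x (Finset.mem_univ _)
  have h2 : n ≤ 2 * (2 * n + 1 - G.ρ x) := by omega
  have h2' : (n : ℝ) ≤ 2 * ((2 * n + 1 - G.ρ x : ℕ) : ℝ) := by exact_mod_cast h2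
  have h3 : (1 / 2) ^ a * U x ≤ Q := by
    refine le_trans ?_ h1
    have := (hU0 x).le
    gcongr ?_ ^ a * _
    rw [div_le_div_iff₀ (by norm_num) hn0]
    linarith
  rw [one_div, Real.inv_rpow (by norm_num), inv_mul_le_iff₀ (by positivity)] at h3
  have hKκ : 0 < K ^ (κ / α) := by positivity
  calc |u x| ≤ U x := by simp [hU]
    _ ≤ 2 ^ a * Q := h3
    _ ≤ 2 ^ a * ((C1 ^ (s / α) + C0 ^ (1 / α)) * K ^ (κ / α)) := by gcongr
    _ ≤ _ := by nlinarith

/-- The maximal inequality on a finite network. -/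
theorem maximal_inequality (d : ℕ) {D CI p q : ℝ} (hD : 2 < D) (hCI : 0 ≤ CI)
    (hp : 1 < p) (hq : 1 < q) (hpq : 1 / p + 1 / q < 2 / D) {α Cvol : ℝ} (hα : 0 < α)
    (hCvol : 0 ≤ Cvol) :
    ∃ γ : ℝ, 0 < γ ∧ ∃ κ : ℝ, 0 < κ ∧ ∃ c : ℝ, 0 ≤ c ∧
      ∀ (V : Type) [Fintype V] (G : Network V) (n : ℕ) (K : ℝ) (u f : V → ℝ), 2 ≤ n →
        G.Admissible d D CI p q n (2 * n) K u f → (∀ x, G.ρ x ≤ 2 * n) →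
        (Fintype.card V : ℝ) ≤ Cvol * (n : ℝ) ^ d →
        ((n : ℝ) ^ d)⁻¹ * ∑ x, |u x| ^ α ≤ 1 →
        ∀ x, G.ρ x ≤ n → |u x| ≤ c * K ^ κ * (((n : ℝ) ^ d)⁻¹ * ∑ x, |u x| ^ α) ^ γ := by
  obtain ⟨κ₁, hκ₁, C₁, hC₁, H₁⟩ := exists_abs_le d hD hCI hp hq hpq hα hCvol
  obtain ⟨κ, hκ, s₀, hs₀, H⟩ := moser_sup_abs d hD hCI hp hq hpq
  -- With `s ≥ 4κ` the exponent `e = κ / s` is at most `1/4`, so the loss `k^(-2e)` does not consume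
  -- the factor `k` coming from the norm.
  set s := max s₀ (max α (4 * κ)) with hs
  have hsα : α ≤ s := (le_max_left _ _).trans (le_max_right _ _)
  have hsκ : 4 * κ ≤ s := (le_max_right _ _).trans (le_max_right _ _)
  have hs1 : 1 ≤ s := hs₀.trans (le_max_left _ _)
  have hs0 : 0 < s := by linarith
  obtain ⟨C, hC, b, hb, H⟩ := H s (le_max_left _ _)
  set e := κ / s with he
  have he0 : 0 < e := by positivity
  have he4 : e ≤ 1 / 4 := by rw [he, div_le_iff₀ hs0]; linarith
  refine ⟨(1 - 2 * e) / s, div_pos (by linarith) hs0, e + κ₁, by positivity,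
    C * 3 ^ b * (2 * (1 + Cvol) * C₁), by positivity,
    fun V _ G n K u f hn hG hρ hV hu x hx => ?_⟩
  have hn1 : (1 : ℝ) ≤ n := hG.one_le_L
  have hn0 : (0 : ℝ) < n := by linarith
  have hK1 := hG.one_le_K
  have hK0 : 0 < K := by linarith
  have hN : (0 : ℝ) < (n : ℝ) ^ d := by positivity
  set I := ((n : ℝ) ^ d)⁻¹ * ∑ x, |u x| ^ α with hI
  have hI0 : 0 ≤ I := by positivity
  rcases hI0.eq_or_lt with hz | hIpos
  · have h1 : ∑ x, |u x| ^ α = 0 := by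
      rw [hI] at hz
      rcases mul_eq_zero.1 hz.symm with h | h
      · exact absurd h (inv_pos.2 hN).ne'
      · exact h
    have h2 := (Finset.sum_eq_zero_iff_of_nonneg fun y _ => by positivity).1 h1 x
      (Finset.mem_univ _)
    have h3 : |u x| = 0 := ((Real.rpow_eq_zero (abs_nonneg _) hα.ne').1 h2)
    rw [h3]; positivity
  -- The shift is tuned to the size of the solution: `k^s = I`. The iteration needs `k ≤ 1`, and
  -- this is where the bound `I ≤ 1` enters.
  set k := I ^ (1 / s) with hk
  have hk0 : 0 < k := by positivity
  have hk1 : k ≤ 1 := Real.rpow_le_one hI0 hu (by positivity)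
  set M := C₁ * K ^ κ₁ with hM
  have hM1 : 1 ≤ M := one_le_mul_of_one_le_of_one_le hC₁ (Real.one_le_rpow hK1 hκ₁.le)
  set h := n / 2 with hh
  have hh1 : 1 ≤ h := by omega
  have hh0' : (0 : ℝ) < h := by exact_mod_cast hh1
  have hhn : (h : ℝ) ≤ n := by exact_mod_cast Nat.div_le_self n 2
  have hgh : (n : ℝ) / h ≤ 3 := by
    have : n ≤ 3 * h := by omega
    rw [div_le_iff₀ hh0']; exact_mod_cast this
  have key := H V G n (2 * n) n h k K u f hG hk0 hk1 hh1 hhn (by omega) x hx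
  have hks : k ^ s = I := by
    rw [hk, ← Real.rpow_mul hI0, one_div_mul_cancel hs0.ne', Real.rpow_one]
  have hlpn : G.lpn ((n : ℝ) ^ d) s (n + h) (fun y => |u y| + k) ≤ 2 * (1 + Cvol) * M * k := by
    have h1 : ((n : ℝ) ^ d)⁻¹ * ∑ y with G.ρ y ≤ n + h, (|u y| + k) ^ s ≤
        2 ^ s * (1 + Cvol) * M ^ s * I := by
      -- Local boundedness gives `|u| ≤ M` here, so the surplus power `|u|^(s - α)` costs at most
      -- `M^s`.
      have h2 : ∀ y, G.ρ y ≤ n + h → (|u y| + k) ^ s ≤ 2 ^ s * M ^ s * (|u y| ^ α + I) := by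
        intro y hy
        have h3 : |u y| + k ≤ 2 * max |u y| k := by
          have := le_max_left (|u y|) k
          have := le_max_right (|u y|) k
          linarith
        have hMs : 1 ≤ M ^ s := Real.one_le_rpow hM1 hs0.le
        have h4 : max |u y| k ^ s ≤ M ^ s * (|u y| ^ α + I) := by
          have hpα : 0 ≤ |u y| ^ α := by positivity
          rcases max_cases |u y| k with hm | hm <;> rw [hm.1]
          · rcases (abs_nonneg (u y)).eq_or_lt with h0 | h0
            · rw [← h0, Real.zero_rpow hs0.ne', Real.zero_rpow hα.ne']; positivity
            · have h5 : |u y| ^ s = |u y| ^ (s - α) * |u y| ^ α := by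
                rw [← Real.rpow_add h0]; congr 1; ring
              have h6 : |u y| ^ (s - α) ≤ M ^ s := by
                calc |u y| ^ (s - α) ≤ M ^ (s - α) :=
                      Real.rpow_le_rpow h0.le (H₁ V G n K u f hG hρ hV hu y hy) (by linarith)
                  _ ≤ M ^ s := Real.rpow_le_rpow_of_exponent_le hM1 (by linarith)
              rw [h5]
              calc _ ≤ M ^ s * |u y| ^ α := by gcongr
                _ ≤ _ := by gcongr; linarith
          · rw [hks]
            nlinarith
        calc (|u y| + k) ^ s ≤ (2 * max |u y| k) ^ s := by gcongr
          _ = 2 ^ s * max |u y| k ^ s := by rw [Real.mul_rpow (by norm_num) (by positivity)]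
          _ ≤ 2 ^ s * (M ^ s * (|u y| ^ α + I)) := by gcongr
          _ = _ := by ring
      calc _ ≤ ((n : ℝ) ^ d)⁻¹ * ∑ y with G.ρ y ≤ n + h, 2 ^ s * M ^ s * (|u y| ^ α + I) := by
            gcongr with y hy
            exact h2 y (by simpa using hy)
        _ ≤ ((n : ℝ) ^ d)⁻¹ * ∑ y, 2 ^ s * M ^ s * (|u y| ^ α + I) := by
            gcongr
            exact Finset.filter_subset _ _
        _ = 2 ^ s * M ^ s * (I + ((n : ℝ) ^ d)⁻¹ * Fintype.card V * I) := by
            rw [← Finset.mul_sum, Finset.sum_add_distrib, hI]; simp; ring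
        _ ≤ 2 ^ s * M ^ s * (I + Cvol * I) := by
            gcongr
            rw [inv_mul_le_iff₀ hN]; linarith
        _ = _ := by ring
    rw [lpn]
    calc _ ≤ (2 ^ s * (1 + Cvol) * M ^ s * I) ^ (1 / s) := by
          refine Real.rpow_le_rpow ?_ h1 (by positivity)
          positivity
      _ = 2 * (1 + Cvol) ^ (1 / s) * M * k := by
          have e1 : ∀ z : ℝ, 0 ≤ z → (z ^ s) ^ (1 / s) = z := fun z hz => by
            rw [← Real.rpow_mul hz, mul_one_div_cancel hs0.ne', Real.rpow_one]
          rw [Real.mul_rpow (by positivity) hI0, Real.mul_rpow (by positivity) (by positivity),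
            Real.mul_rpow (by positivity) (by positivity), e1 2 (by norm_num), e1 M (by linarith)]
      _ ≤ _ := by
          have : (1 + Cvol) ^ (1 / s) ≤ 1 + Cvol := by
            conv_rhs => rw [← Real.rpow_one (1 + Cvol)]
            refine Real.rpow_le_rpow_of_exponent_le (by linarith) ?_
            rw [div_le_one hs0]; exact hs1
          gcongr
  have hk2 : (K / k ^ 2) ^ e * k = K ^ e * I ^ ((1 - 2 * e) / s) := by
    rw [Real.div_rpow hK0.le (by positivity), hk, ← Real.rpow_natCast, ← Real.rpow_mul hI0,
      ← Real.rpow_mul hI0, div_mul_eq_mul_div, mul_div_assoc, ← Real.rpow_sub hIpos]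
    congr 2; push_cast; ring
  calc |u x| ≤ |u x| + k := by linarith
    _ ≤ _ := key
    _ ≤ C * 3 ^ b * (K / k ^ 2) ^ e * G.lpn ((n : ℝ) ^ d) s (n + h) (fun y => |u y| + k) := by
        have := G.lpn_nonneg (s := s) (r := n + h) (v := fun y => |u y| + k) hN
          fun y => add_nonneg (abs_nonneg _) hk0.le
        gcongr
    _ ≤ C * 3 ^ b * (K / k ^ 2) ^ e * (2 * (1 + Cvol) * M * k) := by gcongr
    _ = C * 3 ^ b * (2 * (1 + Cvol)) * M * ((K / k ^ 2) ^ e * k) := by ring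
    _ = _ := by rw [hk2, hM, Real.rpow_add hK0]; ring

end Network
end Network

/-! ### Isoperimetry in very regular balls. -/

section Lattice
open scoped Classical
variable {d : ℕ}

/-- The box with centre `z` and radius `r`. -/
noncomputable def box (z : Site d) (r : ℕ) : Finset (Site d) :=
  Finset.Icc (fun i => z i - r) (fun i => z i + r)

theorem mem_box {z y : Site d} {r : ℕ} : y ∈ box z r ↔ ∀ i, |y i - z i| ≤ r := by
  simp only [box, Finset.mem_Icc, Pi.le_def, ← forall_and]
  refine forall_congr' fun i => ?_
  rw [abs_le]
  constructor <;> rintro ⟨h1, h2⟩ <;> constructor <;> linarith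

theorem card_box (z : Site d) (r : ℕ) : (box z r).card = (2 * r + 1) ^ d := by
  rw [box, Pi.card_Icc]
  simp only [Int.card_Icc]
  rw [Finset.prod_congr rfl (g := fun _ => 2 * r + 1) fun i _ => by omega]
  simp

theorem mem_box_comm {z y : Site d} {r : ℕ} : y ∈ box z r ↔ z ∈ box y r := by
  simp only [mem_box]
  exact forall_congr' fun i => by rw [abs_sub_comm]

theorem mem_box_add {x y z : Site d} {r s : ℕ} (h : y ∈ box x r) (h' : z ∈ box y s) :
    z ∈ box x (r + s) := by
  rw [mem_box] at *
  intro i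
  have h1 := abs_le.1 (h i)
  have h2 := abs_le.1 (h' i)
  rw [abs_le]; push_cast
  constructor <;> linarith [h1.1, h1.2, h2.1, h2.2]

theorem box_mono {z : Site d} {r s : ℕ} (h : r ≤ s) : box z r ⊆ box z s := fun y hy => by
  rw [mem_box] at *
  exact fun i => (hy i).trans (by exact_mod_cast h)

theorem self_mem_box (z : Site d) (r : ℕ) : z ∈ box z r := by simp [mem_box]

theorem openGraph_adj_iff {ω : Env d} {x y : Site d} :
    (openGraph ω).Adj x y ↔ 0 < conductance ω x y := by
  unfold conductance
  constructor
  · rintro ⟨h, hω⟩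
    simpa [h] using hω
  · intro h
    by_cases h' : (lattice d).Adj x y
    · exact ⟨h', by simpa [h'] using h⟩
    · simp [h'] at h

theorem lattice_adj_mem_box {x y : Site d} (h : (lattice d).Adj x y) : y ∈ box x 1 := by
  rw [mem_box]
  intro i
  have h2 : ∑ i, |x i - y i| = 1 := h
  rw [abs_sub_comm, Nat.cast_one, ← h2]
  exact Finset.single_le_sum (f := fun i => |x i - y i|) (fun _ _ => abs_nonneg _)
    (Finset.mem_univ i)

theorem mem_box_of_walk {ω : Env d} {x y : Site d} (w : (openGraph ω).Walk x y) :
    y ∈ box x w.length := by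
  induction w with
  | nil => exact self_mem_box _ _
  | cons h w ih =>
    rw [SimpleGraph.Walk.length_cons, add_comm]
    exact mem_box_add (lattice_adj_mem_box h.1) ih

theorem mem_box_of_edist_le {ω : Env d} {x y : Site d} {r : ℕ}
    (h : (openGraph ω).edist x y ≤ r) : y ∈ box x r := by
  obtain ⟨w, hw⟩ := (openGraph ω).exists_walk_of_edist_ne_top
    (ne_top_of_le_ne_top (ENat.natCast_ne_top r) h)
  refine box_mono ?_ (mem_box_of_walk w)
  rw [← hw] at h
  exact_mod_cast h

theorem ball_subset_box (ω : Env d) (x : Site d) (r : ℝ) : ball ω x r ⊆ box x ⌊r⌋₊ :=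
  fun _ hy => mem_box_of_edist_le hy.2

theorem ball_finite (ω : Env d) (x : Site d) (r : ℝ) : (ball ω x r).Finite :=
  (box x ⌊r⌋₊).finite_toSet.subset (ball_subset_box ω x r)

theorem ncard_ball_le (ω : Env d) (x : Site d) (r : ℝ) :
    (ball ω x r).ncard ≤ (2 * ⌊r⌋₊ + 1) ^ d := by
  rw [← card_box x, ← Set.ncard_coe_finset]
  exact Set.ncard_le_ncard (ball_subset_box ω x r) (Finset.finite_toSet _)

/-- The set of oriented open bonds that leave `A`. -/
noncomputable def outEdges (ω : Env d) (A : Finset (Site d)) : Finset (Site d × Site d) :=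
  (A.sigma fun x => (nbrs x).filter fun y => (openGraph ω).Adj x y ∧ y ∉ A).image
    fun z => (z.1, z.2)

theorem mem_outEdges {ω : Env d} {A : Finset (Site d)} {z : Site d × Site d} :
    z ∈ outEdges ω A ↔ z.1 ∈ A ∧ (openGraph ω).Adj z.1 z.2 ∧ z.2 ∉ A := by
  simp only [outEdges, Finset.mem_image, Finset.mem_sigma, Finset.mem_filter, mem_nbrs]
  constructor
  · rintro ⟨a, ⟨h1, -, h2, h3⟩, rfl⟩
    exact ⟨h1, h2, h3⟩
  · rintro ⟨h1, h2, h3⟩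
    exact ⟨⟨z.1, z.2⟩, ⟨h1, h2.1, h2, h3⟩, rfl⟩

theorem relBoundary_ncard_le (ω : Env d) (S : Set (Site d)) (A : Finset (Site d)) :
    (relBoundary ω S (↑A ∩ S)).ncard ≤ ((outEdges ω A).filter fun z => z.1 ∈ S).card := by
  have h : relBoundary ω S (↑A ∩ S) ⊆
      (((outEdges ω A).filter fun z => z.1 ∈ S).image fun z => s(z.1, z.2) :
        Finset (Sym2 (Site d))) := by
    rintro e ⟨x, hx, y, hy, hxy, rfl⟩
    refine Finset.mem_coe.2 (Finset.mem_image.2 ⟨(x, y), ?_, rfl⟩)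
    refine Finset.mem_filter.2 ⟨mem_outEdges.2 ⟨hx.1, hxy, fun h => hy.2 ⟨h, hy.1⟩⟩, hx.2⟩
  refine (Set.ncard_le_ncard h (Finset.finite_toSet _)).trans ?_
  rw [Set.ncard_coe_finset]
  exact Finset.card_image_le

/-- A maximal separated subset. -/
theorem exists_separated_subset {X : Type*} (A : Finset X) (Near : X → X → Prop)
    (hrefl : ∀ x, Near x x) (hsymm : ∀ x y, Near x y → Near y x) :
    ∃ T ⊆ A, (∀ x ∈ T, ∀ y ∈ T, Near x y → x = y) ∧ ∀ a ∈ A, ∃ x ∈ T, Near x a := by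
  obtain ⟨T, hT, hmax⟩ := Finset.exists_max_image
    (A.powerset.filter fun T => ∀ x ∈ T, ∀ y ∈ T, Near x y → x = y) Finset.card ⟨∅, by simp⟩
  simp only [Finset.mem_filter, Finset.mem_powerset] at hT hmax
  refine ⟨T, hT.1, hT.2, fun a ha => ?_⟩
  by_contra! h
  have haT : a ∉ T := fun h' => h a h' (hrefl a)
  have := hmax (insert a T) ⟨Finset.insert_subset ha hT.1, fun x hx y hy hxy => by
    rcases Finset.mem_insert.1 hx with rfl | hx' <;> rcases Finset.mem_insert.1 hy with rfl | hy'
    · rfl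
    · exact absurd (hsymm _ _ hxy) (h y hy')
    · exact absurd hxy (h x hx')
    · exact hT.2 x hx' y hy' hxy⟩
  rw [Finset.card_insert_of_notMem haT] at this
  omega

variable {CV Criso CW θ : ℝ} {ω : Env d} {M : ℕ}

/-- Balls of radius `r / 2` about separated points are disjoint. They are still regular, which
explains the factor `2` in the lower bound on `r`, so each has at least `CV (r/2)^d` points, and
those that count lie in a box around `z` of side comparable to `CW r`. -/
theorem card_overlap_le (hCV : 0 < CV) (hCW : 1 ≤ CW) (hreg : IsVeryRegular CV Criso CW θ ω M)
    {T : Finset (Site d)} (hT : ↑T ⊆ ball ω 0 M) {r : ℝ} (hr : 2 * (M : ℝ) ^ (θ / d) ≤ r)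
    (hr1 : 1 ≤ r) (hsep : ∀ x ∈ T, ∀ y ∈ T, (openGraph ω).edist x y ≤ (⌊r⌋₊ : ℕ∞) → x = y)
    (z : Site d) :
    ((T.filter fun x => z ∈ ball ω x (CW * r)).card : ℝ) ≤ (4 * CW + 6) ^ d / CV := by
  set Tz := T.filter fun x => z ∈ ball ω x (CW * r) with hTz
  set B : Site d → Finset (Site d) := fun x => (ball_finite ω x (r / 2)).toFinset with hB
  have hfl : ⌊r / 2⌋₊ + ⌊r / 2⌋₊ ≤ ⌊r⌋₊ := by
    rw [Nat.le_floor_iff (by linarith)]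
    push_cast
    have := Nat.floor_le (by linarith : 0 ≤ r / 2)
    linarith
  have hdisj : (↑Tz : Set (Site d)).PairwiseDisjoint B := by
    intro x hx y hy hxy
    refine Finset.disjoint_left.2 fun w hw hw' => hxy ?_
    simp only [hB, Set.Finite.mem_toFinset] at hw hw'
    refine hsep x (Finset.mem_filter.1 hx).1 y (Finset.mem_filter.1 hy).1 ?_
    have h2 := hw'.2
    rw [SimpleGraph.edist_comm] at h2
    refine ((openGraph ω).edist_triangle).trans ((add_le_add hw.2 h2).trans ?_)
    exact_mod_cast hfl
  have hsub : Tz.biUnion B ⊆ box z (⌊CW * r⌋₊ + ⌊r / 2⌋₊) := by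
    intro w hw
    obtain ⟨x, hx, hxw⟩ := Finset.mem_biUnion.1 hw
    simp only [hB, Set.Finite.mem_toFinset] at hxw
    exact mem_box_add (mem_box_comm.1 (ball_subset_box ω x _ (Finset.mem_filter.1 hx).2))
      (ball_subset_box ω x _ hxw)
  have h1 := Finset.card_le_card hsub
  rw [Finset.card_biUnion hdisj, card_box] at h1
  have h2 : ∀ x ∈ Tz, CV * (r / 2) ^ d ≤ (B x).card := by
    intro x hx
    have := (hreg x (hT (Finset.mem_filter.1 hx).1) (r / 2) (by linarith)).1
    rwa [Set.ncard_eq_toFinset_card _ (ball_finite ω x (r / 2))] at this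
  have h3 : (Tz.card : ℝ) * (CV * (r / 2) ^ d) ≤ ((2 * CW + 3) * r) ^ d := by
    calc _ = ∑ x ∈ Tz, CV * (r / 2) ^ d := by simp
      _ ≤ ∑ x ∈ Tz, ((B x).card : ℝ) := Finset.sum_le_sum h2
      _ ≤ (((2 * (⌊CW * r⌋₊ + ⌊r / 2⌋₊) + 1) ^ d : ℕ) : ℝ) := by exact_mod_cast h1
      _ ≤ _ := by
        push_cast
        have e1 := Nat.floor_le (by nlinarith : 0 ≤ CW * r)
        have e2 := Nat.floor_le (by linarith : 0 ≤ r / 2)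
        gcongr
        nlinarith
  rw [le_div_iff₀ hCV]
  have h4 : 0 < (r / 2) ^ d := by positivity
  refine le_of_mul_le_mul_right ?_ h4
  calc _ = (Tz.card : ℝ) * (CV * (r / 2) ^ d) := by ring
    _ ≤ _ := h3
    _ = _ := by rw [← mul_pow]; congr 1; ring

/-- The isoperimetric inequality on the scale `r` for subsets of a very regular ball. -/
theorem card_le_mul_outEdges (hCV : 0 < CV) (hCriso : 0 < Criso) (hCW : 1 ≤ CW)
    (hreg : IsVeryRegular CV Criso CW θ ω M) {A : Finset (Site d)} (hA : ↑A ⊆ ball ω 0 M)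
    {r : ℝ} (hr : 2 * (M : ℝ) ^ (θ / d) ≤ r) (hr1 : 1 ≤ r) (hvol : (A.card : ℝ) ≤ 1 / 2 * (CV * r ^ d)) :
    (A.card : ℝ) ≤ (4 * CW + 6) ^ d / CV / Criso * r * (outEdges ω A).card := by
  -- The balls of radius `r` about `T` cover `A`. The volume bound makes `A` at most half of each `S
  -- x`, so the relative isoperimetric inequality applies in every `S x`; the sum over `T` is
  -- controlled by `card_overlap_le`.
  obtain ⟨T, hTA, hsep, hcov⟩ := exists_separated_subset A
    (fun x y => (openGraph ω).edist x y ≤ (⌊r⌋₊ : ℕ∞)) (fun x => by simp)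
    (fun x y h => by rwa [SimpleGraph.edist_comm])
  have hT : ↑T ⊆ ball ω 0 M := fun x hx => hA (hTA hx)
  have hMr : (M : ℝ) ^ (θ / d) ≤ r := by
    have : 0 ≤ (M : ℝ) ^ (θ / d) := by positivity
    linarith
  have hreg' : ∀ x ∈ T, IsRegularBall CV Criso CW ω x r := fun x hx => hreg x (hT hx) r hMr
  choose! S hSC hSconn hBS hSB hSiso using fun x hx => (hreg' x hx).2
  have hr0 : 0 < r := by linarith
  have hSfin : ∀ x ∈ T, (S x).Finite := fun x hx => (ball_finite _ _ _).subset (hSB x hx)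
  have h1 : ∀ x ∈ T, Criso * r⁻¹ * ((↑A ∩ S x : Set (Site d)).ncard : ℝ) ≤
      ((outEdges ω A).filter fun z => z.1 ∈ S x).card := by
    intro x hx
    have hv := (hreg' x hx).1
    have hle : ((↑A ∩ S x : Set (Site d)).ncard : ℝ) ≤ A.card := by
      rw [← Set.ncard_coe_finset]
      exact_mod_cast Set.ncard_le_ncard Set.inter_subset_left (Finset.finite_toSet _)
    have hBle : ((ball ω x r).ncard : ℝ) ≤ (S x).ncard := by
      exact_mod_cast Set.ncard_le_ncard (hBS x hx) (hSfin x hx)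
    refine (hSiso x hx _ Set.inter_subset_right ?_).trans ?_
    · linarith
    · exact_mod_cast relBoundary_ncard_le ω (S x) A
  have h2 : (A.card : ℝ) ≤ ∑ x ∈ T, ((↑A ∩ S x : Set (Site d)).ncard : ℝ) := by
    have hsub : A ⊆ T.biUnion fun x => A.filter fun y => y ∈ S x := by
      intro a ha
      obtain ⟨x, hx, hxa⟩ := hcov a ha
      exact Finset.mem_biUnion.2 ⟨x, hx, Finset.mem_filter.2 ⟨ha, hBS x hx ⟨(hA ha).1, hxa⟩⟩⟩
    have := (Finset.card_le_card hsub).trans Finset.card_biUnion_le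
    calc (A.card : ℝ) ≤ ∑ x ∈ T, ((A.filter fun y => y ∈ S x).card : ℝ) := by exact_mod_cast this
      _ = _ := by
        refine Finset.sum_congr rfl fun x _ => ?_
        rw [← Set.ncard_coe_finset]
        congr 2
        ext; simp
  have h3 : ∑ x ∈ T, (((outEdges ω A).filter fun z => z.1 ∈ S x).card : ℝ) ≤
      (outEdges ω A).card * ((4 * CW + 6) ^ d / CV) := by
    calc _ = ∑ x ∈ T, ∑ z ∈ outEdges ω A, if z.1 ∈ S x then (1 : ℝ) else 0 := by simp
      _ = ∑ z ∈ outEdges ω A, ((T.filter fun x => z.1 ∈ S x).card : ℝ) := by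
        rw [Finset.sum_comm]; simp
      _ ≤ ∑ z ∈ outEdges ω A, (4 * CW + 6) ^ d / CV := by
        refine Finset.sum_le_sum fun z _ => ?_
        refine le_trans ?_ (card_overlap_le hCV hCW hreg hT hr hr1 hsep z.1)
        have : (T.filter fun x => z.1 ∈ S x) ⊆ T.filter fun x => z.1 ∈ ball ω x (CW * r) :=
          fun x hx => by
            rw [Finset.mem_filter] at *
            exact ⟨hx.1, hSB x hx.1 hx.2⟩
        exact_mod_cast Finset.card_le_card this
      _ = _ := by simp
  have h4 : Criso * r⁻¹ * (A.card : ℝ) ≤ (outEdges ω A).card * ((4 * CW + 6) ^ d / CV) := by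
    calc _ ≤ Criso * r⁻¹ * ∑ x ∈ T, ((↑A ∩ S x : Set (Site d)).ncard : ℝ) := by gcongr
      _ = ∑ x ∈ T, Criso * r⁻¹ * ((↑A ∩ S x : Set (Site d)).ncard : ℝ) := Finset.mul_sum _ _ _
      _ ≤ _ := Finset.sum_le_sum h1
      _ ≤ _ := h3
  have h5 : (A.card : ℝ) = r / Criso * (Criso * r⁻¹ * A.card) := by field_simp
  rw [h5]
  calc _ ≤ r / Criso * ((outEdges ω A).card * ((4 * CW + 6) ^ d / CV)) := by gcongr
    _ = _ := by ring

/-- Isoperimetric inequality of dimension `(d - θ) / (1 - θ)` in a very regular ball. -/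
theorem exists_isoperimetric (hd : 2 ≤ d) (hCV : 0 < CV) (hCV' : CV ≤ 1) (hCriso : 0 < Criso) (hCW : 1 ≤ CW)
    (hθ : 0 < θ) (hθ' : θ < 1) :
    ∃ CI : ℝ, 0 ≤ CI ∧ ∀ (ω : Env d) (n : ℕ), 1 ≤ n → IsVeryRegular CV Criso CW θ ω (2 * n) →
      ∀ A : Finset (Site d), A.Nonempty → ↑A ⊆ ball ω 0 ((2 * n : ℕ) : ℝ) →
        ((A.card : ℝ) / (n : ℝ) ^ d) ^ (1 - 1 / ((d - θ) / (1 - θ))) ≤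
          CI * (n / (n : ℝ) ^ d) * (outEdges ω A).card := by
  set C₁ := (4 * CW + 6) ^ d / CV / Criso with hC₁
  have hC₁0 : 0 < C₁ := by positivity
  set C₂ := C₁ * (2 / CV) ^ (1 / (d : ℝ)) with hC₂
  have hC₂0 : 0 < C₂ := by positivity
  have hd' : (2 : ℝ) ≤ d := by exact_mod_cast hd
  have hd0 : (0 : ℝ) < d := by linarith
  refine ⟨C₂ * 5 ^ d + 2 ^ (d + 1), by positivity, fun ω n hn hreg A hAne hA => ?_⟩
  have hn1 : (1 : ℝ) ≤ n := by exact_mod_cast hn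
  have hn0 : (0 : ℝ) < n := by linarith
  have hN : (0 : ℝ) < (n : ℝ) ^ d := by positivity
  have ha1 : (1 : ℝ) ≤ A.card := by exact_mod_cast hAne.card_pos
  have ha0 : (0 : ℝ) < A.card := by linarith
  set a : ℝ := (A.card : ℝ)
  set M : ℕ := 2 * n with hM
  have hM1 : (1 : ℝ) ≤ M := by rw [hM]; push_cast; linarith
  -- The smallest admissible scale at which `A` fills at most half of a regular ball.
  set r := max (2 * (M : ℝ) ^ (θ / d)) ((2 * a / CV) ^ (1 / (d : ℝ))) with hr
  have hr2 : 2 ≤ r := by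
    have := Real.one_le_rpow hM1 (by positivity : 0 ≤ θ / d)
    exact le_trans (by linarith) (le_max_left _ _)
  have hrd : 2 * a / CV ≤ r ^ d := by
    calc 2 * a / CV = ((2 * a / CV) ^ (1 / (d : ℝ))) ^ d := by
          rw [← Real.rpow_natCast, ← Real.rpow_mul (by positivity), one_div_mul_cancel hd0.ne',
            Real.rpow_one]
      _ ≤ r ^ d := by gcongr; exact le_max_right _ _
  have hiso : a ≤ C₁ * r * ((outEdges ω A).card : ℝ) := card_le_mul_outEdges hCV hCriso hCW hreg hA (le_max_left _ _) (by linarith : 1 ≤ r)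
    (by rw [div_le_iff₀ hCV] at hrd; simp only [a] at hrd; linarith)
  set b : ℝ := ((outEdges ω A).card : ℝ)
  have hb1 : 1 ≤ b := by
    have hb : 0 < b := by
      by_contra h
      have : b = 0 := le_antisymm (not_lt.1 h) (Nat.cast_nonneg _)
      rw [this, mul_zero] at hiso
      linarith
    have : 0 < (outEdges ω A).card := Nat.cast_pos.1 hb
    simp only [b]; exact_mod_cast this
  have hexp : 1 - 1 / ((d - θ) / (1 - θ)) = ((d : ℝ) - 1) / (d - θ) := by
    have : (d : ℝ) - θ ≠ 0 := by linarith
    rw [one_div_div]; field_simp; ring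
  rw [hexp]
  have hdθ : 0 < (d : ℝ) - θ := by linarith
  have hx0 : 0 < a / (n : ℝ) ^ d := by positivity
  have hnN : (n : ℝ) / (n : ℝ) ^ d = (n : ℝ) ^ (1 - (d : ℝ)) := by
    rw [Real.rpow_sub hn0, Real.rpow_one, Real.rpow_natCast]
  have h5 : (1 : ℝ) ≤ 5 ^ d := one_le_pow₀ (by norm_num)
  have hvol : a / (n : ℝ) ^ d ≤ 5 ^ d := by
    rw [div_le_iff₀ hN, ← mul_pow]
    have e1 : A.card ≤ (2 * M + 1) ^ d := by
      have := ncard_ball_le ω 0 (M : ℝ)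
      rw [Nat.floor_natCast] at this
      refine le_trans ?_ this
      rw [← Set.ncard_coe_finset]
      exact Set.ncard_le_ncard hA (ball_finite _ _ _)
    have e2 : a ≤ (2 * (M : ℝ) + 1) ^ d := by simp only [a]; exact_mod_cast e1
    refine e2.trans ?_
    gcongr
    rw [hM]; push_cast; linarith
  clear_value a b r
  -- If the first entry is the maximum, then `|A|` is of order at most `n^θ` and `b ≥ 1` suffices,
  -- since `(n^(θ-d))^((d-1)/(d-θ)) = n^(1-d)`; this is what fixes `D`. Otherwise `r` is of order
  -- `|A|^(1/d)`, the Euclidean inequality holds, and its exponent may be raised because `|A| / n^d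
  -- ≤ 5^d`.
  rcases max_cases (2 * (M : ℝ) ^ (θ / d)) ((2 * a / CV) ^ (1 / (d : ℝ))) with hc | hc
  · have h1 : a ≤ 2 ^ (d + 1) * (n : ℝ) ^ θ := by
      have e1 : r ^ d = 2 ^ d * (M : ℝ) ^ θ := by
        rw [hr, hc.1, mul_pow, ← Real.rpow_natCast ((M : ℝ) ^ (θ / d)),
          ← Real.rpow_mul (by positivity), div_mul_cancel₀ _ hd0.ne']
      rw [e1] at hrd
      have e2 : (M : ℝ) ^ θ ≤ 2 * (n : ℝ) ^ θ := by
        rw [hM]; push_cast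
        rw [Real.mul_rpow (by norm_num) hn0.le]
        gcongr
        calc (2 : ℝ) ^ θ ≤ 2 ^ (1 : ℝ) := Real.rpow_le_rpow_of_exponent_le (by norm_num) hθ'.le
          _ = 2 := Real.rpow_one 2
      rw [div_le_iff₀ hCV] at hrd
      have e3 : 2 ^ d * (M : ℝ) ^ θ * CV ≤ 2 ^ d * (2 * (n : ℝ) ^ θ) * 1 := by gcongr
      rw [pow_succ]
      have : 0 < 2 ^ d * (n : ℝ) ^ θ := by positivity
      linarith
    have h2 : a / (n : ℝ) ^ d ≤ 2 ^ (d + 1) * (n : ℝ) ^ (θ - d) := by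
      rw [Real.rpow_sub hn0, Real.rpow_natCast, mul_div_assoc']
      gcongr
    have h3 : (a / (n : ℝ) ^ d) ^ (((d : ℝ) - 1) / (d - θ)) ≤ 2 ^ (d + 1) * (n : ℝ) ^ (1 - (d : ℝ)) := by
      have e0 : 0 ≤ ((d : ℝ) - 1) / (d - θ) := div_nonneg (by linarith) hdθ.le
      have e1 : ((d : ℝ) - 1) / (d - θ) ≤ 1 := by rw [div_le_one hdθ]; linarith
      calc _ ≤ (2 ^ (d + 1) * (n : ℝ) ^ (θ - d)) ^ (((d : ℝ) - 1) / (d - θ)) := by gcongr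
        _ = (2 ^ (d + 1) : ℝ) ^ (((d : ℝ) - 1) / (d - θ)) * (n : ℝ) ^ (1 - (d : ℝ)) := by
          rw [Real.mul_rpow (by positivity) (by positivity), ← Real.rpow_mul hn0.le]
          congr 2
          field_simp; ring
        _ ≤ _ := by
          gcongr
          calc _ ≤ (2 ^ (d + 1) : ℝ) ^ (1 : ℝ) :=
                Real.rpow_le_rpow_of_exponent_le (one_le_pow₀ (by norm_num)) e1
            _ = _ := Real.rpow_one _
    rw [hnN]
    have hp : 0 < (n : ℝ) ^ (1 - (d : ℝ)) := by positivity
    calc _ ≤ _ := h3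
      _ ≤ (C₂ * 5 ^ d + 2 ^ (d + 1)) * (n : ℝ) ^ (1 - (d : ℝ)) * 1 := by
        rw [mul_one]; gcongr; have : 0 < C₂ * 5 ^ d := by positivity
        linarith
      _ ≤ _ := by gcongr
  · have h1 : a ^ (1 - 1 / (d : ℝ)) ≤ C₂ * b := by
      rw [Real.rpow_sub ha0, Real.rpow_one, div_le_iff₀ (by positivity)]
      calc a ≤ C₁ * r * b := hiso
        _ = C₂ * b * a ^ (1 / (d : ℝ)) := by
          rw [hr, hc.1, show 2 * a / CV = 2 / CV * a by ring,
            Real.mul_rpow (by positivity) ha0.le, hC₂]; ring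
    have h2 : (a / (n : ℝ) ^ d) ^ (1 - 1 / (d : ℝ)) ≤ C₂ * (n : ℝ) ^ (1 - (d : ℝ)) * b := by
      rw [Real.div_rpow ha0.le hN.le, ← Real.rpow_natCast, ← Real.rpow_mul hn0.le,
        div_le_iff₀ (by positivity)]
      calc _ ≤ C₂ * b := h1
        _ = C₂ * b * ((n : ℝ) ^ (1 - (d : ℝ)) * (n : ℝ) ^ ((d : ℝ) * (1 - 1 / d))) := by
          rw [← Real.rpow_add hn0]
          have : 1 - (d : ℝ) + d * (1 - 1 / d) = 0 := by field_simp; ring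
          rw [this, Real.rpow_zero, mul_one]
        _ = _ := by ring
    have e0 : 0 ≤ ((d : ℝ) - 1) / (d - θ) - (1 - 1 / d) := by
      rw [sub_nonneg, le_div_iff₀ hdθ, one_sub_div hd0.ne', div_mul_eq_mul_div, div_le_iff₀ hd0]
      nlinarith
    have e1 : ((d : ℝ) - 1) / (d - θ) - (1 - 1 / d) ≤ 1 := by
      have : ((d : ℝ) - 1) / (d - θ) ≤ 1 := by rw [div_le_one hdθ]; linarith
      have : 1 / (d : ℝ) ≤ 1 := by rw [div_le_one hd0]; linarith
      linarith
    have h4 : (a / (n : ℝ) ^ d) ^ (((d : ℝ) - 1) / (d - θ) - (1 - 1 / d)) ≤ 5 ^ d := by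
      calc _ ≤ (5 ^ d : ℝ) ^ (((d : ℝ) - 1) / (d - θ) - (1 - 1 / d)) := by gcongr
        _ ≤ (5 ^ d : ℝ) ^ (1 : ℝ) := Real.rpow_le_rpow_of_exponent_le h5 e1
        _ = _ := Real.rpow_one _
    rw [hnN]
    have hp : 0 < (n : ℝ) ^ (1 - (d : ℝ)) := by positivity
    calc _ = (a / (n : ℝ) ^ d) ^ (1 - 1 / (d : ℝ)) *
          (a / (n : ℝ) ^ d) ^ (((d : ℝ) - 1) / (d - θ) - (1 - 1 / d)) := by
          rw [← Real.rpow_add hx0]; congr 1; ring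
      _ ≤ C₂ * (n : ℝ) ^ (1 - (d : ℝ)) * b * 5 ^ d := by gcongr
      _ = (C₂ * 5 ^ d) * (n : ℝ) ^ (1 - (d : ℝ)) * b := by ring
      _ ≤ _ := by gcongr; have : (0 : ℝ) < 2 ^ (d + 1) := by positivity
                  linarith

end Lattice

/-! ### Balls of the cluster as finite networks. -/

section Lattice
open scoped Classical
variable {d : ℕ}

theorem conductance_comm (ω : Env d) (x y : Site d) : conductance ω x y = conductance ω y x := by
  unfold conductance
  by_cases h : (lattice d).Adj x y
  · rw [dif_pos h, dif_pos h.symm]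
    congr 1
    exact Subtype.ext Sym2.eq_swap
  · rw [dif_neg h, dif_neg fun h' => h h'.symm]

theorem conductance_eq_zero {ω : Env d} {x y : Site d} (h : ¬(lattice d).Adj x y) :
    conductance ω x y = 0 := dif_neg h

/-- The ball `B^ω(x, r)` as a finite set. -/
noncomputable def ballF (ω : Env d) (x : Site d) (r : ℕ) : Finset (Site d) :=
  (ball_finite ω x r).toFinset

theorem mem_ballF {ω : Env d} {x y : Site d} {r : ℕ} :
    y ∈ ballF ω x r ↔ y ∈ cluster ω ∧ (openGraph ω).edist x y ≤ r := by
  simp [ballF, ball]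

theorem coe_ballF (ω : Env d) (x : Site d) (r : ℕ) : (ballF ω x r : Set (Site d)) = ball ω x r := by
  simp [ballF]

theorem ballF_mono {ω : Env d} {x : Site d} {r s : ℕ} (h : r ≤ s) : ballF ω x r ⊆ ballF ω x s :=
  fun y hy => by
    rw [mem_ballF] at *
    exact ⟨hy.1, hy.2.trans (by exact_mod_cast h)⟩

theorem card_ballF_le (ω : Env d) (x : Site d) (r : ℕ) :
    (ballF ω x r).card ≤ (2 * r + 1) ^ d := by
  have := ncard_ball_le ω x r
  rwa [← coe_ballF, Set.ncard_coe_finset, Nat.floor_natCast] at this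

theorem mem_cluster_of_reachable {ω : Env d} {x y : Site d} (h : (openGraph ω).Reachable x y)
    (hx : x ∈ cluster ω) : y ∈ cluster ω := by
  have : (openGraph ω).connectedComponentMk y = (openGraph ω).connectedComponentMk x :=
    SimpleGraph.ConnectedComponent.sound h.symm
  simpa only [cluster, Set.mem_ofPred_eq, this] using hx

theorem reachable_of_mem_ballF {ω : Env d} {x y : Site d} {r : ℕ} (h : y ∈ ballF ω x r) :
    (openGraph ω).Reachable x y :=
  (openGraph ω).reachable_of_edist_ne_top
    (ne_top_of_le_ne_top (ENat.natCast_ne_top r) (mem_ballF.1 h).2)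

theorem dist_le_of_mem_ballF {ω : Env d} {x y : Site d} {r : ℕ} (h : y ∈ ballF ω x r) :
    (openGraph ω).dist x y ≤ r := by
  have h1 := (reachable_of_mem_ballF h).coe_dist_eq_edist
  have h2 := (mem_ballF.1 h).2
  rw [← h1] at h2
  exact_mod_cast h2

theorem mem_ballF_of_adj {ω : Env d} {x y z : Site d} {r : ℕ} (h : y ∈ ballF ω x r)
    (hd : (openGraph ω).dist x y < r) (hyz : (openGraph ω).Adj y z) : z ∈ ballF ω x r := by
  rw [mem_ballF]
  refine ⟨mem_cluster_of_reachable hyz.reachable (mem_ballF.1 h).1, ?_⟩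
  refine ((openGraph ω).edist_triangle (v := y)).trans ?_
  rw [SimpleGraph.edist_eq_one_iff_adj.2 hyz, ← (reachable_of_mem_ballF h).coe_dist_eq_edist]
  exact_mod_cast hd

/-- The ball with centre `0` as a finite network. -/
noncomputable def ballNetwork (ω : Env d) (M : ℕ) : Network {x // x ∈ ballF ω 0 M} where
  w x y := conductance ω x y
  ρ x := (openGraph ω).dist 0 x
  symm x y := by rw [conductance_comm]
  nonneg x y := NNReal.coe_nonneg _
  lip x y h := by
    have hadj : (openGraph ω).Adj x y := openGraph_adj_iff.2 (by exact_mod_cast h)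
    have h1 := (reachable_of_mem_ballF x.2).dist_triangle_left (y : Site d)
    rwa [SimpleGraph.dist_eq_one_iff_adj.2 hadj] at h1

/-- No open bond leaves the ball from a vertex strictly inside it, so the equation on the cluster
restricts to the network there. -/
theorem sum_ballF_conductance {ω : Env d} {M : ℕ} {x : Site d} (hx : x ∈ ballF ω 0 M)
    (hd : (openGraph ω).dist 0 x < M) (g : Site d → ℝ) :
    ∑ y : {y // y ∈ ballF ω 0 M}, (conductance ω x y : ℝ) * g y =
      ∑ y ∈ nbrs x, (conductance ω x y : ℝ) * g y := by
  rw [Finset.sum_coe_sort (ballF ω 0 M) fun y => (conductance ω x y : ℝ) * g y]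
  refine Finset.sum_congr_of_eq_on_inter (fun y hy hy' => ?_) (fun y hy hy' => ?_) fun _ _ _ => rfl
  · rw [conductance_eq_zero fun h => hy' (mem_nbrs.2 h)]; simp
  · have : conductance ω x y = 0 := by
      by_contra h
      exact hy' (mem_ballF_of_adj hx hd (openGraph_adj_iff.2 (pos_iff_ne_zero.2 h)))
    simp [this]

theorem sum_ballF_le (ω : Env d) (M : ℕ) (x : Site d) (g : Site d → ℝ) (hg : ∀ y, 0 ≤ g y)
    (h0 : ∀ y, ¬(lattice d).Adj x y → g y = 0) :
    ∑ y : {y // y ∈ ballF ω 0 M}, g y ≤ ∑ y ∈ nbrs x, g y := by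
  rw [Finset.sum_coe_sort (ballF ω 0 M) g, ← Finset.sum_filter_add_sum_filter_not _ (· ∈ nbrs x),
    Finset.sum_eq_zero (s := (ballF ω 0 M).filter fun y => ¬y ∈ nbrs x), add_zero]
  · exact Finset.sum_le_sum_of_subset_of_nonneg (fun y hy => (Finset.mem_filter.1 hy).2)
      fun y _ _ => hg y
  · intro y hy
    exact h0 y fun h => (Finset.mem_filter.1 hy).2 (mem_nbrs.2 h)

theorem mu_ballNetwork_le (ω : Env d) (M : ℕ) (x : {x // x ∈ ballF ω 0 M}) :
    (ballNetwork ω M).mu x ≤ mu ω x :=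
  sum_ballF_le ω M x (fun y => (conductance ω x y : ℝ)) (fun y => NNReal.coe_nonneg _)
    fun y h => by rw [conductance_eq_zero h]; rfl

theorem nu_eq_sum_inv (ω : Env d) (x : Site d) :
    nu ω x = ∑ y ∈ nbrs x, (conductance ω x y : ℝ)⁻¹ := by
  refine Finset.sum_congr rfl fun y _ => ?_
  split_ifs with h
  · rw [one_div]
  · have : conductance ω x y = 0 := le_antisymm (not_lt.1 h) zero_le
    simp [this]

theorem nu_ballNetwork_le (ω : Env d) (M : ℕ) (x : {x // x ∈ ballF ω 0 M}) :
    (ballNetwork ω M).nu x ≤ nu ω x := by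
  rw [nu_eq_sum_inv]
  exact sum_ballF_le ω M x (fun y => (conductance ω x y : ℝ)⁻¹)
    (fun y => inv_nonneg.2 (NNReal.coe_nonneg _)) fun y h => by rw [conductance_eq_zero h]; simp

theorem mu_nonneg (ω : Env d) (x : Site d) : 0 ≤ mu ω x :=
  Finset.sum_nonneg fun _ _ => NNReal.coe_nonneg _

theorem nu_nonneg (ω : Env d) (x : Site d) : 0 ≤ nu ω x := by
  rw [nu_eq_sum_inv]
  exact Finset.sum_nonneg fun _ _ => inv_nonneg.2 (NNReal.coe_nonneg _)

variable {CV Criso CW θ : ℝ}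

/-- For `A` of height less than `2n` all open bonds leaving `A` stay in the ball, so the boundary in
the network is the full one. -/
theorem exists_iso_ballNetwork (hd : 2 ≤ d) (hCV : 0 < CV) (hCV' : CV ≤ 1) (hCriso : 0 < Criso)
    (hCW : 1 ≤ CW) (hθ : 0 < θ) (hθ' : θ < 1) :
    ∃ CI : ℝ, 0 ≤ CI ∧ ∀ (ω : Env d) (n : ℕ), 1 ≤ n → IsVeryRegular CV Criso CW θ ω (2 * n) →
      (ballNetwork ω (2 * n)).Iso ((d - θ) / (1 - θ)) CI n ((n : ℝ) ^ d) (2 * n) := by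
  obtain ⟨CI, hCI, H⟩ := exists_isoperimetric hd hCV hCV' hCriso hCW hθ hθ'
  refine ⟨CI, hCI, fun ω n hn hreg A hA hAR => ?_⟩
  set A' : Finset (Site d) := A.map (Function.Embedding.subtype _) with hA'
  have h1 := H ω n hn hreg A' (hA.map) (by
    intro x hx
    obtain ⟨y, hy, rfl⟩ := Finset.mem_map.1 hx
    rw [← coe_ballF]
    exact y.2)
  rw [hA', Finset.card_map] at h1
  refine h1.trans ?_
  gcongr
  have hout : ∀ z ∈ outEdges ω A', ∃ x : {x // x ∈ ballF ω 0 (2 * n)},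
      ∃ y : {x // x ∈ ballF ω 0 (2 * n)}, z = ((x : Site d), (y : Site d)) ∧ x ∈ A ∧ y ∈ Aᶜ ∧
        0 < (ballNetwork ω (2 * n)).w x y := by
    rintro ⟨z1, z2⟩ hz
    obtain ⟨hz1, hz2, hz3⟩ := mem_outEdges.1 hz
    obtain ⟨x, hx, rfl⟩ := Finset.mem_map.1 hz1
    have hz2' : z2 ∈ ballF ω 0 (2 * n) := mem_ballF_of_adj x.2 (hAR x hx) hz2
    refine ⟨x, ⟨z2, hz2'⟩, rfl, hx, ?_, ?_⟩
    · rw [Finset.mem_compl]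
      intro h
      exact hz3 (Finset.mem_map.2 ⟨_, h, rfl⟩)
    · exact NNReal.coe_pos.2 (openGraph_adj_iff.1 hz2)
  have h2 : (outEdges ω A').card ≤
      ((A ×ˢ Aᶜ).filter fun z => 0 < (ballNetwork ω (2 * n)).w z.1 z.2).card := by
    refine Finset.card_le_card_of_surjOn (fun z => ((z.1 : Site d), (z.2 : Site d))) ?_
    intro z hz
    obtain ⟨x, y, rfl, hx, hy, hxy⟩ := hout z hz
    exact ⟨(x, y), by simpa [hx, hxy] using hy, rfl⟩
  have h3 : (ballNetwork ω (2 * n)).bdry A =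
      (((A ×ˢ Aᶜ).filter fun z => 0 < (ballNetwork ω (2 * n)).w z.1 z.2).card : ℝ) := by
    rw [Finset.card_filter, Finset.sum_product]
    push_cast
    rw [Network.bdry]
    congr!
  rw [h3]
  exact_mod_cast h2

/-- The normalized `ℓ^p`-norm over a finite set of sites. -/
noncomputable def normalizedNorm (N p : ℝ) (B : Finset (Site d)) (f : Site d → ℝ) : ℝ :=
  (N⁻¹ * ∑ x ∈ B, f x ^ p) ^ (1 / p)

theorem fintype_card_ballF_le (ω : Env d) {n : ℕ} (hn : (1 : ℝ) ≤ n) :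
    (Fintype.card (ballF ω 0 (2 * n)) : ℝ) ≤ 5 ^ d * (n : ℝ) ^ d := by
  rw [Fintype.card_coe, ← mul_pow]
  calc ((ballF ω 0 (2 * n)).card : ℝ) ≤ ((2 * (2 * n) + 1 : ℕ) : ℝ) ^ d := by
        exact_mod_cast card_ballF_le ω 0 (2 * n)
    _ ≤ _ := by gcongr; push_cast; linarith

/-- The maximal inequality for solutions of a Poisson equation on a very regular ball. -/
theorem exists_maximal_inequality (hd : 2 ≤ d) (hCV : 0 < CV) (hCV' : CV ≤ 1) (hCriso : 0 < Criso)
    (hCW : 1 ≤ CW) (hθ : 0 < θ) (hθ' : θ < 1) {p q : ℝ} (hp : 1 < p) (hq : 1 < q)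
    (hpq : 1 / p + 1 / q < 2 * (1 - θ) / ((d : ℝ) - θ)) {α : ℝ} (hα : 0 < α) :
    ∃ γ : ℝ, 0 < γ ∧ ∃ κ : ℝ, 0 < κ ∧ ∃ c : ℝ, 0 ≤ c ∧
      ∀ (ω : Env d) (n : ℕ) (u f : Site d → ℝ), 2 ≤ n → IsVeryRegular CV Criso CW θ ω (2 * n) →
        (∀ x ∈ cluster ω, ∑ y ∈ nbrs x, (conductance ω x y : ℝ) * (u x - u y) =
          ∑ y ∈ nbrs x, (conductance ω x y : ℝ) * (f x - f y)) →
        (∀ x y, (lattice d).Adj x y → |f x - f y| ≤ 1 / n) →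
        ((n : ℝ) ^ d)⁻¹ * ∑ x ∈ ballF ω 0 (2 * n), |u x| ^ α ≤ 1 →
        ∀ x ∈ ballF ω 0 n, |u x| ≤
          c * (max 1 (normalizedNorm ((n : ℝ) ^ d) p (ballF ω 0 (2 * n)) (mu ω) *
            normalizedNorm ((n : ℝ) ^ d) q (ballF ω 0 (2 * n)) (nu ω))) ^ κ *
          (((n : ℝ) ^ d)⁻¹ * ∑ x ∈ ballF ω 0 (2 * n), |u x| ^ α) ^ γ := by
  obtain ⟨CI, hCI, hiso⟩ := exists_iso_ballNetwork hd hCV hCV' hCriso hCW hθ hθ'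
  have hd' : (2 : ℝ) ≤ d := by exact_mod_cast hd
  -- Equivalent to `d - 2 + θ > 0`; for `d = 2` this needs `θ > 0`.
  have hD : 2 < ((d : ℝ) - θ) / (1 - θ) := by
    rw [lt_div_iff₀ (by linarith)]; nlinarith
  obtain ⟨γ, hγ, κ, hκ, c, hc, H⟩ := Network.maximal_inequality d hD hCI hp hq
    (by rwa [div_div_eq_mul_div]) hα (Cvol := 5 ^ d) (by positivity)
  refine ⟨γ, hγ, κ, hκ, c, hc, fun ω n u f hn hreg hu hf hsum x hx => ?_⟩
  have hn1 : (1 : ℝ) ≤ n := by exact_mod_cast (by omega : 1 ≤ n)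
  have hn0 : (0 : ℝ) < n := by linarith
  have hN : (0 : ℝ) < (n : ℝ) ^ d := by positivity
  have hS : ∀ g : Site d → ℝ, ∑ x : {x // x ∈ ballF ω 0 (2 * n)}, g x =
      ∑ x ∈ ballF ω 0 (2 * n), g x := fun g => Finset.sum_coe_sort _ g
  set Mp := normalizedNorm ((n : ℝ) ^ d) p (ballF ω 0 (2 * n)) (mu ω) with hMp
  set Nq := normalizedNorm ((n : ℝ) ^ d) q (ballF ω 0 (2 * n)) (nu ω) with hNq
  have hadm : (ballNetwork ω (2 * n)).Admissible d ((d - θ) / (1 - θ)) CI p q n (2 * n)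
      (max 1 (Mp * Nq)) (fun x => u x) (fun x => f x) := by
    refine ⟨hn1, hiso ω n (by omega) hreg, le_max_left _ _, le_trans ?_ (le_max_right _ _), ?_, ?_⟩
    · have e1 : (((n : ℝ) ^ d)⁻¹ * ∑ x, (ballNetwork ω (2 * n)).mu x ^ p) ^ (1 / p) ≤ Mp := by
        rw [hMp, normalizedNorm, ← hS fun x => mu ω x ^ p]
        have := fun x => (ballNetwork ω (2 * n)).mu_nonneg x
        gcongr with x
        · exact mul_nonneg (by positivity) (Finset.sum_nonneg fun x _ => Real.rpow_nonneg (this x) _)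
        · exact this x
        · exact mu_ballNetwork_le ω (2 * n) x
      have e2 : (((n : ℝ) ^ d)⁻¹ * ∑ x, (ballNetwork ω (2 * n)).nu x ^ q) ^ (1 / q) ≤ Nq := by
        rw [hNq, normalizedNorm, ← hS fun x => nu ω x ^ q]
        have := fun x => (ballNetwork ω (2 * n)).nu_nonneg x
        gcongr with x
        · exact mul_nonneg (by positivity) (Finset.sum_nonneg fun x _ => Real.rpow_nonneg (this x) _)
        · exact this x
        · exact nu_ballNetwork_le ω (2 * n) x
      have e3 : 0 ≤ (((n : ℝ) ^ d)⁻¹ * ∑ x, (ballNetwork ω (2 * n)).nu x ^ q) ^ (1 / q) :=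
        Real.rpow_nonneg (mul_nonneg (by positivity) (Finset.sum_nonneg fun x _ =>
          Real.rpow_nonneg ((ballNetwork ω (2 * n)).nu_nonneg x) _)) _
      have e4 : 0 ≤ Mp := Real.rpow_nonneg (mul_nonneg (by positivity)
        (Finset.sum_nonneg fun x _ => Real.rpow_nonneg (mu_nonneg ω x) _)) _
      exact mul_le_mul e1 e2 e3 e4
    · intro x hxR
      have e1 := sum_ballF_conductance x.2 hxR fun y => u x - u y
      have e2 := sum_ballF_conductance x.2 hxR fun y => f x - f y
      exact e1.trans ((hu x (mem_ballF.1 x.2).1).trans e2.symm)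
    · intro x y hxy
      exact hf x y (openGraph_adj_iff.2 (NNReal.coe_pos.1 hxy)).1
  have hcard := fintype_card_ballF_le ω hn1
  have key := H _ (ballNetwork ω (2 * n)) n _ _ _ hn hadm (fun x => dist_le_of_mem_ballF x.2)
    hcard (by rw [hS fun x => |u x| ^ α]; exact hsum)
    ⟨x, ballF_mono (by omega) hx⟩ (dist_le_of_mem_ballF hx)
  rwa [hS fun x => |u x| ^ α] at key

end Lattice

/-! ### Shifts, and measurability of the cluster. -/

section Shift
open scoped Classical
variable {d : ℕ}

theorem lattice_adj_add {x y : Site d} (z : Site d) :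
    (lattice d).Adj (x + z) (y + z) ↔ (lattice d).Adj x y := (transl z).map_rel_iff

theorem conductance_shift (z : Site d) (ω : Env d) (x y : Site d) :
    conductance (shift z ω) x y = conductance ω (x + z) (y + z) := by
  unfold conductance
  by_cases h : (lattice d).Adj x y
  · rw [dif_pos h, dif_pos ((lattice_adj_add z).2 h)]
    rfl
  · rw [dif_neg h, dif_neg fun h' => h ((lattice_adj_add z).1 h')]

theorem openGraph_shift_adj {z : Site d} {ω : Env d} {x y : Site d} :
    (openGraph (shift z ω)).Adj x y ↔ (openGraph ω).Adj (x + z) (y + z) := by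
  rw [openGraph_adj_iff, openGraph_adj_iff, conductance_shift]

theorem shift_shift (x y : Site d) (ω : Env d) : shift y (shift x ω) = shift (y + x) ω := by
  funext e
  obtain ⟨e, he⟩ := e
  induction e using Sym2.ind with
  | _ a b =>
    have h1 : (transl x).mapEdgeSet ((transl y).mapEdgeSet ⟨s(a, b), he⟩) =
        (transl (y + x)).mapEdgeSet ⟨s(a, b), he⟩ := by
      apply Subtype.ext
      change s(a + y + x, b + y + x) = s(a + (y + x), b + (y + x))
      rw [add_assoc, add_assoc]
    exact congrArg ω h1

theorem shift_zero (ω : Env d) : shift 0 ω = ω := by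
  funext e
  obtain ⟨e, he⟩ := e
  induction e using Sym2.ind with
  | _ a b =>
    have h1 : (transl 0).mapEdgeSet ⟨s(a, b), he⟩ = (⟨s(a, b), he⟩ : Bond d) := by
      apply Subtype.ext
      change s(a + 0, b + 0) = s(a, b)
      rw [add_zero, add_zero]
    exact congrArg ω h1

theorem measurable_shift (z : Site d) : Measurable (shift z : Env d → Env d) :=
  measurable_pi_iff.2 fun _ => measurable_pi_apply _

/-- The translation as an isomorphism of open graphs. -/
def shiftIso (z : Site d) (ω : Env d) : openGraph (shift z ω) ≃g openGraph ω where
  toEquiv := Equiv.addRight z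
  map_rel_iff' := openGraph_shift_adj.symm

theorem reachable_shift {z : Site d} {ω : Env d} {x y : Site d} :
    (openGraph (shift z ω)).Reachable x y ↔ (openGraph ω).Reachable (x + z) (y + z) :=
  (SimpleGraph.Iso.reachable_iff (φ := shiftIso z ω)).symm

theorem edist_le_of_hom {V W : Type*} {G : SimpleGraph V} {H : SimpleGraph W} (f : G →g H)
    (x y : V) : H.edist (f x) (f y) ≤ G.edist x y := by
  refine le_iInf fun w => ?_
  exact (H.edist_le (w.map f)).trans (by simp)

theorem edist_shift (z : Site d) (ω : Env d) (x y : Site d) :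
    (openGraph (shift z ω)).edist x y = (openGraph ω).edist (x + z) (y + z) := by
  refine le_antisymm ?_ (edist_le_of_hom (shiftIso z ω).toHom x y)
  have := edist_le_of_hom (shiftIso z ω).symm.toHom (x + z) (y + z)
  have e : ∀ x, (shiftIso z ω).symm (x + z) = x := fun x => (shiftIso z ω).symm_apply_apply x
  simpa [e] using this

/-- Boxes are finite, so a component is infinite iff it leaves every box. In this form membership is
a countable combination of connection events, hence measurable. -/
theorem mem_cluster_iff {ω : Env d} {x : Site d} :
    x ∈ cluster ω ↔ ∀ k : ℕ, ∃ y ∉ box x k, (openGraph ω).Reachable x y := by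
  have hsupp : ((openGraph ω).connectedComponentMk x).supp = {y | (openGraph ω).Reachable x y} := by
    ext y
    rw [SimpleGraph.ConnectedComponent.mem_supp_iff, SimpleGraph.ConnectedComponent.eq]
    exact SimpleGraph.reachable_comm
  change ((openGraph ω).connectedComponentMk x).supp.Infinite ↔ _
  rw [hsupp]
  constructor
  · intro h k
    by_contra! hc
    exact h ((box x k).finite_toSet.subset fun y hy => by
      by_contra hy'
      exact hc y hy' hy)
  · intro h hfin
    obtain ⟨k, hk⟩ : ∃ k : ℕ, ∀ y ∈ hfin.toFinset, y ∈ box x k := by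
      refine ⟨hfin.toFinset.sup fun y => Finset.univ.sup fun i => (y i - x i).natAbs,
        fun y hy => mem_box.2 fun i => ?_⟩
      have h1 : (y i - x i).natAbs ≤ Finset.univ.sup fun i => (y i - x i).natAbs :=
        Finset.le_sup (f := fun i => (y i - x i).natAbs) (Finset.mem_univ i)
      have h2 := Finset.le_sup (f := fun y : Site d => Finset.univ.sup
        fun i => (y i - x i).natAbs) hy
      have h3 := h1.trans h2
      rw [Int.abs_eq_natAbs]
      exact_mod_cast h3
    obtain ⟨y, hy, hxy⟩ := h k
    exact hy (hk y (hfin.mem_toFinset.2 hxy))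

theorem mem_box_add_right {x y z : Site d} {k : ℕ} : y + z ∈ box (x + z) k ↔ y ∈ box x k := by
  simp [mem_box]

theorem mem_cluster_shift {z : Site d} {ω : Env d} {x : Site d} :
    x ∈ cluster (shift z ω) ↔ x + z ∈ cluster ω := by
  rw [mem_cluster_iff, mem_cluster_iff]
  refine forall_congr' fun k => ⟨?_, ?_⟩
  · rintro ⟨y, hy, hxy⟩
    exact ⟨y + z, fun h => hy (mem_box_add_right.1 h), reachable_shift.1 hxy⟩
  · rintro ⟨y, hy, hxy⟩
    refine ⟨y - z, fun h => hy ?_, reachable_shift.2 (by simpa using hxy)⟩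
    simpa using (mem_box_add_right (z := z)).2 h

theorem shift_mem_Env0 {z : Site d} {ω : Env d} : shift z ω ∈ Env0 d ↔ z ∈ cluster ω := by
  change (0 : Site d) ∈ cluster (shift z ω) ↔ _
  rw [mem_cluster_shift, zero_add]

theorem sum_nbrs_add {β : Type*} [AddCommMonoid β] (x z : Site d) (g : Site d → β) :
    ∑ y ∈ nbrs (x + z), g y = ∑ y ∈ nbrs x, g (y + z) := by
  symm
  refine Finset.sum_bij (fun y _ => y + z) (fun y hy => ?_) (fun _ _ _ _ h => add_right_cancel h)
    (fun y hy => ⟨y - z, ?_, sub_add_cancel _ _⟩) fun _ _ => rfl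
  · exact mem_nbrs.2 ((lattice_adj_add z).2 (mem_nbrs.1 hy))
  · rw [mem_nbrs, ← lattice_adj_add z, sub_add_cancel]; exact mem_nbrs.1 hy

theorem mu_shift (z : Site d) (ω : Env d) (x : Site d) : mu (shift z ω) x = mu ω (x + z) := by
  unfold mu
  rw [sum_nbrs_add]
  simp only [conductance_shift]

theorem nu_shift (z : Site d) (ω : Env d) (x : Site d) : nu (shift z ω) x = nu ω (x + z) := by
  rw [nu_eq_sum_inv, nu_eq_sum_inv, sum_nbrs_add]
  simp only [conductance_shift]

theorem measurable_conductance (x y : Site d) : Measurable fun ω : Env d => conductance ω x y := by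
  unfold conductance
  by_cases h : (lattice d).Adj x y
  · simp only [h, dif_pos]
    exact measurable_pi_apply _
  · simp only [h, dif_neg, not_false_eq_true]
    exact measurable_const

theorem measurableSet_adj (x y : Site d) : MeasurableSet {ω : Env d | (openGraph ω).Adj x y} := by
  simp only [openGraph_adj_iff]
  exact measurableSet_lt measurable_const (measurable_conductance x y)

/-- Decomposing a walk at its first step gives the recursion behind measurability of the graph
distance. -/
theorem edist_le_succ_iff {ω : Env d} {x y : Site d} {n : ℕ} :
    (openGraph ω).edist x y ≤ (n + 1 : ℕ) ↔
      (openGraph ω).edist x y ≤ n ∨ ∃ z, (openGraph ω).Adj x z ∧ (openGraph ω).edist z y ≤ n := by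
  constructor
  · intro h
    obtain ⟨w, hw⟩ := (openGraph ω).exists_walk_of_edist_ne_top
      (ne_top_of_le_ne_top (ENat.natCast_ne_top _) h)
    cases w with
    | nil => left; simp
    | cons hadj w =>
      right
      refine ⟨_, hadj, ((openGraph ω).edist_le w).trans ?_⟩
      rw [← hw, SimpleGraph.Walk.length_cons] at h
      have : w.length + 1 ≤ n + 1 := by exact_mod_cast h
      exact_mod_cast Nat.le_of_succ_le_succ this
  · rintro (h | ⟨z, hz, h⟩)
    · exact h.trans (by exact_mod_cast Nat.le_succ n)
    · refine ((openGraph ω).edist_triangle (v := z)).trans ?_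
      rw [SimpleGraph.edist_eq_one_iff_adj.2 hz, add_comm]
      push_cast
      gcongr

theorem measurableSet_edist_le (x y : Site d) (n : ℕ) :
    MeasurableSet {ω : Env d | (openGraph ω).edist x y ≤ n} := by
  induction n generalizing x with
  | zero => simp
  | succ n ih =>
    simp only [edist_le_succ_iff, Set.ofPred_or, Set.ofPred_exists, Set.ofPred_and]
    exact (ih x).union (MeasurableSet.iUnion fun z => (measurableSet_adj x z).inter (ih z))

theorem reachable_iff_exists_edist_le {ω : Env d} {x y : Site d} :
    (openGraph ω).Reachable x y ↔ ∃ n : ℕ, (openGraph ω).edist x y ≤ n := by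
  rw [← SimpleGraph.edist_ne_top_iff_reachable]
  constructor
  · intro h
    exact ⟨_, (ENat.natCast_toNat h).ge⟩
  · rintro ⟨n, hn⟩
    exact ne_top_of_le_ne_top (ENat.natCast_ne_top n) hn

theorem measurableSet_reachable (x y : Site d) :
    MeasurableSet {ω : Env d | (openGraph ω).Reachable x y} := by
  simp only [reachable_iff_exists_edist_le, Set.ofPred_exists]
  exact MeasurableSet.iUnion fun n => measurableSet_edist_le x y n

theorem measurableSet_mem_cluster (x : Site d) : MeasurableSet {ω : Env d | x ∈ cluster ω} := by
  simp only [mem_cluster_iff, Set.ofPred_forall]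
  refine MeasurableSet.iInter fun k => ?_
  have : {ω : Env d | ∃ y ∉ box x k, (openGraph ω).Reachable x y} =
      ⋃ y, ⋃ _ : y ∉ box x k, {ω : Env d | (openGraph ω).Reachable x y} := by
    ext; simp
  rw [this]
  exact MeasurableSet.iUnion fun y => MeasurableSet.iUnion fun _ => measurableSet_reachable x y

theorem measurableSet_Env0 : MeasurableSet (Env0 d) := measurableSet_mem_cluster 0

theorem measurable_mu (x : Site d) : Measurable fun ω : Env d => mu ω x :=
  Finset.measurable_sum _ fun y _ => (measurable_conductance x y).coe_nnreal_real

theorem measurable_nu (x : Site d) : Measurable fun ω : Env d => nu ω x := by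
  simp only [nu_eq_sum_inv]
  exact Finset.measurable_sum _ fun y _ => (measurable_conductance x y).coe_nnreal_real.inv

variable {P : Measure (Env d)}

/-- The arguments use stationarity of `P`, so almost sure statements are moved to `P`, with `ω ∈
Env0 d` as a premise. -/
theorem ae_condLaw_iff [IsProbabilityMeasure P] {p : Env d → Prop} :
    (∀ᵐ ω ∂condLaw P, p ω) ↔ ∀ᵐ ω ∂P, ω ∈ Env0 d → p ω := by
  rw [condLaw, ProbabilityTheory.cond, Measure.ae_ennreal_smul_measure_iff
    (ENNReal.inv_ne_zero.2 (measure_ne_top _ _)), ae_restrict_iff' measurableSet_Env0]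

theorem ae_forall_shift (hP : ∀ z : Site d, MeasurePreserving (shift z) P P) {p : Env d → Prop}
    (h : ∀ᵐ ω ∂P, p ω) : ∀ᵐ ω ∂P, ∀ z, p (shift z ω) :=
  ae_all_iff.2 fun z => (hP z).quasiMeasurePreserving.ae h

theorem reachable_of_unique {ω : Env d}
    (h : ∃! C : (openGraph ω).ConnectedComponent, C.supp.Infinite) {x y : Site d}
    (hx : x ∈ cluster ω) (hy : y ∈ cluster ω) : (openGraph ω).Reachable x y :=
  SimpleGraph.ConnectedComponent.exact (h.unique hx hy)

end Shift

/-! ### Maximal inequality and box averages along the shifts. -/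

section Ergodic
open scoped Classical
open Filter
variable {d : ℕ}

/-- Vitali covering lemma for boxes. -/
theorem exists_disjoint_boxes (X : Finset (Site d)) (L : Site d → ℕ) :
    ∃ Y ⊆ X, (↑Y : Set (Site d)).PairwiseDisjoint (fun y => box y (L y)) ∧
      ∀ x ∈ X, ∃ y ∈ Y, x ∈ box y (2 * L y) := by
  induction hc : X.card using Nat.strong_induction_on generalizing X with
  | _ c ih =>
    rcases X.eq_empty_or_nonempty with rfl | hne
    · exact ⟨∅, by simp, by simp, by simp⟩
    -- Greedy choice of a box of largest radius: the centre of any box meeting it lies within twice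
    -- that radius, and induction treats the boxes disjoint from it.
    obtain ⟨y, hy, hmax⟩ := X.exists_max_image L hne
    set X' := X.filter fun x => Disjoint (box x (L x)) (box y (L y)) with hX'
    have hyX' : y ∉ X' := fun h => by
      have := (Finset.mem_filter.1 h).2
      rw [disjoint_self, Finset.bot_eq_empty] at this
      exact Finset.notMem_empty y (this ▸ self_mem_box y (L y))
    have hlt : X'.card < c := by
      rw [← hc]
      exact Finset.card_lt_card ((Finset.ssubset_iff_of_subset (Finset.filter_subset _ _)).2
        ⟨y, hy, hyX'⟩)
    obtain ⟨Y, hYX, hdisj, hcov⟩ := ih _ hlt X' rfl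
    refine ⟨insert y Y, Finset.insert_subset hy (hYX.trans (Finset.filter_subset _ _)), ?_, ?_⟩
    · rw [Finset.coe_insert]
      refine hdisj.insert fun z hz _ => ?_
      exact ((Finset.mem_filter.1 (hYX hz)).2).symm
    · intro x hx
      by_cases h : Disjoint (box x (L x)) (box y (L y))
      · obtain ⟨z, hz, hxz⟩ := hcov x (Finset.mem_filter.2 ⟨hx, h⟩)
        exact ⟨z, Finset.mem_insert_of_mem hz, hxz⟩
      · rw [Finset.not_disjoint_iff] at h
        obtain ⟨w, hw, hw'⟩ := h
        refine ⟨y, Finset.mem_insert_self _ _, ?_⟩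
        have := mem_box_add hw' (mem_box_comm.1 hw)
        exact box_mono (by have := hmax x hx; omega) this

theorem card_le_sum_card_box {X Y : Finset (Site d)} {L : Site d → ℕ}
    (h : ∀ x ∈ X, ∃ y ∈ Y, x ∈ box y (2 * L y)) :
    X.card ≤ 2 ^ d * ∑ y ∈ Y, (box y (L y)).card := by
  have h1 : X ⊆ Y.biUnion fun y => box y (2 * L y) := fun x hx => by
    obtain ⟨y, hy, hxy⟩ := h x hx
    exact Finset.mem_biUnion.2 ⟨y, hy, hxy⟩
  refine (Finset.card_le_card h1).trans (Finset.card_biUnion_le.trans ?_)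
  rw [Finset.mul_sum]
  refine Finset.sum_le_sum fun y _ => ?_
  rw [card_box, card_box, ← mul_pow]
  exact Nat.pow_le_pow_left (by omega) _

/-- The sum of `g` over the environments seen from the points of a box. -/
noncomputable def boxSum (g : Env d → ℝ≥0∞) (n : ℕ) (ω : Env d) : ℝ≥0∞ :=
  ∑ x ∈ box (0 : Site d) n, g (shift x ω)

theorem boxSum_shift (g : Env d → ℝ≥0∞) (n : ℕ) (ω : Env d) (x : Site d) :
    boxSum g n (shift x ω) = ∑ z ∈ box x n, g (shift z ω) := by
  unfold boxSum
  refine Finset.sum_bij (fun y _ => y + x) (fun y hy => ?_) (fun _ _ _ _ h => add_right_cancel h)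
    (fun y hy => ⟨y - x, ?_, sub_add_cancel _ _⟩) fun y _ => by rw [shift_shift]
  · have := (mem_box_add_right (z := x)).2 hy
    rwa [zero_add] at this
  · rw [← mem_box_add_right (z := x), sub_add_cancel, zero_add]; exact hy

theorem measurable_boxSum {g : Env d → ℝ≥0∞} (hg : Measurable g) (n : ℕ) :
    Measurable (boxSum g n) :=
  Finset.measurable_sum _ fun x _ => hg.comp (measurable_shift x)

/-- Serves both the upper and the lower ergodic bound. The region `B` need only contain the points
of the selected boxes where `g` does not vanish. -/
theorem sum_vitali_le {X Y : Finset (Site d)} {L : Site d → ℕ} {g : Env d → ℝ≥0∞} {ω : Env d}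
    {t : ℝ≥0∞} {B : Finset (Site d)} (hcov : ∀ x ∈ X, ∃ y ∈ Y, x ∈ box y (2 * L y))
    (hdisj : (↑Y : Set (Site d)).PairwiseDisjoint (fun y => box y (L y)))
    (ht : ∀ y ∈ Y, t * (box y (L y)).card ≤ ∑ z ∈ box y (L y), g (shift z ω))
    (hB : ∀ y ∈ Y, ∀ z ∈ box y (L y), g (shift z ω) ≠ 0 → z ∈ B) :
    t * X.card ≤ 2 ^ d * ∑ z ∈ B, g (shift z ω) := by
  have h1 : (X.card : ℝ≥0∞) ≤ 2 ^ d * ∑ y ∈ Y, ((box y (L y)).card : ℝ≥0∞) := by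
    exact_mod_cast card_le_sum_card_box hcov
  calc t * X.card ≤ t * (2 ^ d * ∑ y ∈ Y, ((box y (L y)).card : ℝ≥0∞)) := by gcongr
    _ = 2 ^ d * ∑ y ∈ Y, t * (box y (L y)).card := by rw [mul_left_comm, Finset.mul_sum]
    _ ≤ 2 ^ d * ∑ y ∈ Y, ∑ z ∈ box y (L y), g (shift z ω) := by
      gcongr with y hy; exact ht y hy
    _ = 2 ^ d * ∑ z ∈ Y.biUnion fun y => box y (L y), g (shift z ω) := by
      rw [Finset.sum_biUnion hdisj]
    _ ≤ 2 ^ d * ∑ z ∈ B, g (shift z ω) := by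
      refine mul_le_mul' le_rfl ?_
      rw [← Finset.sum_filter_ne_zero]
      refine Finset.sum_le_sum_of_subset fun z hz => ?_
      obtain ⟨hz, hz0⟩ := Finset.mem_filter.1 hz
      obtain ⟨y, hy, hzy⟩ := Finset.mem_biUnion.1 hz
      exact hB y hy z hzy hz0

variable {P : Measure (Env d)}

theorem lintegral_boxSum (hP : ∀ z : Site d, MeasurePreserving (shift z) P P)
    {g : Env d → ℝ≥0∞} (hg : Measurable g) (n : ℕ) :
    ∫⁻ ω, boxSum g n ω ∂P = (2 * n + 1) ^ d * ∫⁻ ω, g ω ∂P := by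
  unfold boxSum
  rw [lintegral_finsetSum (f := fun x ω => g (shift x ω)) _
    fun x _ => hg.comp (measurable_shift x)]
  rw [Finset.sum_congr rfl fun x _ => (hP x).lintegral_comp hg, Finset.sum_const, card_box,
    nsmul_eq_mul]
  push_cast; rfl

/-- The weak-type maximal inequality. -/
theorem maximal_ergodic (hP : ∀ z : Site d, MeasurePreserving (shift z) P P)
    {g : Env d → ℝ≥0∞} (hg : Measurable g) (t : ℝ≥0∞) (K : ℕ) :
    t * P {ω | ∃ L ≤ K, t * (2 * L + 1) ^ d ≤ boxSum g L ω} ≤ 4 ^ d * ∫⁻ ω, g ω ∂P := by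
  set E := {ω : Env d | ∃ L ≤ K, t * (2 * L + 1) ^ d ≤ boxSum g L ω} with hE
  have hEm : MeasurableSet E := by
    have : E = ⋃ L, ⋃ _ : L ≤ K, {ω : Env d | t * (2 * L + 1) ^ d ≤ boxSum g L ω} := by
      ext; simp [hE]
    rw [this]
    exact MeasurableSet.iUnion fun L => MeasurableSet.iUnion fun _ =>
      measurableSet_le measurable_const (measurable_boxSum hg L)
  -- Transference: the covering argument is run for a fixed environment with centres in the box of
  -- radius `K`, and stationarity turns both sides into integrals. The constant `4^d` comes from `2
  -- (4K + 1) ≤ 4 (2K + 1)`.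
  have key : ∀ ω, t * boxSum (E.indicator 1) K ω ≤ 2 ^ d * boxSum g (2 * K) ω := by
    intro ω
    set X := (box (0 : Site d) K).filter fun x => shift x ω ∈ E with hX
    have h1 : boxSum (E.indicator 1) K ω = X.card := by
      simp only [boxSum, hX, Set.indicator_apply, Pi.one_apply]
      rw [Finset.card_filter, Nat.cast_sum]
      exact Finset.sum_congr rfl fun x _ => by split_ifs <;> simp
    have h2 : ∀ x ∈ X, ∃ L ≤ K, t * (2 * L + 1) ^ d ≤ boxSum g L (shift x ω) :=
      fun x hx => (Finset.mem_filter.1 hx).2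
    choose! L hLK hL using h2
    obtain ⟨Y, hYX, hdisj, hcov⟩ := exists_disjoint_boxes X L
    rw [h1]
    refine sum_vitali_le hcov hdisj (fun y hy => ?_) fun y hy z hz _ => ?_
    · rw [card_box, ← boxSum_shift]
      exact_mod_cast hL y (hYX hy)
    · have := mem_box_add (Finset.mem_filter.1 (hYX hy)).1 hz
      exact box_mono (by have := hLK y (hYX hy); omega) this
  have h3 := lintegral_mono (μ := P) key
  rw [lintegral_const_mul _ (measurable_boxSum (measurable_one.indicator hEm) K),
    lintegral_const_mul _ (measurable_boxSum hg _),
    lintegral_boxSum hP (measurable_one.indicator hEm), lintegral_boxSum hP hg,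
    lintegral_indicator_one hEm] at h3
  have h4 : ((2 * K + 1 : ℝ≥0∞)) ^ d * (t * P E) ≤
      (2 * K + 1 : ℝ≥0∞) ^ d * (4 ^ d * ∫⁻ ω, g ω ∂P) := by
    calc _ = t * ((2 * K + 1 : ℝ≥0∞) ^ d * P E) := by ring
      _ ≤ _ := h3
      _ = (2 * (2 * ((2 * K : ℕ) : ℝ≥0∞) + 1)) ^ d * ∫⁻ ω, g ω ∂P := by rw [← mul_assoc, mul_pow]
      _ ≤ (4 * (2 * K + 1)) ^ d * ∫⁻ ω, g ω ∂P := by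
        have h5 : 2 * (2 * (2 * K) + 1) ≤ 4 * (2 * K + 1) := by omega
        have h6 : (2 * (2 * ((2 * K : ℕ) : ℝ≥0∞) + 1)) ≤ 4 * (2 * K + 1) := by exact_mod_cast h5
        exact mul_le_mul' (pow_le_pow_left' h6 d) le_rfl
      _ = _ := by rw [mul_pow]; ring
  refine (ENNReal.mul_le_mul_iff_right ?_ ?_).1 h4
  · positivity
  · exact ENNReal.pow_ne_top (by finiteness)

/-- The upper limit of the averages of `g` over the environments seen from large boxes. -/
noncomputable def limsupAvg (g : Env d → ℝ≥0∞) (ω : Env d) : ℝ≥0∞ :=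
  limsup (fun n : ℕ => boxSum g n ω / (2 * n + 1) ^ d) atTop

theorem measurable_limsupAvg {g : Env d → ℝ≥0∞} (hg : Measurable g) :
    Measurable (limsupAvg g) :=
  Measurable.limsup fun n => (measurable_boxSum hg n).div_const _

theorem exists_mem_box_zero (z : Site d) : ∃ k, z ∈ box (0 : Site d) k :=
  ⟨Finset.univ.sup fun i => (z i).natAbs, mem_box.2 fun i => by
    rw [Pi.zero_apply, sub_zero, Int.abs_eq_natAbs]
    exact_mod_cast Finset.le_sup (f := fun i => (z i).natAbs) (Finset.mem_univ i)⟩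

/-- The box of radius `n` about `0` lies in the box of radius `n + k` about `z`, and the ratio of
the volumes tends to one. -/
theorem limsupAvg_le_shift (g : Env d → ℝ≥0∞) (z : Site d) (ω : Env d) :
    limsupAvg g ω ≤ limsupAvg g (shift z ω) := by
  obtain ⟨k, hk⟩ := exists_mem_box_zero (-z)
  have hle : ∀ n, boxSum g n ω ≤ boxSum g (n + k) (shift z ω) := fun n => by
    rw [boxSum_shift]
    refine Finset.sum_le_sum_of_subset fun y hy => ?_
    have h1 : (0 : Site d) ∈ box z k := by
      have := (mem_box_add_right (z := z)).2 hk
      rw [neg_add_cancel, zero_add] at this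
      exact mem_box_comm.1 this |> fun h => mem_box_comm.1 (mem_box_comm.1 this)
    have := mem_box_add h1 hy
    rwa [add_comm n]
  refine le_of_forall_lt fun c hc => ?_
  obtain ⟨c', hcc', hc'⟩ := exists_between hc
  obtain ⟨c'', hcc'', hc''⟩ := exists_between hcc'
  refine hcc''.trans_le (le_limsup_of_frequently_le ?_)
  have h1 : ∃ᶠ n : ℕ in atTop, c' < boxSum g n ω / (2 * n + 1) ^ d := frequently_lt_of_lt_limsup
    (by isBoundedDefault) hc'
  have hc''top : c'' ≠ ⊤ := hc''.ne_top
  have hc'top : c' ≠ ⊤ := hc'.ne_top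
  have h2 : ∀ᶠ n : ℕ in atTop, c'' * (2 * (n + k : ℕ) + 1) ^ d ≤ c' * (2 * n + 1) ^ d := by
    lift c'' to ℝ≥0 using hc''top
    lift c' to ℝ≥0 using hc'top
    have hlt : (c'' : ℝ) < c' := by exact_mod_cast hc''
    have ht : Tendsto (fun n : ℕ => (c'' : ℝ) * (1 + 2 * k / (2 * (n : ℝ) + 1)) ^ d) atTop
        (nhds ((c'' : ℝ) * (1 + 0) ^ d)) := by
      refine Tendsto.const_mul _ (Tendsto.pow (Tendsto.const_add _ ?_) _)
      refine Tendsto.div_atTop tendsto_const_nhds ?_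
      exact tendsto_atTop_add_const_right _ _
        (tendsto_natCast_atTop_atTop.const_mul_atTop (by norm_num))
    rw [add_zero, one_pow, mul_one] at ht
    filter_upwards [ht.eventually_lt_const hlt] with n hn
    have hn0 : (0 : ℝ) < 2 * (n : ℝ) + 1 := by positivity
    have : (c'' : ℝ) * (2 * ((n + k : ℕ) : ℝ) + 1) ^ d ≤ c' * (2 * n + 1) ^ d := by
      calc _ = (c'' : ℝ) * (1 + 2 * k / (2 * (n : ℝ) + 1)) ^ d * (2 * n + 1) ^ d := by
            rw [mul_assoc, ← mul_pow]; congr 2; field_simp; push_cast; ring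
        _ ≤ _ := by gcongr
    have h' : c'' * (2 * ((n + k : ℕ) : ℝ≥0) + 1) ^ d ≤ c' * (2 * n + 1) ^ d := by exact_mod_cast this
    exact_mod_cast h'
  have h3 : ∃ᶠ n : ℕ in atTop,
      c'' ≤ boxSum g (n + k) (shift z ω) / (2 * ((n + k : ℕ) : ℝ≥0∞) + 1) ^ d := by
    refine (h1.and_eventually h2).mono fun n hn => ?_
    obtain ⟨ha, hb⟩ := hn
    rw [ENNReal.le_div_iff_mul_le (Or.inl (by positivity))
      (Or.inl (ENNReal.pow_ne_top (by finiteness)))]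
    refine hb.trans (le_trans ?_ (hle n))
    rw [ENNReal.lt_div_iff_mul_lt (Or.inl (by positivity))
      (Or.inl (ENNReal.pow_ne_top (by finiteness)))] at ha
    exact ha.le
  exact (tendsto_add_atTop_nat k).frequently h3

theorem limsupAvg_shift (g : Env d → ℝ≥0∞) (z : Site d) (ω : Env d) :
    limsupAvg g (shift z ω) = limsupAvg g ω := by
  refine le_antisymm ?_ (limsupAvg_le_shift g z ω)
  have := limsupAvg_le_shift g (-z) (shift z ω)
  rwa [shift_shift, neg_add_cancel, shift_zero] at this

theorem limsupAvg_zero_one (hP : LawAssumption P) {g : Env d → ℝ≥0∞} (hg : Measurable g)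
    (t : ℝ≥0∞) : P {ω | t ≤ limsupAvg g ω} = 0 ∨ P {ω | t ≤ limsupAvg g ω} = 1 :=
  hP.ergodic _ (measurableSet_le measurable_const (measurable_limsupAvg hg)) fun z => by
    ext ω
    simp only [Set.mem_preimage, Set.mem_ofPred_eq, limsupAvg_shift]

/-- By ergodicity the upper limit exceeds a given level with probability zero or one, and the
maximal inequality excludes one. The crude factor `4^d` replaces a pointwise ergodic theorem. -/
theorem eventually_boxSum_le [IsProbabilityMeasure P] (hP : LawAssumption P)
    {g : Env d → ℝ≥0∞} (hg : Measurable g)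
    {t : ℝ≥0∞} (ht : 4 ^ d * ∫⁻ ω, g ω ∂P < t) :
    ∀ᵐ ω ∂P, ∀ᶠ n : ℕ in atTop, boxSum g n ω ≤ t * (2 * n + 1) ^ d := by
  obtain ⟨s, hs, hst⟩ := exists_between ht
  obtain ⟨s', hs', hss'⟩ := exists_between hs
  have hzero : P {ω | s ≤ limsupAvg g ω} = 0 := by
    refine (limsupAvg_zero_one hP hg s).resolve_right fun h1 => ?_
    set E : ℕ → Set (Env d) := fun K => {ω | ∃ L ≤ K, s' * (2 * L + 1) ^ d ≤ boxSum g L ω} with hE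
    have hmono : Monotone E := fun K K' h ω ⟨L, hL, h2⟩ => ⟨L, hL.trans h, h2⟩
    have hsub : {ω | s ≤ limsupAvg g ω} ⊆ ⋃ K, E K := by
      intro ω hω
      have hω' : s' < limsupAvg g ω := hss'.trans_le hω
      obtain ⟨n, hn⟩ := (frequently_lt_of_lt_limsup (by isBoundedDefault) hω').exists
      refine Set.mem_iUnion.2 ⟨n, n, le_rfl, ?_⟩
      rw [ENNReal.lt_div_iff_mul_lt (Or.inl (by positivity))
        (Or.inl (ENNReal.pow_ne_top (by finiteness)))] at hn
      exact hn.le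
    have h2 : P (⋃ K, E K) = 1 := le_antisymm prob_le_one (h1 ▸ measure_mono hsub)
    have h3 : Tendsto (fun K => s' * P (E K)) atTop (nhds (s' * 1)) := by
      refine ENNReal.Tendsto.const_mul ?_ (Or.inl one_ne_zero)
      rw [← h2]
      exact tendsto_measure_iUnion_atTop hmono
    rw [mul_one] at h3
    have h4 := le_of_tendsto' h3 fun K => maximal_ergodic hP.stationary hg s' K
    exact absurd h4 (not_le.2 hs')
  have hae : ∀ᵐ ω ∂P, limsupAvg g ω < s := by
    rw [ae_iff]
    simpa only [not_lt] using hzero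
  filter_upwards [hae] with ω hω
  filter_upwards [eventually_lt_of_limsup_lt (hω.trans hst)] with n hn
  rw [ENNReal.div_lt_iff (Or.inl (by positivity)) (Or.inl (ENNReal.pow_ne_top (by finiteness)))] at hn
  exact hn.le

/-- Boundedness of `g` permits the reverse Fatou lemma: the mean of the upper limit is at least the
mean of `g`. By the zero-one law the upper limit is then almost surely above any smaller level. -/
theorem exists_le_boxSum [IsProbabilityMeasure P] (hP : LawAssumption P)
    {g : Env d → ℝ≥0∞} (hg : Measurable g) {M : ℝ≥0∞} (hM : M ≠ ⊤) (hgM : ∀ ω, g ω ≤ M)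
    {t : ℝ≥0∞} (ht : t < ∫⁻ ω, g ω ∂P) :
    ∀ᵐ ω ∂P, ∃ L : ℕ, t * (2 * L + 1) ^ d ≤ boxSum g L ω := by
  obtain ⟨s, hts, hs⟩ := exists_between ht
  have hpos : ∀ n : ℕ, ((2 * n + 1 : ℝ≥0∞)) ^ d ≠ 0 := fun n => by positivity
  have hfin : ∀ n : ℕ, ((2 * n + 1 : ℝ≥0∞)) ^ d ≠ ⊤ := fun n => ENNReal.pow_ne_top (by finiteness)
  have h1 : ∫⁻ ω, g ω ∂P ≤ ∫⁻ ω, limsupAvg g ω ∂P := by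
    have hb : ∀ n : ℕ, (fun ω => boxSum g n ω / (2 * n + 1) ^ d) ≤ᵐ[P] fun _ => M := fun n =>
      ae_of_all _ fun ω => by
        rw [ENNReal.div_le_iff (hpos n) (hfin n)]
        calc boxSum g n ω ≤ ∑ x ∈ box (0 : Site d) n, M := Finset.sum_le_sum fun x _ => hgM _
          _ = M * (2 * n + 1) ^ d := by
            rw [Finset.sum_const, card_box, nsmul_eq_mul, mul_comm]; push_cast; rfl
    have := limsup_lintegral_le (μ := P) (f := fun (n : ℕ) ω => boxSum g n ω / (2 * n + 1) ^ d)
      (fun _ => M) (fun n => (measurable_boxSum hg n).div_const _) hb (by simpa using hM)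
    refine le_trans (le_of_eq ?_) this
    have e : ∀ n : ℕ, ∫⁻ ω, boxSum g n ω / (2 * n + 1) ^ d ∂P = ∫⁻ ω, g ω ∂P := fun n => by
      simp only [div_eq_mul_inv]
      rw [lintegral_mul_const _ (measurable_boxSum hg n), lintegral_boxSum hP.stationary hg,
        mul_right_comm, ENNReal.mul_inv_cancel (hpos n) (hfin n), one_mul]
    simp only [e, limsup_const]
  have h2 : P {ω | s ≤ limsupAvg g ω} = 1 := by
    refine (limsupAvg_zero_one hP hg s).resolve_left fun h0 => ?_
    have hae : ∀ᵐ ω ∂P, limsupAvg g ω ≤ s := by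
      have : ∀ᵐ ω ∂P, ¬ s ≤ limsupAvg g ω := by
        rw [ae_iff]; simpa only [not_not] using h0
      filter_upwards [this] with ω hω using (not_le.1 hω).le
    have := lintegral_mono_ae hae
    rw [lintegral_const, measure_univ, mul_one] at this
    exact absurd (hs.trans_le h1) (not_lt.2 this)
  have h3 : ∀ᵐ ω ∂P, s ≤ limsupAvg g ω := by
    rw [← prob_compl_eq_zero_iff (measurableSet_le measurable_const (measurable_limsupAvg hg))] at h2
    exact h2
  filter_upwards [h3] with ω hω
  obtain ⟨n, hn⟩ := (frequently_lt_of_lt_limsup (by isBoundedDefault) (hts.trans_le hω)).exists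
  refine ⟨n, ?_⟩
  rw [ENNReal.lt_div_iff_mul_lt (Or.inl (hpos n)) (Or.inl (hfin n))] at hn
  exact hn.le

end Ergodic

/-! ### Comparison of ergodic sums over balls of the cluster. -/

section BallSums
open scoped Classical
open Filter
variable {d : ℕ} {P : Measure (Env d)}

theorem exists_measure_le_of_antitone {α : Type*} [MeasurableSpace α] {Q : Measure α}
    [IsFiniteMeasure Q] {s : ℕ → Set α} (hs : ∀ n, MeasurableSet (s n)) (hanti : Antitone s)
    (h : ∀ᵐ x ∂Q, ∃ n, x ∉ s n) {ε : ℝ≥0∞} (hε : 0 < ε) : ∃ n, Q (s n) ≤ ε := by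
  have h1 := tendsto_measure_iInter_atTop (μ := Q) (fun n => (hs n).nullMeasurableSet) hanti
    ⟨0, measure_ne_top _ _⟩
  have h2 : Q (⋂ n, s n) = 0 := by
    rw [ae_iff] at h
    convert h using 2
    ext x; simp
  rw [h2] at h1
  obtain ⟨n, hn⟩ := (h1.eventually_lt_const hε).exists
  exact ⟨n, hn.le⟩

/-- The environments for which the origin lies in the infinite cluster, but either the averages
of `g` over the boxes of radius at most `K` are all small, or some cluster point of the box of
radius `K` is at graph distance larger than `R`. -/
def badSet (g : Env d → ℝ≥0∞) (t : ℝ≥0∞) (K R : ℕ) : Set (Env d) :=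
  Env0 d ∩ ({ω | ∀ L ≤ K, boxSum g L ω < t * (2 * L + 1) ^ d} ∪
    {ω | ∃ y ∈ box (0 : Site d) K, y ∈ cluster ω ∧ ¬(openGraph ω).edist 0 y ≤ R})

theorem measurableSet_small_boxSum {g : Env d → ℝ≥0∞} (hg : Measurable g) (t : ℝ≥0∞) (K : ℕ) :
    MeasurableSet {ω : Env d | ∀ L ≤ K, boxSum g L ω < t * (2 * L + 1) ^ d} := by
  simp only [Set.ofPred_forall]
  exact MeasurableSet.iInter fun L => MeasurableSet.iInter fun _ =>
    measurableSet_lt (measurable_boxSum hg L) measurable_const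

theorem measurableSet_far (K R : ℕ) : MeasurableSet
    {ω : Env d | ∃ y ∈ box (0 : Site d) K, y ∈ cluster ω ∧ ¬(openGraph ω).edist 0 y ≤ R} := by
  have : {ω : Env d | ∃ y ∈ box (0 : Site d) K, y ∈ cluster ω ∧ ¬(openGraph ω).edist 0 y ≤ R} =
      ⋃ y ∈ box (0 : Site d) K,
        {ω : Env d | y ∈ cluster ω} ∩ {ω : Env d | (openGraph ω).edist 0 y ≤ R}ᶜ := by
    ext; simp [and_left_comm]
  rw [this]
  exact Finset.measurableSet_biUnion _ fun y _ =>
    (measurableSet_mem_cluster y).inter (measurableSet_edist_le 0 y R).compl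

theorem measurableSet_badSet {g : Env d → ℝ≥0∞} (hg : Measurable g) (t : ℝ≥0∞) (K R : ℕ) :
    MeasurableSet (badSet g t K R) :=
  measurableSet_Env0.inter ((measurableSet_small_boxSum hg t K).union (measurableSet_far K R))

/-- `K` is chosen first, then `R`: uniqueness of the infinite cluster makes the graph distances to
the finitely many cluster points of the box finite. -/
theorem exists_measure_badSet_le [IsProbabilityMeasure P] (hP : LawAssumption P)
    {g : Env d → ℝ≥0∞} (hg : Measurable g) {M : ℝ≥0∞} (hM : M ≠ ⊤) (hgM : ∀ ω, g ω ≤ M)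
    {t : ℝ≥0∞} (ht : t < ∫⁻ ω, g ω ∂P) {ε : ℝ≥0∞} (hε : 0 < ε) :
    ∃ K R, P (badSet g t K R) ≤ ε := by
  have hε2 : 0 < ε / 2 := ENNReal.half_pos hε.ne'
  obtain ⟨K, hK⟩ := exists_measure_le_of_antitone (Q := P)
    (fun K => measurableSet_small_boxSum hg t K)
    (fun K K' h ω hω L hL => hω L (hL.trans h)) (by
      filter_upwards [exists_le_boxSum hP hg hM hgM ht] with ω ⟨L, hL⟩
      exact ⟨L, fun h => absurd (h L le_rfl) (not_lt.2 hL)⟩) hε2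
  obtain ⟨R, hR⟩ := exists_measure_le_of_antitone (Q := P)
    (fun R => measurableSet_Env0.inter (measurableSet_far (d := d) K R))
    (by
      rintro R R' h ω ⟨h0, y, hy, hyc, hd⟩
      exact ⟨h0, y, hy, hyc, fun h' => hd (h'.trans (by exact_mod_cast h))⟩) (by
      filter_upwards [hP.unique_cluster] with ω hω
      by_cases h0 : ω ∈ Env0 d
      · refine ⟨(box (0 : Site d) K).sup fun y => (openGraph ω).dist 0 y, ?_⟩
        rintro ⟨-, y, hy, hyc, hd⟩
        refine hd ?_
        rw [← (reachable_of_unique hω h0 hyc).coe_dist_eq_edist]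
        exact_mod_cast Finset.le_sup (f := fun y => (openGraph ω).dist 0 y) hy
      · exact ⟨0, fun h => h0 h.1⟩) hε2
  refine ⟨K, R, ?_⟩
  calc P (badSet g t K R) ≤ P ({ω | ∀ L ≤ K, boxSum g L ω < t * (2 * L + 1) ^ d} ∪
        (Env0 d ∩ {ω | ∃ y ∈ box (0 : Site d) K, y ∈ cluster ω ∧ ¬(openGraph ω).edist 0 y ≤ R})) :=
        measure_mono fun ω ⟨h0, h1⟩ => h1.imp id fun h => ⟨h0, h⟩
    _ ≤ ε / 2 + ε / 2 := (measure_union_le _ _).trans (add_le_add hK hR)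
    _ = ε := ENNReal.add_halves ε

theorem ballF_subset_box (ω : Env d) (x : Site d) (n : ℕ) : ballF ω x n ⊆ box x n := fun y hy => by
  have := ball_subset_box ω x n
  rw [Nat.floor_natCast, ← coe_ballF] at this
  exact_mod_cast this hy

/-- At least half of the volume bound for the ball of radius `n / 2` consists of good points. Each
is the centre of a box of bounded radius on which the average of `g` is at least `t`, and whose
cluster points lie within bounded graph distance, hence inside `B(n)`. Disjoint boxes are extracted
by Vitali's lemma. -/
theorem eventually_le_sum_ballF [IsProbabilityMeasure P] (hP : LawAssumption P) {CV : ℝ≥0}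
    (hCV : 0 < CV)
    (hvol : ∀ᵐ ω ∂P, ω ∈ Env0 d → ∀ᶠ n : ℕ in atTop,
      (CV : ℝ≥0∞) * (n : ℝ≥0∞) ^ d ≤ (ballF ω 0 n).card)
    {g : Env d → ℝ≥0∞} (hg : Measurable g) (hg0 : ∀ ω ∉ Env0 d, g ω = 0)
    {M : ℝ≥0∞} (hM : M ≠ ⊤) (hgM : ∀ ω, g ω ≤ M) {t : ℝ≥0∞} (ht : t < ∫⁻ ω, g ω ∂P) :
    ∀ᵐ ω ∂P, ω ∈ Env0 d → ∀ᶠ n : ℕ in atTop,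
      t * CV * (n : ℝ≥0∞) ^ d ≤ 2 * 6 ^ d * ∑ x ∈ ballF ω 0 n, g (shift x ω) := by
  -- Chosen so that there are at most `δ (3m)^d = (CV / 2) m^d` bad points.
  set δ : ℝ≥0 := CV / (2 * 3 ^ d) with hδ
  have hδ0 : 0 < δ := by positivity
  have hδe : (0 : ℝ≥0∞) < ((δ / (2 * 4 ^ d) : ℝ≥0) : ℝ≥0∞) := by
    exact_mod_cast (by positivity : 0 < δ / (2 * 4 ^ d))
  obtain ⟨K, R, hKR⟩ := exists_measure_badSet_le hP hg hM hgM ht hδe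
  have hlt : 4 ^ d * ∫⁻ ω, (badSet g t K R).indicator 1 ω ∂P < (δ : ℝ≥0∞) := by
    rw [lintegral_indicator_one (measurableSet_badSet hg t K R)]
    calc _ ≤ 4 ^ d * ((δ / (2 * 4 ^ d) : ℝ≥0) : ℝ≥0∞) := by gcongr
      _ = ((δ / 2 : ℝ≥0) : ℝ≥0∞) := by
        have : 4 ^ d * (δ / (2 * 4 ^ d)) = δ / 2 := by field_simp
        exact_mod_cast this
      _ < δ := by exact_mod_cast NNReal.half_lt_self hδ0.ne'
  filter_upwards [hvol, eventually_boxSum_le hP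
    (measurable_one.indicator (measurableSet_badSet hg t K R)) hlt] with ω hω hbad h0
  have htend : Tendsto (fun n : ℕ => n / 2) atTop atTop := Nat.tendsto_div_const_atTop (by norm_num)
  filter_upwards [htend.eventually (hω h0), htend.eventually hbad, eventually_ge_atTop (2 * R + 2)]
    with n hn1 hn2 hn3
  set m := n / 2 with hm
  have hm1 : 1 ≤ m := by omega
  set X := (ballF ω 0 m).filter fun x => shift x ω ∉ badSet g t K R with hX
  have hbadcard : (((ballF ω 0 m).filter fun x => shift x ω ∈ badSet g t K R).card : ℝ≥0∞) ≤
      ((CV / 2 : ℝ≥0) : ℝ≥0∞) * (m : ℝ≥0∞) ^ d := by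
    calc _ = ∑ x ∈ ballF ω 0 m, (badSet g t K R).indicator (1 : Env d → ℝ≥0∞) (shift x ω) := by
          rw [Finset.card_filter, Nat.cast_sum]
          exact Finset.sum_congr rfl fun x _ => by
            simp only [Set.indicator_apply, Pi.one_apply]; split_ifs <;> simp
      _ ≤ boxSum ((badSet g t K R).indicator 1) m ω :=
          Finset.sum_le_sum_of_subset (ballF_subset_box ω 0 m)
      _ ≤ _ := hn2
      _ ≤ (δ : ℝ≥0∞) * (3 * m) ^ d := by
          gcongr
          have : 2 * m + 1 ≤ 3 * m := by omega
          exact_mod_cast this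
      _ = _ := by
          rw [mul_pow, ← mul_assoc]
          congr 1
          have : δ * 3 ^ d = CV / 2 := by rw [hδ]; field_simp
          exact_mod_cast this
  have hXcard : ((CV / 2 : ℝ≥0) : ℝ≥0∞) * (m : ℝ≥0∞) ^ d ≤ X.card := by
    have h1 := Finset.card_filter_add_card_filter_not (s := ballF ω 0 m)
      (fun x => shift x ω ∈ badSet g t K R)
    have h2 : ((CV / 2 : ℝ≥0) : ℝ≥0∞) * (m : ℝ≥0∞) ^ d + ((CV / 2 : ℝ≥0) : ℝ≥0∞) * (m : ℝ≥0∞) ^ d ≤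
        ((CV / 2 : ℝ≥0) : ℝ≥0∞) * (m : ℝ≥0∞) ^ d + X.card := by
      calc _ = (CV : ℝ≥0∞) * (m : ℝ≥0∞) ^ d := by
            rw [← add_mul, ← ENNReal.coe_add, add_halves]
        _ ≤ _ := hn1
        _ = (((ballF ω 0 m).filter fun x => shift x ω ∈ badSet g t K R).card : ℝ≥0∞) + X.card := by
            rw [← h1]; push_cast; rfl
        _ ≤ _ := by gcongr
    exact (ENNReal.add_le_add_iff_left (by finiteness)).1 h2
  have hgood : ∀ x ∈ X, (∃ L ≤ K, t * (2 * L + 1) ^ d ≤ boxSum g L (shift x ω)) ∧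
      ∀ y ∈ box (0 : Site d) K, y ∈ cluster (shift x ω) → (openGraph (shift x ω)).edist 0 y ≤ R := by
    intro x hx
    obtain ⟨hxB, hxb⟩ := Finset.mem_filter.1 hx
    have hx0 : shift x ω ∈ Env0 d := shift_mem_Env0.2 (mem_ballF.1 hxB).1
    refine ⟨?_, ?_⟩
    · by_contra h
      push Not at h
      exact hxb ⟨hx0, Or.inl h⟩
    · intro y hy hyc
      by_contra h
      exact hxb ⟨hx0, Or.inr ⟨y, hy, hyc, h⟩⟩
  have hgood1 := fun x hx => (hgood x hx).1
  choose! L hLK hL using hgood1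
  obtain ⟨Y, hYX, hdisj, hcov⟩ := exists_disjoint_boxes X L
  have hv := sum_vitali_le (g := g) (ω := ω) (t := t) (B := ballF ω 0 n) hcov hdisj
    (fun y hy => by
      rw [card_box, ← boxSum_shift]
      exact_mod_cast hL y (hYX hy))
    (fun y hy z hz hgz => by
      have hzc : z ∈ cluster ω := by
        by_contra h
        exact hgz (hg0 _ fun h' => h (shift_mem_Env0.1 h'))
      have hzy : z - y ∈ box (0 : Site d) K := by
        rw [← mem_box_add_right (z := y), sub_add_cancel, zero_add]
        exact box_mono (hLK y (hYX hy)) hz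
      have h1 := (hgood y (hYX hy)).2 (z - y) hzy (mem_cluster_shift.2 (by rwa [sub_add_cancel]))
      rw [edist_shift, sub_add_cancel, zero_add] at h1
      have h2 := (mem_ballF.1 (Finset.mem_filter.1 (hYX hy)).1).2
      refine mem_ballF.2 ⟨hzc, ((openGraph ω).edist_triangle (v := y)).trans
        ((add_le_add h2 h1).trans ?_)⟩
      have : m + R ≤ n := by omega
      exact_mod_cast this)
  have hnm : (n : ℝ≥0∞) ^ d ≤ 3 ^ d * (m : ℝ≥0∞) ^ d := by
    rw [← mul_pow]
    have : n ≤ 3 * m := by omega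
    exact pow_le_pow_left' (by exact_mod_cast this) d
  calc t * CV * (n : ℝ≥0∞) ^ d ≤ t * CV * (3 ^ d * (m : ℝ≥0∞) ^ d) := by gcongr
    _ = 2 * 3 ^ d * (t * (((CV / 2 : ℝ≥0) : ℝ≥0∞) * (m : ℝ≥0∞) ^ d)) := by
      have : (CV : ℝ≥0∞) = 2 * ((CV / 2 : ℝ≥0) : ℝ≥0∞) := by
        have : CV = 2 * (CV / 2) := by field_simp
        exact_mod_cast this
      rw [this]; ring
    _ ≤ 2 * 3 ^ d * (t * X.card) := by gcongr
    _ ≤ 2 * 3 ^ d * (2 ^ d * ∑ z ∈ ballF ω 0 n, g (shift z ω)) := by gcongr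
    _ = _ := by
      have : (6 : ℝ≥0∞) ^ d = 3 ^ d * 2 ^ d := by rw [← mul_pow]; norm_num
      rw [this]; ring

theorem exists_lt_lintegral_min {α : Type*} [MeasurableSpace α] {Q : Measure α} {g : α → ℝ≥0∞}
    (hg : Measurable g) (hgfin : ∫⁻ x, g x ∂Q ≠ ⊤) {t : ℝ≥0∞} (ht : t < ∫⁻ x, g x ∂Q) :
    ∃ M : ℕ, t < ∫⁻ x, min (g x) M ∂Q := by
  have h1 : ∫⁻ x, g x ∂Q = ⨆ M : ℕ, ∫⁻ x, min (g x) M ∂Q := by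
    rw [← lintegral_iSup (fun M => hg.min measurable_const)
      (fun M M' h x => min_le_min le_rfl (by exact_mod_cast h))]
    refine lintegral_congr_ae ?_
    filter_upwards [ae_lt_top hg hgfin] with x hx
    refine le_antisymm ?_ (iSup_le fun M => min_le_left _ _)
    obtain ⟨M, hM⟩ := ENNReal.exists_nat_gt hx.ne
    exact le_iSup_of_le M (by rw [min_eq_left hM.le])
  rw [h1] at ht
  exact lt_iSup_iff.1 ht

/-- Ergodic sums over balls of radius `2n` are comparable to those over balls of radius `n`. -/
theorem eventually_sum_ballF_two_mul_le [IsProbabilityMeasure P] (hP : LawAssumption P) {CV : ℝ≥0}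
    (hCV : 0 < CV)
    (hvol : ∀ᵐ ω ∂P, ω ∈ Env0 d → ∀ᶠ n : ℕ in atTop,
      (CV : ℝ≥0∞) * (n : ℝ≥0∞) ^ d ≤ (ballF ω 0 n).card)
    {g : Env d → ℝ≥0∞} (hg : Measurable g) (hg0 : ∀ ω ∉ Env0 d, g ω = 0)
    (hgfin : ∫⁻ ω, g ω ∂P ≠ ⊤) :
    ∀ᵐ ω ∂P, ω ∈ Env0 d → ∀ᶠ n : ℕ in atTop,
      CV * ∑ x ∈ ballF ω 0 (2 * n), g (shift x ω) ≤
        8 * 120 ^ d * ∑ x ∈ ballF ω 0 n, g (shift x ω) := by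
  by_cases hz : ∫⁻ ω, g ω ∂P = 0
  · rw [lintegral_eq_zero_iff hg] at hz
    filter_upwards [ae_forall_shift hP.stationary hz] with ω hω _
    refine Eventually.of_forall fun n => ?_
    have : ∀ x, g (shift x ω) = 0 := hω
    simp [this]
  set I := ∫⁻ ω, g ω ∂P with hI
  -- Truncation loses less than half of the mean. Both sums are then compared with `I n^d`, and `I`
  -- cancels; the resulting constant does not depend on the law.
  obtain ⟨M, hM⟩ := exists_lt_lintegral_min hg hgfin (ENNReal.half_lt_self hz hgfin)
  have hlow := eventually_le_sum_ballF hP hCV hvol (hg.min (measurable_const (a := (M : ℝ≥0∞))))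
    (fun ω hω => by rw [hg0 ω hω]; simp) (ENNReal.natCast_ne_top M) (fun ω => min_le_right _ _) hM
  have hup := eventually_boxSum_le hP hg (t := 2 * (4 ^ d * I)) (by
    have h4 : 4 ^ d * I ≠ 0 := mul_ne_zero (by positivity) hz
    have h5 : 4 ^ d * I ≠ ⊤ := ENNReal.mul_ne_top (by finiteness) hgfin
    calc 4 ^ d * I < 4 ^ d * I + 4 ^ d * I := ENNReal.lt_add_right h5 h4
      _ = _ := (two_mul _).symm)
  filter_upwards [hlow, hup] with ω hω hup h0
  have htend : Tendsto (fun n : ℕ => 2 * n) atTop atTop :=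
    tendsto_id.const_mul_atTop' (by norm_num)
  filter_upwards [hω h0, htend.eventually hup, eventually_ge_atTop 1] with n hn1 hn2 hn3
  calc CV * ∑ x ∈ ballF ω 0 (2 * n), g (shift x ω)
      ≤ CV * boxSum g (2 * n) ω := by
        gcongr
        exact Finset.sum_le_sum_of_subset (ballF_subset_box ω 0 (2 * n))
    _ ≤ CV * (2 * (4 ^ d * I) * (5 * n) ^ d) := by
        refine mul_le_mul' le_rfl (hn2.trans (mul_le_mul' le_rfl (pow_le_pow_left' ?_ d)))
        have : 2 * (2 * n) + 1 ≤ 5 * n := by omega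
        exact_mod_cast this
    _ = 4 * 20 ^ d * (I / 2 * CV * n ^ d) := by
        have h1 : (20 : ℝ≥0∞) ^ d = 4 ^ d * 5 ^ d := by rw [← mul_pow]; norm_num
        have h2 : I = 2 * (I / 2) := by
          rw [ENNReal.mul_div_cancel (by norm_num) (by norm_num)]
        rw [mul_pow, h1]
        conv_lhs => rw [h2]
        ring
    _ ≤ 4 * 20 ^ d * (2 * 6 ^ d * ∑ x ∈ ballF ω 0 n, min (g (shift x ω)) M) := by gcongr
    _ ≤ 4 * 20 ^ d * (2 * 6 ^ d * ∑ x ∈ ballF ω 0 n, g (shift x ω)) := by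
        gcongr; exact min_le_left _ _
    _ = _ := by
        have : (120 : ℝ≥0∞) ^ d = 20 ^ d * 6 ^ d := by rw [← mul_pow]; norm_num
        rw [this]; ring

end BallSums

/-! ### Solenoidal fields are divergence free. -/

section Harmonic
open scoped Classical
open Filter
variable {d : ℕ} {P : Measure (Env d)}

theorem lintegral_condLaw (f : Env d → ℝ≥0∞) :
    ∫⁻ ω, f ω ∂condLaw P = (P (Env0 d))⁻¹ * ∫⁻ ω in Env0 d, f ω ∂P := by
  rw [condLaw, ProbabilityTheory.cond, lintegral_smul_measure, smul_eq_mul]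

theorem integral_condLaw (f : Env d → ℝ) :
    ∫ ω, f ω ∂condLaw P = ((P (Env0 d))⁻¹).toReal * ∫ ω in Env0 d, f ω ∂P := by
  rw [condLaw, ProbabilityTheory.cond, integral_smul_measure, smul_eq_mul]

theorem lintegral_condLaw_lt_top_iff [IsProbabilityMeasure P] (hP : LawAssumption P)
    {f : Env d → ℝ≥0∞} : ∫⁻ ω, f ω ∂condLaw P < ⊤ ↔ ∫⁻ ω in Env0 d, f ω ∂P < ⊤ := by
  have h1 : (P (Env0 d))⁻¹ ≠ ⊤ := ENNReal.inv_ne_top.2 hP.origin_pos.ne'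
  have h2 : (P (Env0 d))⁻¹ ≠ 0 := ENNReal.inv_ne_zero.2 (measure_ne_top _ _)
  rw [lintegral_condLaw]
  refine ⟨fun h => ?_, fun h => ENNReal.mul_lt_top h1.lt_top h⟩
  by_contra h'
  rw [not_lt, top_le_iff] at h'
  rw [h', ENNReal.mul_top h2] at h
  exact lt_irrefl _ h

theorem IsCocycle.ae [IsProbabilityMeasure P] {Ψ : RandomField d} (h : IsCocycle P Ψ) :
    ∀ᵐ ω ∂P, ω ∈ Env0 d → ∀ x ∈ cluster ω, ∀ y ∈ cluster ω,
      Ψ (shift x ω) (y - x) = Ψ ω y - Ψ ω x := ae_condLaw_iff.1 h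

theorem IsCocycle.ae_zero [IsProbabilityMeasure P] {Ψ : RandomField d} (h : IsCocycle P Ψ) :
    ∀ᵐ ω ∂P, ω ∈ Env0 d → Ψ ω 0 = 0 := by
  filter_upwards [h.ae] with ω hω h0
  have := hω h0 0 h0 0 h0
  rwa [shift_zero, sub_zero, sub_self] at this

theorem integrable_conductance (hP : LawAssumption P) (x y : Site d) :
    Integrable (fun ω : Env d => (conductance ω x y : ℝ)) P := by
  unfold conductance
  by_cases h : (lattice d).Adj x y
  · simp only [h, dif_pos]
    exact hP.integrable _
  · simp [h]

theorem covNormSq_lt_top_of_bounded [IsProbabilityMeasure P] (hP : LawAssumption P)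
    {Ψ : RandomField d} {C : ℝ} (hΨ : ∀ ω x, |Ψ ω x| ≤ C) : covNormSq P Ψ < ⊤ := by
  rw [covNormSq, lintegral_condLaw_lt_top_iff hP]
  have h1 : ∫⁻ ω, ∑ x ∈ nbrs (0 : Site d), ENNReal.ofReal ((conductance ω 0 x : ℝ) * C ^ 2) ∂P < ⊤ := by
    rw [lintegral_finsetSum (f := fun x ω => ENNReal.ofReal ((conductance ω 0 x : ℝ) * C ^ 2)) _
      fun x _ => ((measurable_conductance 0 x).coe_nnreal_real.mul_const _).ennreal_ofReal]
    exact ENNReal.sum_lt_top.2 fun x _ =>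
      ((integrable_conductance hP 0 x).mul_const _).lintegral_lt_top
  refine (setLIntegral_le_lintegral _ _).trans_lt (lt_of_le_of_lt (lintegral_mono fun ω => ?_) h1)
  refine Finset.sum_le_sum fun x _ => ENNReal.ofReal_le_ofReal ?_
  have := sq_le_sq' (abs_le.1 (hΨ ω x)).1 (abs_le.1 (hΨ ω x)).2
  gcongr

theorem hgrad_mem_L2pot [IsProbabilityMeasure P] (hP : LawAssumption P) {φ : Env d → ℝ}
    (hφ : IsBoundedLocal φ) : hgrad φ ∈ L2pot P := by
  obtain ⟨hm, ⟨C, hC⟩, -⟩ := id hφ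
  refine ⟨⟨fun x => (hm.comp (measurable_shift x)).sub hm, ?_, ?_⟩, fun ε hε => ⟨φ, hφ, ?_⟩⟩
  · refine ae_of_all _ fun ω x _ y _ => ?_
    simp only [hgrad, shift_shift, sub_add_cancel]
    ring
  · exact covNormSq_lt_top_of_bounded hP (C := C + C) fun ω x =>
      (abs_sub _ _).trans (add_le_add (hC _) (hC _))
  · rw [sub_self]
    simpa [covNormSq] using hε

/-- The flux is dominated by `ω + ω Ψ²`, both terms being integrable. -/
theorem integrable_mul_field [IsProbabilityMeasure P] (hP : LawAssumption P) {Ψ : RandomField d}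
    (hm : ∀ x, Measurable fun ω => Ψ ω x) (hn : covNormSq P Ψ < ⊤) {x : Site d}
    (hx : x ∈ nbrs (0 : Site d)) :
    Integrable (fun ω => (Env0 d).indicator (fun ω => (conductance ω 0 x : ℝ) * Ψ ω x) ω) P := by
  rw [integrable_indicator_iff measurableSet_Env0]
  have hc : Measurable fun ω : Env d => (conductance ω 0 x : ℝ) :=
    (measurable_conductance 0 x).coe_nnreal_real
  have h1 : Integrable (fun ω => (conductance ω 0 x : ℝ) * Ψ ω x ^ 2) (P.restrict (Env0 d)) := by
    refine ⟨(hc.mul ((hm x).pow_const 2)).aestronglyMeasurable, ?_⟩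
    rw [hasFiniteIntegral_iff_ofReal (ae_of_all _ fun ω => by positivity)]
    rw [covNormSq, lintegral_condLaw_lt_top_iff hP] at hn
    refine lt_of_le_of_lt (lintegral_mono fun ω => ?_) hn
    exact Finset.single_le_sum (f := fun x => ENNReal.ofReal ((conductance ω 0 x : ℝ) * Ψ ω x ^ 2))
      (fun _ _ => zero_le) hx
  refine ((integrable_conductance hP 0 x).restrict.add h1).mono'
    (hc.mul (hm x)).aestronglyMeasurable (ae_of_all _ fun ω => ?_)
  have hc0 : (0 : ℝ) ≤ conductance ω 0 x := NNReal.coe_nonneg _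
  rw [Real.norm_eq_abs, abs_mul, abs_of_nonneg hc0, Pi.add_apply, ← sq_abs]
  nlinarith [mul_nonneg hc0 (sq_nonneg (|Ψ ω x| - 1)), mul_nonneg hc0 (sq_nonneg (|Ψ ω x|))]

theorem neg_mem_nbrs {x : Site d} : -x ∈ nbrs (0 : Site d) ↔ x ∈ nbrs (0 : Site d) := by
  rw [mem_nbrs, mem_nbrs, ← lattice_adj_add x, zero_add, neg_add_cancel, SimpleGraph.adj_comm]

theorem mem_cluster_of_conductance {ω : Env d} {x y : Site d} (hx : x ∈ cluster ω)
    (h : conductance ω x y ≠ 0) : y ∈ cluster ω :=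
  mem_cluster_of_reachable (openGraph_adj_iff.2 (pos_iff_ne_zero.2 h)).reachable hx

/-- The flux of a covariant field through a bond changes sign when the bond is reversed. -/
theorem indicator_flux_shift [IsProbabilityMeasure P] {Ψ : RandomField d} (h : IsCocycle P Ψ) :
    ∀ᵐ ω ∂P, ∀ x : Site d,
      (Env0 d).indicator (fun ω => (conductance ω 0 x : ℝ) * Ψ ω x) (shift (-x) ω) =
        -(Env0 d).indicator (fun ω => (conductance ω 0 (-x) : ℝ) * Ψ ω (-x)) ω := by
  filter_upwards [h.ae, h.ae_zero] with ω h1 h2 x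
  have hc : conductance (shift (-x) ω) 0 x = conductance ω 0 (-x) := by
    rw [conductance_shift, zero_add, add_neg_cancel, conductance_comm]
  by_cases hc0 : conductance ω 0 (-x) = 0
  · simp only [Set.indicator_apply, hc, hc0]
    simp
  by_cases h0 : (0 : Site d) ∈ cluster ω
  · have hx : -x ∈ cluster ω := mem_cluster_of_conductance h0 hc0
    rw [Set.indicator_of_mem (shift_mem_Env0.2 hx), Set.indicator_of_mem (show ω ∈ Env0 d from h0), hc]
    have h3 := h1 h0 (-x) hx 0 h0
    rw [h2 h0, zero_sub, neg_neg, zero_sub] at h3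
    rw [h3]; ring
  · have hx : -x ∉ cluster ω := fun hx => h0
      (mem_cluster_of_conductance hx (by rwa [conductance_comm]))
    rw [Set.indicator_of_notMem (fun h => hx (shift_mem_Env0.1 h)),
      Set.indicator_of_notMem (show ω ∉ Env0 d from h0), neg_zero]

/-- The divergence at the origin. -/
noncomputable def divergence (Ψ : RandomField d) (ω : Env d) : ℝ :=
  ∑ x ∈ nbrs (0 : Site d), (Env0 d).indicator (fun ω => (conductance ω 0 x : ℝ) * Ψ ω x) ω

theorem integrable_divergence [IsProbabilityMeasure P] (hP : LawAssumption P) {Ψ : RandomField d}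
    (hΨ : Ψ ∈ L2cov P) : Integrable (divergence Ψ) P :=
  integrable_finsetSum _ fun _ hx => integrable_mul_field hP hΨ.1 hΨ.2.2 hx

/-- Orthogonality to `hgrad φ` is an integral of fluxes times `φ ∘ τ_x - φ`. Stationarity and
antisymmetry of the flux turn the first term into minus the flux through `-x` times `φ`; after
reindexing, minus twice the claimed integral vanishes. -/
theorem integral_divergence_mul [IsProbabilityMeasure P] (hP : LawAssumption P) {Ψ : RandomField d}
    (hΨ : Ψ ∈ L2sol P) {φ : Env d → ℝ} (hφ : IsBoundedLocal φ) :
    ∫ ω, divergence Ψ ω * φ ω ∂P = 0 := by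
  obtain ⟨hm, ⟨C, hC⟩, -⟩ := id hφ
  set h : Site d → Env d → ℝ := fun x ω =>
    (Env0 d).indicator (fun ω => (conductance ω 0 x : ℝ) * Ψ ω x) ω with hh
  have hint : ∀ x ∈ nbrs (0 : Site d), Integrable (h x) P :=
    fun x hx => integrable_mul_field hP hΨ.1.1 hΨ.1.2.2 hx
  have hint1 : ∀ x ∈ nbrs (0 : Site d), Integrable (fun ω => h x ω * φ ω) P := fun x hx =>
    (hint x hx).mul_bdd hm.aestronglyMeasurable (ae_of_all _ hC)
  have hint2 : ∀ x ∈ nbrs (0 : Site d), Integrable (fun ω => h x ω * φ (shift x ω)) P := fun x hx =>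
    (hint x hx).mul_bdd (hm.comp (measurable_shift x)).aestronglyMeasurable (ae_of_all _ fun _ => hC _)
  have h1 := hΨ.2 _ (hgrad_mem_L2pot hP hφ)
  rw [covInner, integral_condLaw, mul_eq_zero, or_iff_right
    (ENNReal.toReal_ne_zero.2 ⟨ENNReal.inv_ne_zero.2 (measure_ne_top _ _),
      ENNReal.inv_ne_top.2 hP.origin_pos.ne'⟩), ← integral_indicator measurableSet_Env0] at h1
  have h2 : ∀ ω, (Env0 d).indicator (fun ω => ∑ x ∈ nbrs (0 : Site d),
      (conductance ω 0 x : ℝ) * Ψ ω x * hgrad φ ω x) ω =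
      ∑ x ∈ nbrs (0 : Site d), (h x ω * φ (shift x ω) - h x ω * φ ω) := by
    intro ω
    by_cases h0 : ω ∈ Env0 d
    · simp only [hh, Set.indicator_of_mem h0, hgrad]
      exact Finset.sum_congr rfl fun x _ => by ring
    · simp [hh, Set.indicator_of_notMem h0]
  simp only [h2] at h1
  rw [integral_finsetSum (f := fun x ω => h x ω * φ (shift x ω) - h x ω * φ ω) _
    fun x hx => (hint2 x hx).sub (hint1 x hx)] at h1
  have h3 : ∀ x ∈ nbrs (0 : Site d), ∫ ω, (h x ω * φ (shift x ω) - h x ω * φ ω) ∂P =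
      -(∫ ω, h (-x) ω * φ ω ∂P) - ∫ ω, h x ω * φ ω ∂P := by
    intro x hx
    rw [integral_sub (hint2 x hx) (hint1 x hx)]
    congr 1
    rw [← integral_neg]
    have h4 : ∫ ω, h x (shift (-x) ω) * φ (shift x (shift (-x) ω)) ∂P =
        ∫ ω, h x ω * φ (shift x ω) ∂P := by
      have hmap := (hP.stationary (-x)).map_eq
      have := integral_map (μ := P) (measurable_shift (-x)).aemeasurable
        (f := fun ω => h x ω * φ (shift x ω)) (by rw [hmap]; exact (hint2 x hx).aestronglyMeasurable)
      rw [← this, hmap]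
    rw [← h4]
    refine integral_congr_ae ?_
    filter_upwards [indicator_flux_shift hΨ.1.2.1] with ω hω
    have := hω x
    simp only [hh] at this ⊢
    rw [this, shift_shift, add_neg_cancel, shift_zero, neg_mul]
  rw [Finset.sum_congr rfl h3, Finset.sum_sub_distrib, Finset.sum_neg_distrib] at h1
  have h5 : ∑ x ∈ nbrs (0 : Site d), ∫ ω, h (-x) ω * φ ω ∂P =
      ∑ x ∈ nbrs (0 : Site d), ∫ ω, h x ω * φ ω ∂P :=
    Finset.sum_bij (fun x _ => -x) (fun x hx => neg_mem_nbrs.2 hx) (fun _ _ _ _ h => neg_injective h)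
      (fun x hx => ⟨-x, neg_mem_nbrs.2 hx, neg_neg x⟩) fun _ _ => rfl
  rw [h5] at h1
  have h6 : ∫ ω, divergence Ψ ω * φ ω ∂P = ∑ x ∈ nbrs (0 : Site d), ∫ ω, h x ω * φ ω ∂P := by
    rw [← integral_finsetSum _ hint1]
    simp only [divergence, Finset.sum_mul, hh]
  rw [h6]
  linarith

/-- Indicators of cylinders are bounded local functions, and cylinders form a π-system generating
the σ-algebra. -/
theorem ae_eq_zero_of_forall_local [IsProbabilityMeasure P] {f : Env d → ℝ} (hf : Integrable f P)
    (h : ∀ φ, IsBoundedLocal φ → ∫ ω, f ω * φ ω ∂P = 0) : f =ᵐ[P] 0 := by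
  have hcyl : ∀ s ∈ measurableCylinders (fun _ : Bond d => ℝ≥0), ∫ ω in s, f ω ∂P = 0 := by
    intro s hs
    have hsm : MeasurableSet s := MeasurableSet.of_mem_measurableCylinders hs
    obtain ⟨F, S, hS, rfl⟩ := (mem_measurableCylinders _).1 hs
    have := h ((cylinder F S).indicator 1) ⟨measurable_one.indicator hsm, ⟨1, fun ω => ?_⟩, F, ?_⟩
    · rw [← integral_indicator hsm, ← this]
      refine integral_congr_ae (ae_of_all _ fun ω => ?_)
      by_cases hω : ω ∈ cylinder F S <;> simp [hω]
    · by_cases hω : ω ∈ cylinder F S <;> simp [hω]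
    · intro ω ω' hωω'
      have : F.restrict ω = F.restrict ω' := funext fun i => hωω' i i.2
      simp [Set.indicator_apply, mem_cylinder, this]
  refine hf.ae_eq_zero_of_forall_setIntegral_eq_zero fun s hs _ => ?_
  induction s, hs using MeasurableSpace.induction_on_inter generateFrom_measurableCylinders.symm
    isPiSystem_measurableCylinders with
  | empty => simp
  | basic s hs => exact hcyl s hs
  | compl s hs ih =>
    have h1 := integral_add_compl hs hf
    have h2 := hcyl Set.univ (univ_mem_measurableCylinders _)
    rw [setIntegral_univ] at h2
    linarith [ih (measure_lt_top _ _)]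
  | iUnion s hdisj hs ih =>
    rw [integral_iUnion hs hdisj hf.integrableOn]
    simp [ih _ (measure_lt_top _ _)]

/-- Solenoidal fields are divergence free at every point of the infinite cluster. -/
theorem ae_harmonic [IsProbabilityMeasure P] (hP : LawAssumption P) {Ψ : RandomField d}
    (hΨ : Ψ ∈ L2sol P) : ∀ᵐ ω ∂P, ω ∈ Env0 d → ∀ x ∈ cluster ω,
      ∑ y ∈ nbrs x, (conductance ω x y : ℝ) * (Ψ ω y - Ψ ω x) = 0 := by
  have h1 := ae_eq_zero_of_forall_local (integrable_divergence hP hΨ.1)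
    fun φ hφ => integral_divergence_mul hP hΨ hφ
  filter_upwards [ae_forall_shift hP.stationary h1, hΨ.1.2.1.ae] with ω hω hcoc h0 x hx
  have h2 := hω x
  simp only [divergence, Pi.zero_apply, Set.indicator_of_mem (shift_mem_Env0.2 hx)] at h2
  rw [← h2, ← zero_add x, sum_nbrs_add, zero_add]
  refine Finset.sum_congr rfl fun y _ => ?_
  rw [conductance_shift, zero_add]
  by_cases hc : conductance ω x (y + x) = 0
  · simp [hc]
  · have := hcoc h0 x hx (y + x) (mem_cluster_of_conductance hx hc)
    rw [add_sub_cancel_right] at this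
    rw [this]

end Harmonic

/-! ### The `L¹` Poincaré inequality on regular balls. -/

section Poincare
open scoped Classical
variable {d : ℕ}

/-- The smallest value whose strict superlevel set has at most half of the points: the next smaller
value fails this, which bounds the sublevel set. -/
theorem exists_median {V : Type} [Fintype V] (v : V → ℝ) :
    ∃ a, ((Finset.univ.filter fun x => a < v x).card : ℝ) ≤ 1 / 2 * Fintype.card V ∧
      ((Finset.univ.filter fun x => v x < a).card : ℝ) ≤ 1 / 2 * Fintype.card V := by
  rcases isEmpty_or_nonempty V with hV | hV
  · exact ⟨0, by simp⟩
  set T := Finset.univ.filter fun z : V =>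
    ((Finset.univ.filter fun x => v z < v x).card : ℝ) ≤ 1 / 2 * Fintype.card V with hT
  obtain ⟨m, -, hm⟩ := Finset.univ.exists_max_image v Finset.univ_nonempty
  have hmT : m ∈ T := by
    refine Finset.mem_filter.2 ⟨Finset.mem_univ _, ?_⟩
    rw [Finset.filter_false_of_mem fun x hx => not_lt.2 (hm x hx)]
    simp
  obtain ⟨z, hz, hzmin⟩ := T.exists_min_image v ⟨m, hmT⟩
  refine ⟨v z, (Finset.mem_filter.1 hz).2, ?_⟩
  rcases (Finset.univ.filter fun x => v x < v z).eq_empty_or_nonempty with h0 | hne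
  · rw [h0]; simp
  obtain ⟨w, hw, hwmax⟩ := Finset.exists_max_image _ v hne
  have hwz : v w < v z := (Finset.mem_filter.1 hw).2
  have hwT : w ∉ T := fun h => not_le.2 hwz (hzmin w h)
  have h1 : 1 / 2 * (Fintype.card V : ℝ) < (Finset.univ.filter fun x => v w < v x).card := by
    by_contra h
    exact hwT (Finset.mem_filter.2 ⟨Finset.mem_univ _, not_lt.1 h⟩)
  have h2 : (Finset.univ.filter fun x => v w < v x) ⊆ Finset.univ.filter fun x => ¬v x < v z := by
    intro x hx
    refine Finset.mem_filter.2 ⟨Finset.mem_univ _, fun hxz => ?_⟩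
    exact absurd (Finset.mem_filter.1 hx).2
      (not_lt.2 (hwmax x (Finset.mem_filter.2 ⟨Finset.mem_univ _, hxz⟩)))
  have h3 : ((Finset.univ.filter fun x => v w < v x).card : ℝ) ≤
      (Finset.univ.filter fun x => ¬v x < v z).card := by exact_mod_cast Finset.card_le_card h2
  have h4 := Finset.card_filter_add_card_filter_not (s := (Finset.univ : Finset V)) (fun x => v x < v z)
  have h5 : ((Finset.univ.filter fun x => v x < v z).card : ℝ) +
      (Finset.univ.filter fun x => ¬v x < v z).card = Fintype.card V := by
    rw [← Finset.card_univ]; exact_mod_cast h4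
  linarith

/-- The `L¹` Poincaré inequality on a finite set satisfying a relative isoperimetric inequality. -/
theorem exists_sum_abs_sub_le {V : Type} [Fintype V] (b : V → V → ℝ) (hb : ∀ x y, 0 ≤ b x y)
    (hiso : ∀ A : Finset V, A.Nonempty → (A.card : ℝ) ≤ 1 / 2 * Fintype.card V →
      (A.card : ℝ) ≤ ∑ x, ∑ y, b x y * |(if x ∈ A then (1 : ℝ) else 0) - (if y ∈ A then 1 else 0)|)
    (v : V → ℝ) : ∃ a, ∑ x, |v x - a| ≤ 2 * ∑ x, ∑ y, b x y * |v x - v y| := by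
  obtain ⟨a, ha1, ha2⟩ := exists_median v
  refine ⟨a, ?_⟩
  -- The positive and the negative part of `v - a` each live on at most half of the points, where
  -- the relative isoperimetric inequality and `layer_cake` apply.
  have key : ∀ g : V → ℝ, (∀ x, 0 ≤ g x) →
      ((Finset.univ.filter fun x => 0 < g x).card : ℝ) ≤ 1 / 2 * Fintype.card V →
      ∑ x, g x ≤ ∑ x, ∑ y, b x y * |g x - g y| := by
    intro g hg hs
    refine layer_cake b (fun g => ∑ x, g x) (fun g h _ _ => ?_) (fun t g _ _ => ?_) (by simp)
      (fun A => (A.card : ℝ) ≤ 1 / 2 * Fintype.card V) (fun A B hAB hB => ?_)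
      (fun A hA hA' => ?_) g hg hs
    · simp [Finset.sum_add_distrib]
    · simp [Finset.mul_sum]
    · exact le_trans (by exact_mod_cast Finset.card_le_card hAB) hB
    · simpa using hiso A hA hA'
  have h1 := key (fun x => max (v x - a) 0) (fun x => le_max_right _ _) (by simpa using ha1)
  have h2 := key (fun x => max (a - v x) 0) (fun x => le_max_right _ _) (by simpa using ha2)
  have h3 : ∀ g : V → ℝ, (∀ x y, |g x - g y| ≤ |v x - v y|) →
      ∑ x, ∑ y, b x y * |g x - g y| ≤ ∑ x, ∑ y, b x y * |v x - v y| := fun g hg =>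
    Finset.sum_le_sum fun x _ => Finset.sum_le_sum fun y _ => mul_le_mul_of_nonneg_left (hg x y) (hb x y)
  have h4 : ∀ x, |v x - a| = max (v x - a) 0 + max (a - v x) 0 := by
    intro x
    rcases le_total (v x) a with h | h
    · rw [abs_of_nonpos (by linarith), max_eq_right (by linarith), max_eq_left (by linarith)]; ring
    · rw [abs_of_nonneg (by linarith), max_eq_left (by linarith), max_eq_right (by linarith)]; ring
  simp only [h4, Finset.sum_add_distrib]
  have h5 := h1.trans (h3 (fun x => max (v x - a) 0) fun x y => by
    refine (abs_max_sub_max_le_abs _ _ _).trans (le_of_eq ?_)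
    congr 1; ring)
  have h6 := h2.trans (h3 (fun x => max (a - v x) 0) fun x y => by
    refine (abs_max_sub_max_le_abs _ _ _).trans (le_of_eq ?_)
    rw [abs_sub_comm]; congr 1; ring)
  linarith

variable {CV Criso CW : ℝ}

/-- The inequality holds on the intermediate set `S`; the left side is restricted to the smaller
ball, the right side enlarged to the bigger one. -/
theorem exists_poincare_ballF (hCriso : 0 < Criso) {ω : Env d} {x : Site d} {m : ℕ} (hm : 1 ≤ m)
    (hreg : IsRegularBall CV Criso CW ω x m) (v : Site d → ℝ) :
    ∃ a, ∑ y ∈ ballF ω x m, |v y - a| ≤ 2 * (m / Criso) * ∑ y ∈ ballF ω x ⌊CW * m⌋₊,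
      ∑ z ∈ nbrs y, if 0 < conductance ω y z then |v y - v z| else 0 := by
  obtain ⟨-, S, -, -, hBS, hSB, hiso⟩ := hreg
  have hSB' : S ⊆ ballF ω x ⌊CW * m⌋₊ := by
    rw [coe_ballF]
    refine hSB.trans fun y hy => ?_
    simpa [ball] using hy
  have hSfin : S.Finite := (Finset.finite_toSet _).subset hSB'
  set T := hSfin.toFinset with hT
  have hm0 : (0 : ℝ) < m := by exact_mod_cast hm
  set b : T → T → ℝ := fun y z => m / Criso * if 0 < conductance ω y z then 1 else 0 with hb
  obtain ⟨a, ha⟩ := exists_sum_abs_sub_le b (fun y z => by positivity) (by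
    intro A _ hA
    set A' : Finset (Site d) := A.map (Function.Embedding.subtype _) with hA'
    have hcardS : (Fintype.card T : ℝ) = S.ncard := by
      rw [Fintype.card_coe, Set.ncard_eq_toFinset_card S hSfin]
    have hA'S : (A' : Set (Site d)) ⊆ S := by
      intro y hy
      obtain ⟨y, -, rfl⟩ := Finset.mem_map.1 hy
      exact hSfin.mem_toFinset.1 y.2
    have hcardA : ((A' : Set (Site d)).ncard : ℝ) = A.card := by
      rw [Set.ncard_coe_finset, Finset.card_map]
    have h1 := hiso A' hA'S (by rw [hcardA, ← hcardS]; exact hA)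
    rw [hcardA] at h1
    have h2 : relBoundary ω S A' ⊆ ((((Finset.univ : Finset (T × T)).filter fun z =>
        z.1 ∈ A ∧ z.2 ∉ A ∧ 0 < conductance ω z.1 z.2).image fun z => s((z.1 : Site d), (z.2 : Site d)) :
        Finset (Sym2 (Site d))) : Set (Sym2 (Site d))) := by
      rintro e ⟨y, hy, z, hz, hyz, rfl⟩
      obtain ⟨y, hyA, rfl⟩ := Finset.mem_map.1 hy
      refine Finset.mem_coe.2 (Finset.mem_image.2 ⟨(y, ⟨z, hSfin.mem_toFinset.2 hz.1⟩), ?_, rfl⟩)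
      refine Finset.mem_filter.2 ⟨Finset.mem_univ _, hyA, fun h => hz.2 ?_, openGraph_adj_iff.1 hyz⟩
      exact Finset.mem_map.2 ⟨_, h, rfl⟩
    have h3 := (Set.ncard_le_ncard h2 (Finset.finite_toSet _))
    rw [Set.ncard_coe_finset] at h3
    have h4 := h3.trans Finset.card_image_le
    have h5 : (((Finset.univ : Finset (T × T)).filter fun z =>
        z.1 ∈ A ∧ z.2 ∉ A ∧ 0 < conductance ω z.1 z.2).card : ℝ) ≤
        ∑ y : T, ∑ z : T, (if 0 < conductance ω y z then (1 : ℝ) else 0) *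
          |(if y ∈ A then (1 : ℝ) else 0) - (if z ∈ A then 1 else 0)| := by
      rw [← Fintype.sum_prod_type', Finset.card_filter, Nat.cast_sum]
      refine Finset.sum_le_sum fun z _ => ?_
      split_ifs <;> simp_all
    have h6 : ((relBoundary ω S A').ncard : ℝ) ≤ _ := (Nat.cast_le.2 h4).trans h5
    have h7 := h1.trans h6
    simp only [hb, mul_assoc, ← Finset.mul_sum]
    calc (A.card : ℝ) = m / Criso * (Criso * (m : ℝ)⁻¹ * A.card) := by field_simp
      _ ≤ _ := by
        refine mul_le_mul_of_nonneg_left ?_ (by positivity)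
        convert h7) fun y => v y
  refine ⟨a, ?_⟩
  calc ∑ y ∈ ballF ω x m, |v y - a| ≤ ∑ y ∈ T, |v y - a| := by
        refine Finset.sum_le_sum_of_subset_of_nonneg (fun y hy => ?_) fun _ _ _ => abs_nonneg _
        rw [hT, hSfin.mem_toFinset]
        exact hBS (by rw [← coe_ballF]; exact hy)
    _ = ∑ y : T, |v y - a| := (Finset.sum_coe_sort T fun y => |v y - a|).symm
    _ ≤ _ := ha
    _ = 2 * (m / Criso) * ∑ y : T, ∑ z : T, if 0 < conductance ω y z then |v y - v z| else 0 := by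
        simp only [hb, mul_assoc, ← Finset.mul_sum, ite_mul, one_mul, zero_mul]
    _ ≤ _ := by
        gcongr
        rw [Finset.sum_coe_sort T fun y => ∑ z : T, if 0 < conductance ω y z then |v y - v z| else 0]
        have hsub : T ⊆ ballF ω x ⌊CW * m⌋₊ := fun y hy => hSB' (hSfin.mem_toFinset.1 hy)
        refine (Finset.sum_le_sum fun y _ => ?_).trans
          (Finset.sum_le_sum_of_subset_of_nonneg hsub fun y _ _ => Finset.sum_nonneg fun z _ => by
            split_ifs <;> positivity)
        rw [Finset.sum_coe_sort T fun z => if 0 < conductance ω y z then |v y - v z| else 0,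
          ← Finset.sum_filter]
        rw [← Finset.sum_filter]
        refine Finset.sum_le_sum_of_subset_of_nonneg (fun z hz => ?_) fun _ _ _ => abs_nonneg _
        obtain ⟨-, hz⟩ := Finset.mem_filter.1 hz
        exact Finset.mem_filter.2 ⟨mem_nbrs.2 (by
          by_contra h; rw [conductance_eq_zero h] at hz; exact lt_irrefl _ hz), hz⟩

end Poincare

/-! ### Sublinear mean oscillation of potential fields. -/

section Sublinear
open scoped Classical
open Filter
variable {d : ℕ} {P : Measure (Env d)}

/-- The total variation of a field across the open bonds at the origin, if the origin lies in the
infinite cluster. -/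
noncomputable def variationAt (Ψ : RandomField d) (ω : Env d) : ℝ≥0∞ :=
  (Env0 d).indicator (fun ω => ∑ y ∈ nbrs (0 : Site d),
    if 0 < conductance ω 0 y then ENNReal.ofReal |Ψ ω y| else 0) ω

theorem measurable_variationAt {Ψ : RandomField d} (hm : ∀ x, Measurable fun ω => Ψ ω x) :
    Measurable (variationAt Ψ) := by
  refine Measurable.indicator (Finset.measurable_sum _ fun y _ => ?_) measurableSet_Env0
  exact Measurable.ite (measurableSet_lt measurable_const (measurable_conductance 0 y))
    (hm y).abs.ennreal_ofReal measurable_const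

theorem variationAt_shift {Ψ : RandomField d} {ω : Env d} {x : Site d} (hx : x ∈ cluster ω)
    (hcoc : ∀ y ∈ cluster ω, Ψ (shift x ω) (y - x) = Ψ ω y - Ψ ω x) :
    variationAt Ψ (shift x ω) = ENNReal.ofReal
      (∑ y ∈ nbrs x, if 0 < conductance ω x y then |Ψ ω x - Ψ ω y| else 0) := by
  rw [variationAt, Set.indicator_of_mem (shift_mem_Env0.2 hx), ENNReal.ofReal_sum_of_nonneg
    fun y _ => by split_ifs <;> positivity]
  conv_rhs => rw [← zero_add x, sum_nbrs_add, zero_add]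
  refine Finset.sum_congr rfl fun y _ => ?_
  rw [conductance_shift, zero_add]
  split_ifs with h
  · have := hcoc (y + x) (mem_cluster_of_conductance hx h.ne')
    rw [add_sub_cancel_right] at this
    rw [this, abs_sub_comm]
  · rw [ENNReal.ofReal_zero]

/-- Young's inequality `|Ψ| ≤ s ω Ψ² + 1 / (s ω)` on each open bond. The free parameter `s` plays
the energy against the resistances. -/
theorem lintegral_variationAt_le [IsProbabilityMeasure P]
    {Ψ : RandomField d} (hm : ∀ x, Measurable fun ω => Ψ ω x) {s : ℝ} (hs : 0 < s) :
    ∫⁻ ω, variationAt Ψ ω ∂P ≤ ENNReal.ofReal s * covNormSq P Ψ +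
      ENNReal.ofReal s⁻¹ * ∫⁻ ω, ENNReal.ofReal (nu ω 0) ∂P := by
  have hI : ∫⁻ ω in Env0 d, ∑ x ∈ nbrs (0 : Site d),
      ENNReal.ofReal ((conductance ω 0 x : ℝ) * Ψ ω x ^ 2) ∂P ≤ covNormSq P Ψ := by
    rw [covNormSq, lintegral_condLaw]
    refine le_mul_of_one_le_left zero_le ?_
    rw [ENNReal.one_le_inv]
    exact prob_le_one
  have hpt : ∀ ω, (∑ y ∈ nbrs (0 : Site d),
      if 0 < conductance ω 0 y then ENNReal.ofReal |Ψ ω y| else 0) ≤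
      ENNReal.ofReal s * ∑ x ∈ nbrs (0 : Site d),
        ENNReal.ofReal ((conductance ω 0 x : ℝ) * Ψ ω x ^ 2) +
      ENNReal.ofReal s⁻¹ * ENNReal.ofReal (nu ω 0) := by
    intro ω
    rw [nu_eq_sum_inv, ENNReal.ofReal_sum_of_nonneg fun y _ => by positivity, Finset.mul_sum,
      Finset.mul_sum, ← Finset.sum_add_distrib]
    refine Finset.sum_le_sum fun y _ => ?_
    split_ifs with h
    · have hc : (0 : ℝ) < conductance ω 0 y := by exact_mod_cast h
      rw [← ENNReal.ofReal_mul hs.le, ← ENNReal.ofReal_mul (by positivity),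
        ← ENNReal.ofReal_add (by positivity) (by positivity)]
      refine ENNReal.ofReal_le_ofReal ?_
      have hsc : 0 < s * conductance ω 0 y := by positivity
      have h1 : (s * conductance ω 0 y) * (s⁻¹ * (conductance ω 0 y : ℝ)⁻¹) = 1 := by field_simp
      rw [← sq_abs (Ψ ω y)]
      set w := s⁻¹ * (conductance ω 0 y : ℝ)⁻¹
      set c := s * (conductance ω 0 y : ℝ)
      have hw : 0 < w := by positivity
      have h2 : 0 ≤ w * (c * |Ψ ω y| - 1) ^ 2 := by positivity
      have h3 : w * (c * |Ψ ω y| - 1) ^ 2 = (c * w) * c * |Ψ ω y| ^ 2 - 2 * (c * w) * |Ψ ω y| + w := by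
        ring
      rw [h3, h1] at h2
      have h4 : s * ((conductance ω 0 y : ℝ) * |Ψ ω y| ^ 2) = c * |Ψ ω y| ^ 2 := by
        simp only [c]; ring
      rw [h4]
      nlinarith [abs_nonneg (Ψ ω y)]
    · exact zero_le
  have hcm : Measurable fun ω : Env d => ENNReal.ofReal (nu ω 0) := (measurable_nu 0).ennreal_ofReal
  have hsm : Measurable fun ω : Env d => ∑ x ∈ nbrs (0 : Site d),
      ENNReal.ofReal ((conductance ω 0 x : ℝ) * Ψ ω x ^ 2) :=
    Finset.measurable_sum _ fun x _ =>
      ((measurable_conductance 0 x).coe_nnreal_real.mul ((hm x).pow_const 2)).ennreal_ofReal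
  unfold variationAt
  rw [lintegral_indicator measurableSet_Env0]
  refine (lintegral_mono hpt).trans ?_
  rw [lintegral_add_left (hsm.const_mul _), lintegral_const_mul _ hsm, lintegral_const_mul _ hcm]
  gcongr
  exact Measure.restrict_le_self

theorem exists_local_variationAt_le [IsProbabilityMeasure P]
    {χ : RandomField d} (hχ : χ ∈ L2pot P) (hnu : ∫⁻ ω, ENNReal.ofReal (nu ω 0) ∂P ≠ ⊤)
    {δ : ℝ} (hδ : 0 < δ) :
    ∃ φ, IsBoundedLocal φ ∧ ∫⁻ ω, variationAt (χ - hgrad φ) ω ∂P ≤ ENNReal.ofReal δ := by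
  set N : ℝ := (∫⁻ ω, ENNReal.ofReal (nu ω 0) ∂P).toReal with hN
  have hN0 : 0 ≤ N := ENNReal.toReal_nonneg
  -- Large enough for the resistance term to be at most `δ / 2`; `φ` is chosen afterwards to make
  -- the energy term small.
  set s : ℝ := 2 * (N + 1) / δ with hs
  have hs0 : 0 < s := by positivity
  obtain ⟨φ, hφ, hφε⟩ := hχ.2 (ENNReal.ofReal (δ / 2 / s))
    (ENNReal.ofReal_pos.2 (by positivity))
  refine ⟨φ, hφ, ?_⟩
  have hm : ∀ x, Measurable fun ω => (χ - hgrad φ) ω x := fun x =>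
    (hχ.1.1 x).sub ((hφ.1.comp (measurable_shift x)).sub hφ.1)
  refine (lintegral_variationAt_le hm hs0).trans ?_
  rw [← ENNReal.ofReal_toReal hnu, ← hN]
  calc _ ≤ ENNReal.ofReal s * ENNReal.ofReal (δ / 2 / s) + ENNReal.ofReal s⁻¹ * ENNReal.ofReal N := by
        gcongr
    _ = ENNReal.ofReal (δ / 2 + s⁻¹ * N) := by
        rw [← ENNReal.ofReal_mul hs0.le, ← ENNReal.ofReal_mul (by positivity),
          ← ENNReal.ofReal_add (by positivity) (by positivity)]
        congr 2; field_simp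
    _ ≤ ENNReal.ofReal δ := by
        refine ENNReal.ofReal_le_ofReal ?_
        have : s⁻¹ * N ≤ δ / 2 := by
          rw [inv_mul_le_iff₀ hs0, hs]
          field_simp
          linarith
        linarith

theorem card_ballF_two_mul_le (ω : Env d) {n : ℕ} (hn : 1 ≤ n) :
    ((ballF ω 0 (2 * n)).card : ℝ) ≤ 5 ^ d * (n : ℝ) ^ d := by
  have := fintype_card_ballF_le ω (n := n) (by exact_mod_cast hn)
  rwa [Fintype.card_coe] at this

variable {CV Criso CW : ℝ}

/-- The mean oscillation of a potential field over large balls is sublinear. -/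
theorem eventually_mean_oscillation_le [IsProbabilityMeasure P] (hP : LawAssumption P)
    (hCriso : 0 < Criso) (hCW : 1 ≤ CW)
    (hreg : ∀ᵐ ω ∂P, ω ∈ Env0 d → ∀ᶠ n : ℕ in atTop, IsRegularBall CV Criso CW ω 0 n)
    {χ : RandomField d} (hχ : χ ∈ L2pot P) (hnu : ∫⁻ ω, ENNReal.ofReal (nu ω 0) ∂P ≠ ⊤)
    {ε : ℝ} (hε : 0 < ε) :
    ∀ᵐ ω ∂P, ω ∈ Env0 d → ∀ᶠ n : ℕ in atTop, ∃ a,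
      ∑ x ∈ ballF ω 0 (2 * n), |χ ω x - a| ≤ ε * n * (n : ℝ) ^ d := by
  -- Product of the Poincaré factor `4 n / Criso` and the volume `(5 CW n)^d`, without the powers of
  -- `n`. The Poincaré inequality is applied to `χ - hgrad φ` only: `hgrad φ` is bounded, so its
  -- contribution of order `n^d` is negligible against `n · n^d`.
  set A : ℝ := 4 / Criso * (5 * CW) ^ d with hA
  have hA0 : 0 < A := by positivity
  set δ : ℝ := ε / 2 / A with hδ
  have hδ0 : 0 < δ := by positivity
  obtain ⟨φ, hφ, hφδ⟩ := exists_local_variationAt_le hχ hnu (δ := δ / (2 * 4 ^ d)) (by positivity)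
  obtain ⟨hφm, ⟨C, hC⟩, -⟩ := id hφ
  set Ψ := χ - hgrad φ with hΨ
  have hm : ∀ x, Measurable fun ω => Ψ ω x := fun x =>
    (hχ.1.1 x).sub ((hφm.comp (measurable_shift x)).sub hφm)
  have hlt : 4 ^ d * ∫⁻ ω, variationAt Ψ ω ∂P < ENNReal.ofReal δ := by
    calc _ ≤ 4 ^ d * ENNReal.ofReal (δ / (2 * 4 ^ d)) := by gcongr
      _ = ENNReal.ofReal (δ / 2) := by
        have : (4 : ℝ≥0∞) ^ d = ENNReal.ofReal (4 ^ d) := by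
          rw [ENNReal.ofReal_pow (by norm_num)]; norm_num
        rw [this, ← ENNReal.ofReal_mul (by positivity)]
        congr 1; field_simp
      _ < _ := (ENNReal.ofReal_lt_ofReal_iff hδ0).2 (by linarith)
  have htend : Tendsto (fun n : ℕ => ⌊CW * ((2 * n : ℕ) : ℝ)⌋₊) atTop atTop :=
    tendsto_nat_floor_atTop.comp (((tendsto_natCast_atTop_atTop (R := ℝ)).comp
      (tendsto_id.const_mul_atTop' (by norm_num))).const_mul_atTop (by linarith))
  have htend2 : Tendsto (fun n : ℕ => 2 * n) atTop atTop :=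
    tendsto_id.const_mul_atTop' (by norm_num)
  filter_upwards [hreg, hχ.1.2.1.ae, (hgrad_mem_L2pot hP hφ).1.2.1.ae,
    eventually_boxSum_le hP (measurable_variationAt hm) hlt] with ω h1 h2 h3 h4 h0
  filter_upwards [htend2.eventually (h1 h0), htend.eventually h4, eventually_ge_atTop 1,
    eventually_ge_atTop ⌈4 * C * 5 ^ d / ε⌉₊] with n hn1 hn2 hn3 hn4
  obtain ⟨a, ha⟩ := exists_poincare_ballF hCriso (by omega) hn1 (Ψ ω)
  refine ⟨a, ?_⟩
  have hn0 : (1 : ℝ) ≤ n := by exact_mod_cast hn3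
  set M := ⌊CW * ((2 * n : ℕ) : ℝ)⌋₊ with hM
  have hMle : (2 * (M : ℝ) + 1) ≤ 5 * CW * n := by
    have : (M : ℝ) ≤ CW * ((2 * n : ℕ) : ℝ) := Nat.floor_le (by positivity)
    push_cast at this
    nlinarith
  set X := ∑ y ∈ ballF ω 0 M, ∑ z ∈ nbrs y, if 0 < conductance ω y z then |Ψ ω y - Ψ ω z| else 0
    with hX
  have hXle : X ≤ δ * (5 * CW * n) ^ d := by
    have hsum : ENNReal.ofReal X = ∑ y ∈ ballF ω 0 M, variationAt Ψ (shift y ω) := by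
      rw [hX, ENNReal.ofReal_sum_of_nonneg fun y _ => Finset.sum_nonneg fun z _ => by
        split_ifs <;> positivity]
      refine Finset.sum_congr rfl fun y hy => ?_
      have hyc := (mem_ballF.1 hy).1
      rw [variationAt_shift hyc]
      intro z hz
      have e1 := h2 h0 y hyc z hz
      have e2 := h3 h0 y hyc z hz
      simp only [hΨ, Pi.sub_apply, e1, e2]
      ring
    have hle : ENNReal.ofReal X ≤ ENNReal.ofReal (δ * (2 * M + 1) ^ d) := by
      rw [hsum]
      refine (Finset.sum_le_sum_of_subset (ballF_subset_box ω 0 M)).trans (hn2.trans (le_of_eq ?_))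
      rw [ENNReal.ofReal_mul hδ0.le, ENNReal.ofReal_pow (by positivity)]
      congr 2
      rw [ENNReal.ofReal_add (by positivity) (by norm_num), ENNReal.ofReal_mul (by norm_num)]
      simp
    refine ((ENNReal.ofReal_le_ofReal_iff (by positivity)).1 hle).trans ?_
    gcongr
  have hosc : ∑ x ∈ ballF ω 0 (2 * n), |χ ω x - a| ≤
      ∑ x ∈ ballF ω 0 (2 * n), (|Ψ ω x - a| + 2 * C) := by
    refine Finset.sum_le_sum fun x _ => ?_
    have e1 : χ ω x - a = (Ψ ω x - a) + hgrad φ ω x := by simp only [hΨ, Pi.sub_apply]; ring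
    have e2 : |hgrad φ ω x| ≤ 2 * C := by
      have := (abs_sub (φ (shift x ω)) (φ ω)).trans (add_le_add (hC _) (hC _))
      simp only [hgrad]; linarith
    rw [e1]
    exact (abs_add_le _ _).trans (by linarith)
  have hC0 : 0 ≤ C := (abs_nonneg _).trans (hC ω)
  rw [Finset.sum_add_distrib, Finset.sum_const, nsmul_eq_mul] at hosc
  have hcard := card_ballF_two_mul_le ω hn3
  have hbd : ((ballF ω 0 (2 * n)).card : ℝ) * (2 * C) ≤ ε / 2 * n * (n : ℝ) ^ d := by
    have h5 : 4 * C * 5 ^ d / ε ≤ n := (Nat.le_ceil _).trans (by exact_mod_cast hn4)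
    rw [div_le_iff₀ hε] at h5
    calc _ ≤ 5 ^ d * (n : ℝ) ^ d * (2 * C) := by gcongr
      _ = (4 * C * 5 ^ d) / 2 * (n : ℝ) ^ d := by ring
      _ ≤ (n * ε) / 2 * (n : ℝ) ^ d := by gcongr
      _ = _ := by ring
  have hpo : ∑ x ∈ ballF ω 0 (2 * n), |Ψ ω x - a| ≤ ε / 2 * n * (n : ℝ) ^ d := by
    refine ha.trans ?_
    calc _ ≤ 2 * (((2 * n : ℕ) : ℝ) / Criso) * (δ * (5 * CW * n) ^ d) := by gcongr
      _ = (A * δ) * n * (n : ℝ) ^ d := by rw [hA, mul_pow]; push_cast; ring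
      _ = _ := by rw [hδ]; congr 2; field_simp
  linarith

/-- Here `K` depends on the law. This is enough for the qualitative sublinearity, but would not do
in the final constant. -/
theorem eventually_normalizedNorm_le [IsProbabilityMeasure P] (hP : LawAssumption P) {p : ℝ}
    (hp : 0 < p) {f : RandomField d} (hf0 : ∀ ω x, 0 ≤ f ω x) (hfm : Measurable fun ω => f ω 0)
    (hf : ∀ ω x, f (shift x ω) 0 = f ω x)
    (hfin : ∫⁻ ω, ENNReal.ofReal (f ω 0 ^ p) ∂P ≠ ⊤) :
    ∃ K : ℝ, ∀ᵐ ω ∂P, ∀ᶠ n : ℕ in atTop,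
      normalizedNorm ((n : ℝ) ^ d) p (ballF ω 0 (2 * n)) (f ω) ≤ K := by
  set I := (∫⁻ ω, ENNReal.ofReal (f ω 0 ^ p) ∂P).toReal with hI
  have hI0 : 0 ≤ I := ENNReal.toReal_nonneg
  set t : ℝ := 4 ^ d * I + 1 with ht
  have hlt : 4 ^ d * ∫⁻ ω, ENNReal.ofReal (f ω 0 ^ p) ∂P < ENNReal.ofReal t := by
    have : (4 : ℝ≥0∞) ^ d = ENNReal.ofReal (4 ^ d) := by
      rw [ENNReal.ofReal_pow (by norm_num)]; norm_num
    rw [← ENNReal.ofReal_toReal hfin, ← hI, this, ← ENNReal.ofReal_mul (by positivity)]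
    exact (ENNReal.ofReal_lt_ofReal_iff (by positivity)).2 (by linarith)
  refine ⟨(t * 5 ^ d) ^ (1 / p), ?_⟩
  have htend2 : Tendsto (fun n : ℕ => 2 * n) atTop atTop :=
    tendsto_id.const_mul_atTop' (by norm_num)
  filter_upwards [eventually_boxSum_le hP (hfm.pow_const p).ennreal_ofReal hlt] with ω hω
  filter_upwards [htend2.eventually hω, eventually_ge_atTop 1] with n hn hn1
  have hn0 : (1 : ℝ) ≤ n := by exact_mod_cast hn1
  have h1 : ENNReal.ofReal (∑ x ∈ ballF ω 0 (2 * n), f ω x ^ p) ≤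
      ENNReal.ofReal (t * (2 * ((2 * n : ℕ) : ℝ) + 1) ^ d) := by
    rw [ENNReal.ofReal_sum_of_nonneg fun x _ => Real.rpow_nonneg (hf0 ω x) p]
    refine (Finset.sum_le_sum_of_subset (ballF_subset_box ω 0 (2 * n))).trans
      (le_trans (le_of_eq ?_) (hn.trans (le_of_eq ?_)))
    · exact Finset.sum_congr rfl fun x _ => by simp only [hf]
    · rw [ENNReal.ofReal_mul (by positivity), ENNReal.ofReal_pow (by positivity)]
      congr 2
      rw [ENNReal.ofReal_add (by positivity) (by norm_num), ENNReal.ofReal_mul (by norm_num),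
        ENNReal.ofReal_natCast]
      simp
  have h2 := (ENNReal.ofReal_le_ofReal_iff (by positivity)).1 h1
  refine Real.rpow_le_rpow (mul_nonneg (by positivity)
    (Finset.sum_nonneg fun x _ => Real.rpow_nonneg (hf0 ω x) p)) ?_ (by positivity)
  rw [inv_mul_le_iff₀ (by positivity)]
  calc _ ≤ t * (2 * ((2 * n : ℕ) : ℝ) + 1) ^ d := h2
    _ ≤ t * (5 * n) ^ d := by gcongr; push_cast; linarith
    _ = _ := by rw [mul_pow]; ring

theorem normalizedNorm_nonneg {N p : ℝ} (hN : 0 ≤ N) {B : Finset (Site d)} {f : Site d → ℝ}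
    (hf : ∀ x, 0 ≤ f x) : 0 ≤ normalizedNorm N p B f :=
  Real.rpow_nonneg (mul_nonneg (by positivity)
    (Finset.sum_nonneg fun x _ => Real.rpow_nonneg (hf x) p)) _

end Sublinear

/-! ### Sublinearity of the corrector. -/

section Corrector
open scoped Classical
open Filter
variable {d : ℕ} {P : Measure (Env d)} {CV Criso CW θ : ℝ} {p q : ℝ}

theorem memLp_conductance {p : ℝ≥0∞} (h : ∀ e : Bond d, MemLp (fun ω : Env d => (ω e : ℝ)) p P)
    (x y : Site d) : MemLp (fun ω : Env d => (conductance ω x y : ℝ)) p P := by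
  unfold conductance
  by_cases hxy : (lattice d).Adj x y
  · simp only [hxy, dif_pos]; exact h _
  · simp [hxy]

theorem memLp_inv_conductance {q : ℝ≥0∞}
    (h : ∀ e : Bond d, MemLp (fun ω : Env d => if 0 < ω e then ((ω e : ℝ))⁻¹ else 0) q P)
    (x y : Site d) : MemLp (fun ω : Env d => (conductance ω x y : ℝ)⁻¹) q P := by
  unfold conductance
  by_cases hxy : (lattice d).Adj x y
  · simp only [hxy, dif_pos]
    refine (memLp_congr_ae (ae_of_all _ fun ω => ?_)).1
      (h ⟨s(x, y), (lattice d).mem_edgeSet.2 hxy⟩)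
    split_ifs with h0
    · rfl
    · rw [le_antisymm (not_lt.1 h0) zero_le]; simp
  · simp [hxy]

theorem memLp_mu {p : ℝ≥0∞} (h : ∀ e : Bond d, MemLp (fun ω : Env d => (ω e : ℝ)) p P)
    (x : Site d) : MemLp (fun ω : Env d => mu ω x) p P :=
  memLp_finsetSum _ fun y _ => memLp_conductance h x y

theorem memLp_nu {q : ℝ≥0∞}
    (h : ∀ e : Bond d, MemLp (fun ω : Env d => if 0 < ω e then ((ω e : ℝ))⁻¹ else 0) q P)
    (x : Site d) : MemLp (fun ω : Env d => nu ω x) q P := by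
  simp only [nu_eq_sum_inv]
  exact memLp_finsetSum _ fun y _ => memLp_inv_conductance h x y

theorem lintegral_ofReal_rpow_ne_top {f : Env d → ℝ} (hf0 : ∀ ω, 0 ≤ f ω) (hp : 0 < p)
    (hf : MemLp f (ENNReal.ofReal p) P) : ∫⁻ ω, ENNReal.ofReal (f ω ^ p) ∂P ≠ ⊤ := by
  have h1 := hf.integrable_norm_rpow (ENNReal.ofReal_pos.2 hp).ne' ENNReal.ofReal_ne_top
  rw [ENNReal.toReal_ofReal hp.le] at h1
  refine ne_of_lt (lt_of_le_of_lt (lintegral_mono fun ω => ?_) h1.lintegral_lt_top)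
  rw [Real.norm_of_nonneg (hf0 ω)]

theorem abs_position_sub_le (j : Fin d) (ω : Env d) {x y : Site d} (h : (lattice d).Adj x y) :
    |position j ω x - position j ω y| ≤ 1 := by
  have h1 : ∑ i, |x i - y i| = 1 := h
  have h2 : |x j - y j| ≤ 1 := h1 ▸ Finset.single_le_sum (f := fun i => |x i - y i|)
    (fun _ _ => abs_nonneg _) (Finset.mem_univ j)
  unfold position
  exact_mod_cast h2

/-- The corrector solves a Poisson equation on the infinite cluster. -/
theorem ae_poisson [IsProbabilityMeasure P] (hP : LawAssumption P) {j : Fin d}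
    {χ : RandomField d} (hχ : IsCorrector P j χ) : ∀ᵐ ω ∂P, ω ∈ Env0 d → ∀ x ∈ cluster ω,
      ∑ y ∈ nbrs x, (conductance ω x y : ℝ) * (χ ω x - χ ω y) =
        ∑ y ∈ nbrs x, (conductance ω x y : ℝ) * (position j ω x - position j ω y) := by
  filter_upwards [ae_harmonic hP hχ.2] with ω hω h0 x hx
  rw [← sub_eq_zero, ← Finset.sum_sub_distrib, ← hω h0 x hx]
  refine Finset.sum_congr rfl fun y _ => ?_
  simp only [Pi.sub_apply]
  ring

/-- Subtracting a constant and multiplying by a factor preserve the equation: the constant centres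
the corrector, the factor `1 / n` makes the increments of the right-hand side at most `1 / n`. -/
theorem poisson_scale {ω : Env d} {χ f : Site d → ℝ} {x : Site d} (a c : ℝ)
    (h : ∑ y ∈ nbrs x, (conductance ω x y : ℝ) * (χ x - χ y) =
        ∑ y ∈ nbrs x, (conductance ω x y : ℝ) * (f x - f y)) :
    ∑ y ∈ nbrs x, (conductance ω x y : ℝ) * (c * (χ x - a) - c * (χ y - a)) =
      ∑ y ∈ nbrs x, (conductance ω x y : ℝ) * (c * f x - c * f y) := by
  have e : ∀ (g : Site d → ℝ) (b : ℝ), ∑ y ∈ nbrs x, (conductance ω x y : ℝ) *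
      (c * (g x - b) - c * (g y - b)) = c * ∑ y ∈ nbrs x, (conductance ω x y : ℝ) * (g x - g y) := by
    intro g b
    rw [Finset.mul_sum]
    exact Finset.sum_congr rfl fun y _ => by ring
  have := e f 0
  simp only [sub_zero] at this
  rw [e, this, h]

theorem zero_mem_ballF {ω : Env d} (h0 : ω ∈ Env0 d) (n : ℕ) : (0 : Site d) ∈ ballF ω 0 n :=
  mem_ballF.2 ⟨h0, by simp⟩

theorem abs_scaled_position_le (j : Fin d) (ω : Env d) {n : ℕ} (hn : 1 ≤ n) {x y : Site d}
    (h : (lattice d).Adj x y) :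
    |1 / (n : ℝ) * position j ω x - 1 / (n : ℝ) * position j ω y| ≤ 1 / n := by
  have hn0 : (0 : ℝ) < n := by exact_mod_cast hn
  rw [← mul_sub, abs_mul, abs_of_nonneg (by positivity)]
  exact mul_le_of_le_one_right (by positivity) (abs_position_sub_le j ω h)

theorem ae_eventually_regular [IsProbabilityMeasure P] (hd : 2 ≤ d) (hθ' : θ < 1)
    (hC : ClusterAssumption CV Criso CW θ P) :
    ∀ᵐ ω ∂P, ω ∈ Env0 d → ∀ᶠ n : ℕ in atTop, IsRegularBall CV Criso CW ω 0 n := by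
  filter_upwards [ae_condLaw_iff.1 hC] with ω hω h0
  obtain ⟨N₀, hN₀⟩ := hω h0
  filter_upwards [eventually_ge_atTop N₀, eventually_ge_atTop 1] with n hn hn1
  refine hN₀ n hn 0 ⟨h0, by simp⟩ n ?_
  have hd' : (2 : ℝ) ≤ d := by exact_mod_cast hd
  have hn1' : (1 : ℝ) ≤ n := by exact_mod_cast hn1
  calc (n : ℝ) ^ (θ / d) ≤ (n : ℝ) ^ (1 : ℝ) := by
        refine Real.rpow_le_rpow_of_exponent_le hn1' ?_
        rw [div_le_one (by linarith)]; linarith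
    _ = n := Real.rpow_one _

theorem ae_eventually_volume
    (hreg : ∀ᵐ ω ∂P, ω ∈ Env0 d → ∀ᶠ n : ℕ in atTop, IsRegularBall CV Criso CW ω 0 n) :
    ∀ᵐ ω ∂P, ω ∈ Env0 d → ∀ᶠ n : ℕ in atTop,
      CV * (n : ℝ) ^ d ≤ (ballF ω 0 n).card := by
  filter_upwards [hreg] with ω hω h0
  filter_upwards [hω h0] with n hn
  have := hn.1
  rwa [← coe_ballF, Set.ncard_coe_finset] at this

/-- The corrector is sublinear. -/
theorem ae_sublinear [IsProbabilityMeasure P] (hd : 2 ≤ d) (hCV : 0 < CV) (hCV' : CV ≤ 1)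
    (hCriso : 0 < Criso) (hCW : 1 ≤ CW) (hθ : 0 < θ) (hθ' : θ < 1) (hp : 1 < p) (hq : 1 < q)
    (hpq : 1 / p + 1 / q < 2 * (1 - θ) / ((d : ℝ) - θ)) (hP : LawAssumption P)
    (hC : ClusterAssumption CV Criso CW θ P)
    (hM : MomentAssumption (ENNReal.ofReal p) (ENNReal.ofReal q) P) {j : Fin d}
    {χ : RandomField d} (hχ : IsCorrector P j χ) :
    ∀ᵐ ω ∂P, ω ∈ Env0 d → ∀ ε : ℝ, 0 < ε → ∀ᶠ n : ℕ in atTop,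
      ∀ x ∈ ballF ω 0 n, |χ ω x| ≤ ε * n := by
  obtain ⟨γ, hγ, κ, hκ, c, hc, H⟩ :=
    exists_maximal_inequality hd hCV hCV' hCriso hCW hθ hθ' hp hq hpq one_pos
  obtain ⟨K₁, hK₁⟩ := eventually_normalizedNorm_le hP (p := p) (by linarith) mu_nonneg
    (measurable_mu 0) (fun ω x => by rw [mu_shift, zero_add])
    (lintegral_ofReal_rpow_ne_top (fun ω => mu_nonneg ω 0) (by linarith) (memLp_mu hM.upper 0))
  obtain ⟨K₂, hK₂⟩ := eventually_normalizedNorm_le hP (p := q) (by linarith) nu_nonneg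
    (measurable_nu 0) (fun ω x => by rw [nu_shift, zero_add])
    (lintegral_ofReal_rpow_ne_top (fun ω => nu_nonneg ω 0) (by linarith) (memLp_nu hM.lower 0))
  have hnu : ∫⁻ ω, ENNReal.ofReal (nu ω 0) ∂P ≠ ⊤ := by
    refine (((memLp_nu hM.lower 0).integrable ?_).lintegral_lt_top).ne
    exact ENNReal.one_le_ofReal.2 hq.le
  have hosc : ∀ᵐ ω ∂P, ∀ k : ℕ, ω ∈ Env0 d → ∀ᶠ n : ℕ in atTop, ∃ a,
      ∑ x ∈ ballF ω 0 (2 * n), |χ ω x - a| ≤ 1 / ((k : ℝ) + 1) * n * (n : ℝ) ^ d :=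
    ae_all_iff.2 fun k => eventually_mean_oscillation_le hP hCriso hCW
      (ae_eventually_regular hd hθ' hC) hχ.1 hnu (by positivity)
  set Q : ℝ := c * (max 1 (K₁ * K₂)) ^ κ with hQ
  have hQ0 : 0 ≤ Q := by positivity
  filter_upwards [hK₁, hK₂, hosc, ae_poisson hP hχ, ae_condLaw_iff.1 hC, hχ.1.1.2.1.ae_zero]
    with ω h1 h2 h3 h4 h5 h6 h0 ε hε
  obtain ⟨N₀, hN₀⟩ := h5 h0
  have hlim : Tendsto (fun k : ℕ => 2 * (Q * (1 / ((k : ℝ) + 1)) ^ γ)) atTop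
      (nhds (2 * (Q * 0 ^ γ))) :=
    ((tendsto_one_div_add_atTop_nhds_zero_nat.rpow_const (Or.inr hγ.le)).const_mul Q).const_mul 2
  rw [Real.zero_rpow hγ.ne', mul_zero, mul_zero] at hlim
  obtain ⟨k, hk⟩ := (hlim.eventually_lt_const hε).exists
  filter_upwards [h1, h2, h3 k h0, eventually_ge_atTop N₀, eventually_ge_atTop 2]
    with n hn1 hn2 hn3 hn4 hn5 x hx
  obtain ⟨a, ha⟩ := hn3
  have hn0 : (0 : ℝ) < n := by exact_mod_cast (by omega : 0 < n)
  have hnd : (0 : ℝ) < (n : ℝ) ^ d := by positivity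
  have havg : ((n : ℝ) ^ d)⁻¹ * ∑ x ∈ ballF ω 0 (2 * n), |1 / (n : ℝ) * (χ ω x - a)| ^ (1 : ℝ) ≤
      1 / ((k : ℝ) + 1) := by
    simp only [Real.rpow_one, abs_mul, abs_of_nonneg (by positivity : (0 : ℝ) ≤ 1 / n)]
    rw [← Finset.mul_sum, inv_mul_le_iff₀ hnd, one_div_mul_eq_div, div_le_iff₀ hn0]
    linarith
  have hk1 : 1 / ((k : ℝ) + 1) ≤ 1 := by
    rw [div_le_one (by positivity)]; linarith [(Nat.cast_nonneg k : (0 : ℝ) ≤ k)]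
  have hH := H ω n (fun x => 1 / (n : ℝ) * (χ ω x - a)) (fun x => 1 / (n : ℝ) * position j ω x) hn5
    (hN₀ (2 * n) (by omega)) (fun x hx => poisson_scale a _ (h4 h0 x hx))
    (fun x y hxy => abs_scaled_position_le j ω (by omega) hxy) (havg.trans hk1)
  have hbound : ∀ x ∈ ballF ω 0 n, |1 / (n : ℝ) * (χ ω x - a)| ≤ Q * (1 / ((k : ℝ) + 1)) ^ γ := by
    intro x hx
    refine (hH x hx).trans ?_
    have e1 : 0 ≤ normalizedNorm ((n : ℝ) ^ d) p (ballF ω 0 (2 * n)) (mu ω) :=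
      normalizedNorm_nonneg hnd.le (mu_nonneg ω)
    have e2 : 0 ≤ normalizedNorm ((n : ℝ) ^ d) q (ballF ω 0 (2 * n)) (nu ω) :=
      normalizedNorm_nonneg hnd.le (nu_nonneg ω)
    have e3 : normalizedNorm ((n : ℝ) ^ d) p (ballF ω 0 (2 * n)) (mu ω) *
        normalizedNorm ((n : ℝ) ^ d) q (ballF ω 0 (2 * n)) (nu ω) ≤ K₁ * K₂ :=
      mul_le_mul hn1 hn2 e2 (e1.trans hn1)
    have e4 : 0 ≤ ((n : ℝ) ^ d)⁻¹ *
        ∑ x ∈ ballF ω 0 (2 * n), |1 / (n : ℝ) * (χ ω x - a)| ^ (1 : ℝ) := by positivity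
    rw [hQ]
    gcongr
  -- The corrector vanishes at the origin, so the bound there controls the constant `a / n` itself.
  -- The triangle inequality then costs the factor `2` provided for in the choice of `k`.
  have hx0 := hbound 0 (zero_mem_ballF h0 n)
  have hx1 := hbound x hx
  rw [h6 h0, zero_sub, abs_mul, abs_neg] at hx0
  rw [abs_mul] at hx1
  rw [abs_of_nonneg (by positivity : (0 : ℝ) ≤ 1 / n), one_div_mul_eq_div, div_le_iff₀ hn0] at hx0 hx1
  have e5 : |χ ω x| ≤ |χ ω x - a| + |a| := by
    have := abs_add_le (χ ω x - a) a
    rwa [sub_add_cancel] at this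
  nlinarith

/-- Rescaled averages of powers of the corrector are eventually at most one. -/
theorem ae_eventually_avg_le_one {χ : RandomField d} {α : ℝ} (hα : 0 < α)
    (h : ∀ᵐ ω ∂P, ω ∈ Env0 d → ∀ ε : ℝ, 0 < ε → ∀ᶠ n : ℕ in atTop,
      ∀ x ∈ ballF ω 0 n, |χ ω x| ≤ ε * n) :
    ∀ᵐ ω ∂P, ω ∈ Env0 d → ∀ᶠ n : ℕ in atTop,
      ((n : ℝ) ^ d)⁻¹ * ∑ x ∈ ballF ω 0 (2 * n), |1 / (n : ℝ) * χ ω x| ^ α ≤ 1 := by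
  filter_upwards [h] with ω hω h0
  -- Chosen so that `η^α = 5^(-d)`, which compensates the volume bound `5^d n^d` of the ball of
  -- radius `2n`.
  set η : ℝ := ((5 : ℝ) ^ d)⁻¹ ^ (1 / α) with hη
  have hη0 : 0 < η := by positivity
  have htend2 : Tendsto (fun n : ℕ => 2 * n) atTop atTop :=
    tendsto_id.const_mul_atTop' (by norm_num)
  filter_upwards [htend2.eventually (hω h0 (η / 2) (by positivity)), eventually_ge_atTop 1]
    with n hn hn1
  have hn0 : (0 : ℝ) < n := by exact_mod_cast hn1
  have hle : ∀ x ∈ ballF ω 0 (2 * n), |1 / (n : ℝ) * χ ω x| ^ α ≤ ((5 : ℝ) ^ d)⁻¹ := by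
    intro x hx
    have e1 : |1 / (n : ℝ) * χ ω x| ≤ η := by
      rw [abs_mul, abs_of_nonneg (by positivity : (0 : ℝ) ≤ 1 / n), one_div_mul_eq_div,
        div_le_iff₀ hn0]
      refine (hn x hx).trans (le_of_eq ?_)
      push_cast; ring
    calc _ ≤ η ^ α := Real.rpow_le_rpow (abs_nonneg _) e1 hα.le
      _ = _ := by rw [hη, ← Real.rpow_mul (by positivity), one_div_mul_cancel hα.ne', Real.rpow_one]
  rw [inv_mul_le_iff₀ (by positivity), mul_one]
  calc _ ≤ ∑ x ∈ ballF ω 0 (2 * n), ((5 : ℝ) ^ d)⁻¹ := Finset.sum_le_sum hle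
    _ = (ballF ω 0 (2 * n)).card * ((5 : ℝ) ^ d)⁻¹ := by rw [Finset.sum_const, nsmul_eq_mul]
    _ ≤ 5 ^ d * (n : ℝ) ^ d * ((5 : ℝ) ^ d)⁻¹ := by
      gcongr; exact card_ballF_two_mul_le ω hn1
    _ = _ := by field_simp

end Corrector

/-! ### From normalised sums to averaged norms. -/

section Averages
open scoped Classical
open Filter
variable {d : ℕ} {P : Measure (Env d)} {CV : ℝ}

theorem avgNorm_ofReal {p : ℝ} (hp : 0 < p) (B : Finset (Site d)) (f : Site d → ℝ) :
    avgNorm (ENNReal.ofReal p) B f = ((B.card : ℝ)⁻¹ * ∑ x ∈ B, |f x| ^ p) ^ (1 / p) := by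
  rw [avgNorm, if_neg ENNReal.ofReal_ne_top, ENNReal.toReal_ofReal hp.le, Set.ncard_coe_finset,
    finsum_mem_coe_finset]

theorem avgNorm_nonneg (p : ℝ≥0∞) (B : Finset (Site d)) (f : Site d → ℝ) : 0 ≤ avgNorm p B f := by
  unfold avgNorm
  split_ifs
  · exact Real.iSup_nonneg fun x => abs_nonneg _
  · rw [finsum_mem_coe_finset]; positivity

/-- An average of powers is at most the power of the maximum; this returns from a finite substitute
exponent to `⊤`. -/
theorem avgNorm_ofReal_le {p : ℝ} (hp : 0 < p) {p' : ℝ≥0∞} (h : p' = ENNReal.ofReal p ∨ p' = ⊤)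
    {B : Finset (Site d)} (hB : B.Nonempty) (f : Site d → ℝ) :
    avgNorm (ENNReal.ofReal p) B f ≤ avgNorm p' B f := by
  rcases h with rfl | rfl
  · exact le_rfl
  have h0 := avgNorm_nonneg ⊤ B f
  rw [avgNorm_ofReal hp]
  set s := avgNorm ⊤ B f with hs
  have hle : ∀ x ∈ B, |f x| ≤ s := by
    intro x hx
    rw [hs, avgNorm, if_pos rfl]
    exact le_ciSup (f := fun y : (B : Set (Site d)) => |f y|) (Set.finite_range _).bddAbove ⟨x, hx⟩
  have hc : (0 : ℝ) < B.card := by exact_mod_cast hB.card_pos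
  calc _ ≤ (s ^ p) ^ (1 / p) := by
        refine Real.rpow_le_rpow (by positivity) ?_ (by positivity)
        rw [inv_mul_le_iff₀ hc]
        calc _ ≤ ∑ x ∈ B, s ^ p :=
              Finset.sum_le_sum fun x hx => Real.rpow_le_rpow (abs_nonneg _) (hle x hx) hp.le
          _ = _ := by rw [Finset.sum_const, nsmul_eq_mul]
    _ = s := by rw [← Real.rpow_mul h0, mul_one_div_cancel hp.ne', Real.rpow_one]

/-- The analysis uses finite exponents, so `⊤` is replaced by a large real number at a cost of at
most `δ` in the reciprocal; a finite exponent is kept. -/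
theorem exists_finite_exponent {p : ℝ≥0∞} (hp : (p⁻¹).toReal < 1) (hp0 : 1 ≤ p) {δ : ℝ}
    (hδ : 0 < δ) :
    ∃ p' : ℝ, 1 < p' ∧ 1 / p' ≤ (p⁻¹).toReal + δ ∧ (p = ENNReal.ofReal p' ∨ p = ⊤) := by
  by_cases h : p = ⊤
  · refine ⟨max 2 (1 / δ), lt_max_of_lt_left (by norm_num), ?_, Or.inr h⟩
    rw [h, ENNReal.inv_top, ENNReal.toReal_zero, zero_add]
    exact (one_div_le hδ (by positivity)).1 (le_max_right _ _)
  · have h0 : 0 < p.toReal := ENNReal.toReal_pos (zero_lt_one.trans_le hp0).ne' h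
    rw [ENNReal.toReal_inv] at hp ⊢
    refine ⟨p.toReal, ?_, ?_, Or.inl (ENNReal.ofReal_toReal h).symm⟩
    · exact (inv_lt_one₀ h0).1 hp
    · rw [one_div]; linarith

/-- Normalized norms over balls of radius `2n` are controlled by averaged norms over balls of
radius `n`. -/
theorem eventually_normalizedNorm_le_avgNorm [IsProbabilityMeasure P] (hP : LawAssumption P)
    (hCV : 0 < CV)
    (hvol : ∀ᵐ ω ∂P, ω ∈ Env0 d → ∀ᶠ n : ℕ in atTop, CV * (n : ℝ) ^ d ≤ (ballF ω 0 n).card)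
    {p : ℝ} (hp : 0 < p) {f : RandomField d} (hf0 : ∀ ω x, 0 ≤ f ω x)
    (hfm : Measurable fun ω => f ω 0) (hf : ∀ ω x, f (shift x ω) 0 = f ω x)
    (hfin : ∫⁻ ω, ENNReal.ofReal (f ω 0 ^ p) ∂P ≠ ⊤) :
    ∀ᵐ ω ∂P, ω ∈ Env0 d → ∀ᶠ n : ℕ in atTop,
      normalizedNorm ((n : ℝ) ^ d) p (ballF ω 0 (2 * n)) (f ω) ≤
        (8 * 120 ^ d / CV * 3 ^ d) ^ (1 / p) *
          avgNorm (ENNReal.ofReal p) (ballF ω 0 n) (f ω) := by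
  have hvol' : ∀ᵐ ω ∂P, ω ∈ Env0 d → ∀ᶠ n : ℕ in atTop,
      (CV.toNNReal : ℝ≥0∞) * (n : ℝ≥0∞) ^ d ≤ (ballF ω 0 n).card := by
    filter_upwards [hvol] with ω hω h0
    filter_upwards [hω h0] with n hn
    have := ENNReal.ofReal_le_ofReal hn
    rw [ENNReal.ofReal_mul hCV.le, ENNReal.ofReal_pow (by positivity), ENNReal.ofReal_natCast,
      ENNReal.ofReal_natCast] at this
    exact this
  have hD := eventually_sum_ballF_two_mul_le hP (Real.toNNReal_pos.2 hCV) hvol'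
    (g := (Env0 d).indicator fun ω => ENNReal.ofReal (f ω 0 ^ p))
    ((hfm.pow_const p).ennreal_ofReal.indicator measurableSet_Env0)
    (fun ω hω => Set.indicator_of_notMem hω _) (by
      refine ne_top_of_le_ne_top hfin (lintegral_mono fun ω => ?_)
      exact Set.indicator_le_self _ _ ω)
  filter_upwards [hD] with ω hω h0
  filter_upwards [hω h0, eventually_ge_atTop 1] with n hn hn1
  have hn0 : (1 : ℝ) ≤ n := by exact_mod_cast hn1
  have hsum : ∀ m : ℕ, ∑ x ∈ ballF ω 0 m,
      (Env0 d).indicator (fun ω => ENNReal.ofReal (f ω 0 ^ p)) (shift x ω) =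
      ENNReal.ofReal (∑ x ∈ ballF ω 0 m, f ω x ^ p) := by
    intro m
    rw [ENNReal.ofReal_sum_of_nonneg fun x _ => Real.rpow_nonneg (hf0 ω x) p]
    refine Finset.sum_congr rfl fun x hx => ?_
    rw [Set.indicator_of_mem (shift_mem_Env0.2 (mem_ballF.1 hx).1), hf]
  have hS : ∀ m : ℕ, 0 ≤ ∑ x ∈ ballF ω 0 m, f ω x ^ p := fun m =>
    Finset.sum_nonneg fun x _ => Real.rpow_nonneg (hf0 ω x) p
  rw [hsum, hsum] at hn
  have hn' : ENNReal.ofReal (CV * ∑ x ∈ ballF ω 0 (2 * n), f ω x ^ p) ≤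
      ENNReal.ofReal (8 * 120 ^ d * ∑ x ∈ ballF ω 0 n, f ω x ^ p) := by
    rw [ENNReal.ofReal_mul hCV.le, ENNReal.ofReal_mul (by positivity),
      ENNReal.ofReal_mul (by norm_num), ENNReal.ofReal_pow (by norm_num)]
    simpa [ENNReal.ofReal] using hn
  have h1 := (ENNReal.ofReal_le_ofReal_iff (mul_nonneg (by positivity) (hS n))).1 hn'
  have hB : (0 : ℝ) < (ballF ω 0 n).card := by
    exact_mod_cast Finset.card_pos.2 ⟨0, zero_mem_ballF h0 n⟩
  have hcard : ((ballF ω 0 n).card : ℝ) ≤ 3 ^ d * (n : ℝ) ^ d := by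
    calc ((ballF ω 0 n).card : ℝ) ≤ (2 * n + 1) ^ d := by exact_mod_cast card_ballF_le ω 0 n
      _ ≤ (3 * n) ^ d := by gcongr; linarith
      _ = _ := mul_pow _ _ _
  rw [avgNorm_ofReal hp, ← Real.mul_rpow (by positivity) (by positivity)]
  refine Real.rpow_le_rpow (mul_nonneg (by positivity) (hS _)) ?_ (by positivity)
  simp only [abs_of_nonneg (hf0 ω _)]
  rw [inv_mul_le_iff₀ (by positivity)]
  calc _ ≤ 8 * 120 ^ d / CV * ∑ x ∈ ballF ω 0 n, f ω x ^ p := by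
        rw [div_mul_eq_mul_div, le_div_iff₀ hCV]; linarith
    _ = ((ballF ω 0 n).card : ℝ) *
        (8 * 120 ^ d / CV * (((ballF ω 0 n).card : ℝ)⁻¹ * ∑ x ∈ ballF ω 0 n, f ω x ^ p)) := by
        field_simp
    _ ≤ (3 ^ d * (n : ℝ) ^ d) *
        (8 * 120 ^ d / CV * (((ballF ω 0 n).card : ℝ)⁻¹ * ∑ x ∈ ballF ω 0 n, f ω x ^ p)) := by
        have := hS n
        gcongr
    _ = _ := by ring

theorem normalized_sum_rpow_le_avgNorm {α γ : ℝ} (hα : 0 < α) (hγ : 0 < γ) {ω : Env d}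
    (h0 : ω ∈ Env0 d) {n : ℕ} (hn : 1 ≤ n) (u : Site d → ℝ) :
    (((n : ℝ) ^ d)⁻¹ * ∑ x ∈ ballF ω 0 (2 * n), |u x| ^ α) ^ γ ≤
      ((5 : ℝ) ^ d) ^ γ * avgNorm (ENNReal.ofReal α) (ballF ω 0 (2 * n)) u ^ (α * γ) := by
  have hB : (0 : ℝ) < (ballF ω 0 (2 * n)).card := by
    exact_mod_cast Finset.card_pos.2 ⟨0, zero_mem_ballF h0 _⟩
  have hn0 : (0 : ℝ) < n := by exact_mod_cast hn
  have hcard := card_ballF_two_mul_le ω hn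
  rw [avgNorm_ofReal hα, ← Real.rpow_mul (by positivity),
    show 1 / α * (α * γ) = γ by field_simp, ← Real.mul_rpow (by positivity) (by positivity)]
  refine Real.rpow_le_rpow (by positivity) ?_ hγ.le
  rw [inv_mul_le_iff₀ (by positivity)]
  set S := ∑ x ∈ ballF ω 0 (2 * n), |u x| ^ α
  have hS : 0 ≤ S := by positivity
  calc S = ((ballF ω 0 (2 * n)).card : ℝ) * (((ballF ω 0 (2 * n)).card : ℝ)⁻¹ * S) := by field_simp
    _ ≤ (5 ^ d * (n : ℝ) ^ d) * (((ballF ω 0 (2 * n)).card : ℝ)⁻¹ * S) := by gcongr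
    _ = _ := by ring

theorem max_one_mul_le {a b C : ℝ} (hb : 0 ≤ b) (h : a ≤ C * b) :
    max 1 a ≤ max 1 C * max 1 b := by
  refine max_le (one_le_mul_of_one_le_of_one_le (le_max_left _ _) (le_max_left _ _)) (h.trans ?_)
  exact mul_le_mul (le_max_right _ _) (le_max_right _ _) hb (by positivity)

theorem MomentAssumption.mono [IsProbabilityMeasure P] {p q p' q' : ℝ≥0∞}
    (h : MomentAssumption p q P) (hp : p' ≤ p) (hq : q' ≤ q) : MomentAssumption p' q' P :=
  ⟨fun e => (h.upper e).mono_exponent hp, fun e => (h.lower e).mono_exponent hq⟩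

end Averages
end RCM

/-! ### Assembly of the maximal inequality for the corrector. -/

theorem mainTheorem9 (d : ℕ) (hd : 2 ≤ d)
    (CV Criso CW : ℝ) (hCV : 0 < CV) (hCV' : CV ≤ 1) (hCriso : 0 < Criso) (hCW : 1 ≤ CW)
    (θ : ℝ) (hθ : 0 < θ) (hθ' : θ < 1)
    (p q : ℝ≥0∞) (hp : 1 ≤ p) (hq : 1 ≤ q)
    (hpq : (p⁻¹).toReal + (q⁻¹).toReal < 2 * (1 - θ) / ((d : ℝ) - θ))
    (α : ℝ) (hα : 0 < α) :
    ∃ γ' : ℝ, 0 < γ' ∧ ∃ κ' : ℝ, 0 < κ' ∧ ∃ c : ℝ,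
      ∀ (P : Measure (Env d)) [IsProbabilityMeasure P],
        LawAssumption P → ClusterAssumption CV Criso CW θ P → MomentAssumption p q P →
        ∀ χ : Fin d → RandomField d, (∀ j, IsCorrector P j (χ j)) →
          ∀ᵐ ω ∂(condLaw P), ∃ N : ℕ, ∀ n : ℕ, N ≤ n → ∀ j : Fin d,
            ∀ x ∈ ball ω 0 (n : ℝ),
              |1 / (n : ℝ) * χ j ω x| ≤
                c * (max 1 (avgNorm p (ball ω 0 (n : ℝ)) (mu ω) *
                      avgNorm q (ball ω 0 (n : ℝ)) (nu ω))) ^ κ' *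
                  (avgNorm (ENNReal.ofReal α) (ball ω 0 (2 * (n : ℝ)))
                    (fun y => 1 / (n : ℝ) * χ j ω y)) ^ γ' := by
  have hd' : (2 : ℝ) ≤ d := by exact_mod_cast hd
  have hB1 : 2 * (1 - θ) / ((d : ℝ) - θ) < 1 := by
    rw [div_lt_one (by linarith)]; linarith
  have hp0 : 0 ≤ (p⁻¹).toReal := ENNReal.toReal_nonneg
  have hq0 : 0 ≤ (q⁻¹).toReal := ENNReal.toReal_nonneg
  -- A third of the slack: replacing both exponents costs at most `2 δ`, so the strict inequality
  -- survives.
  set δ : ℝ := (2 * (1 - θ) / ((d : ℝ) - θ) - ((p⁻¹).toReal + (q⁻¹).toReal)) / 3 with hδ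
  have hδ0 : 0 < δ := by rw [hδ]; linarith
  obtain ⟨s, hs1, hsδ, hps⟩ := exists_finite_exponent (by linarith) hp hδ0
  obtain ⟨t, ht1, htδ, hqt⟩ := exists_finite_exponent (by linarith) hq hδ0
  have hst : 1 / s + 1 / t < 2 * (1 - θ) / ((d : ℝ) - θ) := by linarith
  have hsp : ENNReal.ofReal s ≤ p := by rcases hps with h | h <;> simp [h]
  have htq : ENNReal.ofReal t ≤ q := by rcases hqt with h | h <;> simp [h]
  have hs0 : 0 < s := by linarith
  have ht0 : 0 < t := by linarith
  obtain ⟨γ, hγ, κ, hκ, c, hc, H⟩ :=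
    exists_maximal_inequality hd hCV hCV' hCriso hCW hθ hθ' hs1 ht1 hst hα
  set C₁ : ℝ := (8 * 120 ^ d / CV * 3 ^ d) ^ (1 / s) with hC₁
  set C₂ : ℝ := (8 * 120 ^ d / CV * 3 ^ d) ^ (1 / t) with hC₂
  have hC₁0 : 0 ≤ C₁ := by positivity
  have hC₂0 : 0 ≤ C₂ := by positivity
  -- The network estimate carries the power `γ` of an average of `|u|^α`, which is the power `α γ`
  -- of the norm. In the constant, `max 1 (C₁ * C₂) ^ κ` pays for passing from `B(2n)` to `B(n)` in
  -- the weights, and `5^(d γ)` for `|B(2n)| ≤ 5^d n^d`. All are fixed before the law `P`.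
  refine ⟨α * γ, by positivity, κ, hκ, c * max 1 (C₁ * C₂) ^ κ * ((5 : ℝ) ^ d) ^ γ, ?_⟩
  intro P _ hP hC hM χ hχ
  have hM' := hM.mono hsp htq
  have hreg := ae_eventually_regular hd hθ' hC
  have hvol := ae_eventually_volume hreg
  have hmu := eventually_normalizedNorm_le_avgNorm hP hCV hvol hs0 mu_nonneg
    (measurable_mu 0) (fun ω x => by rw [mu_shift, zero_add])
    (lintegral_ofReal_rpow_ne_top (fun ω => mu_nonneg ω 0) hs0 (memLp_mu hM'.upper 0))
  have hnu := eventually_normalizedNorm_le_avgNorm hP hCV hvol ht0 nu_nonneg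
    (measurable_nu 0) (fun ω x => by rw [nu_shift, zero_add])
    (lintegral_ofReal_rpow_ne_top (fun ω => nu_nonneg ω 0) ht0 (memLp_nu hM'.lower 0))
  have hsmall := ae_all_iff.2 fun j => ae_eventually_avg_le_one hα
    (ae_sublinear hd hCV hCV' hCriso hCW hθ hθ' hs1 ht1 hst hP hC hM' (hχ j))
  have hpoisson := ae_all_iff.2 fun j => ae_poisson hP (hχ j)
  rw [ae_condLaw_iff]
  filter_upwards [hmu, hnu, hsmall, hpoisson, ae_condLaw_iff.1 hC] with ω h1 h2 h3 h4 h5 h0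
  obtain ⟨N₀, hN₀⟩ := h5 h0
  refine Filter.eventually_atTop.1 ?_
  filter_upwards [h1 h0, h2 h0, Filter.eventually_all.2 fun j => h3 j h0,
    Filter.eventually_ge_atTop N₀, Filter.eventually_ge_atTop 2] with n hn1 hn2 hn3 hn4 hn5 j x hx
  rw [show 2 * (n : ℝ) = ((2 * n : ℕ) : ℝ) by push_cast; rfl, ← coe_ballF, ← coe_ballF]
  rw [← coe_ballF] at hx
  have hB : (ballF ω 0 n).Nonempty := ⟨0, zero_mem_ballF h0 n⟩
  have hH := H ω n (fun x => 1 / (n : ℝ) * χ j ω x) (fun x => 1 / (n : ℝ) * position j ω x) hn5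
    (hN₀ (2 * n) (by omega))
    (fun x hx => by simpa only [sub_zero] using poisson_scale 0 (1 / (n : ℝ)) (h4 j h0 x hx))
    (fun x y hxy => abs_scaled_position_le j ω (by omega) hxy) (hn3 j) x hx
  refine hH.trans ?_
  have hnd : (0 : ℝ) ≤ (n : ℝ) ^ d := by positivity
  have hμ0 := avgNorm_nonneg p (ballF ω 0 n) (mu ω)
  have hν0 := avgNorm_nonneg q (ballF ω 0 n) (nu ω)
  have e1 : normalizedNorm ((n : ℝ) ^ d) s (ballF ω 0 (2 * n)) (mu ω) ≤
      C₁ * avgNorm p (ballF ω 0 n) (mu ω) :=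
    hn1.trans (mul_le_mul_of_nonneg_left (avgNorm_ofReal_le hs0 hps hB _) hC₁0)
  have e2 : normalizedNorm ((n : ℝ) ^ d) t (ballF ω 0 (2 * n)) (nu ω) ≤
      C₂ * avgNorm q (ballF ω 0 n) (nu ω) :=
    hn2.trans (mul_le_mul_of_nonneg_left (avgNorm_ofReal_le ht0 hqt hB _) hC₂0)
  have e3 := max_one_mul_le (mul_nonneg hμ0 hν0)
    ((mul_le_mul e1 e2 (normalizedNorm_nonneg hnd (nu_nonneg ω)) (by positivity)).trans_eq
      (mul_mul_mul_comm C₁ _ C₂ _))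
  have e4 := Real.rpow_le_rpow (by positivity) e3 hκ.le
  rw [Real.mul_rpow (by positivity) (by positivity)] at e4
  have e5 := normalized_sum_rpow_le_avgNorm hα hγ h0 (by omega : 1 ≤ n)
    fun x => 1 / (n : ℝ) * χ j ω x
  refine (mul_le_mul (mul_le_mul_of_nonneg_left e4 hc) e5 (by positivity) (by positivity)).trans
    (le_of_eq ?_)
  ring
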